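/- \textbf{Conventions.} A Boolean constraint language is a (possibly infinite) family $\Gamma=\{R_i\}_{i\in\mathbb N}$ of relations; $R_i$ has finite arity $r_i$, and, identifying a Boolean tuple with the set of its $1$-positions, $R_i$ is a set of subsets of $[r_i]=\{1,\dots,r_i\}$. $\Gamma$ is \emph{fpt-membership-checkable} if there are a Turing machine $B$, a computable function $f$ and a polynomial $p$ such that for every index $i$ and every $T\subseteq[r_i]$, the machine $B$ on input $(i,T)$ (index and positions written in binary) decides whether $T\in R_i$ in at most $f(|T|)\cdot p(N)$ steps, where $N$ is the length of the input. An instance of $\mathrm{CSP}(\Gamma)_k$ consists of a finite set $V$ of variables, an integer $k_0\ge 0$ (the parameter), and a finite sequence of constraints $R_i\langle v_1,\dots,v_{r_i}\rangle$ with $v_1,\dots,v_{r_i}\in V$ (repetitions allowed). It is written as a string by writing $k_0$ in binary, listing the variables, and listing each constraint as its index in binary followed by its list of variables. It is a yes-instance if there is a set $D\subseteq V$ with $|D|=k_0$ (the constraint $W^{\{k_0\}}_{|V|}\langle V\rangle$, where $W^A_m$ is the set of all $T\subseteq[m]$ with $|T|\in A$) such that $\{j: v_j\in D\}\in R_i$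 for each of its constraints $R_i\langle v_1,\dots,v_{r_i}\rangle$. A parameterized problem has a parameter that is computable in polynomial time from the input. $\mathrm W[1]$ is the class of parameterized problems that are fpt-reducible to $p\text{-}\mathrm{WD}_\varphi$ for some formula $\varphi(X)=\forall x_1\cdots\forall x_\ell\,\psi$, with $\psi$ quantifier-free, over a finite relational vocabulary with one additional relation variable $X$ of some arity $s\geq 1$; here $p\text{-}\mathrm{WD}_\varphi$ asks, given a finite nonempty structure $\mathcal A$ with universe $A$ and an integer $k\ge1$ (the parameter), whether there is $S\subseteq A^s$ with $|S|=k$ and $\mathcal A\models\varphi(S)$. An fpt-reduction maps inputs to inputs, preserves the answer, is computable by a Turing machine in at most $g(k)\cdot p(n)$ steps with $g$ computable and $p$ a polynomial ($k$ the parameter and $n$ the length of the input), and maps inputs with parameter $k$ to inputs with parameter at most $h(k)$, with $h$ computable. \textbf{Theorem.} Let $\Gamma=\{R_i\}_{i\in\mathbb N}$ be a possibly infinite, fpt-membership-checkable Boolean constraint language. Suppose that there is an integer $d\ge 1$ such that $|T|\le d$ for every $i$ and every $T\in R_i$. Then $\mathrm{CSP}(\Gamma)_k$ is in $\mathrm W[1]$.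 This holds for the problem whose inputs are the (encodings of) instances, with no assumption on how hard it is to recognize them. If moreover it can be decided in polynomial time whether a string encodes an instance (so in particular whether each constraint has the right number of variables), it also holds for the problem on all strings, in which exactly the encodings of yes-instances are accepted and strings that encode no instance have parameter $0$. -/

import Mathlib

namespace ParamCSP

/-! ### Strings -/

/-- The finite alphabet over which all inputs and outputs are written: two binary digits
and three separators. -/
inductive Sym
  | zero
  | one
  | comma
  | semi
  | bar
  deriving DecidableEq

/-- One Boolean value, written as one digit. -/
def encBool (b : Bool) : List Sym :=
  [if b then Sym.one else Sym.zero]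

/-- A natural number in binary (least significant digit first), terminated by a comma. -/
def encNat (n : ℕ) : List Sym :=
  n.bits.map (fun b => if b then Sym.one else Sym.zero) ++ [Sym.comma]

/-- A list of natural numbers in binary, terminated by a semicolon. -/
def encNats (l : List ℕ) : List Sym :=
  l.flatMap encNat ++ [Sym.semi]

/-! ### Parameterized problems, running times, fpt-reductions -/

/-- A parameterized decision problem: instances, their encodings as strings, the
yes-instances, and the parameter. As in Mathlib's `Turing.TM2ComputableInPolyTime`,
algorithms are run on the encodings of instances. -/
structure ParamProblem where
  Inst : Type
  encode : Inst → List Sym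
  yes : Inst → Prop
  param : Inst → ℕ

/-- `f` is computed, through the encodings `ea` and `eb`, by a Turing machine that takes at
most `time a` steps on the encoding of `a`. -/
def ComputableWithin {α β : Type} (ea : α → List Sym) (eb : β → List Sym) (f : α → β)
    (time : α → ℕ) : Prop :=
  ∃ M : Turing.TM2ComputableAux Sym Sym, ∀ a : α,
    Nonempty (Turing.TM2OutputsInTime M.tm ((ea a).map M.inputAlphabet.invFun)
      (some ((eb (f a)).map M.outputAlphabet.invFun)) (time a))

/-- `f` is computable in polynomial time. -/
def PolyTimeComputable {α β : Type} (ea : α → List Sym) (eb : β → List Sym) (f : α → β) : Prop :=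
  ∃ p : Polynomial ℕ, ComputableWithin ea eb f (fun a => p.eval (ea a).length)

/-- `f` is computable by an fpt-algorithm with respect to `κ`: in at most
`g (κ a) * p (length of the input a)` steps, where `g` is computable and `p` is a polynomial. -/
def FPTComputable {α β : Type} (ea : α → List Sym) (eb : β → List Sym) (κ : α → ℕ)
    (f : α → β) : Prop :=
  ∃ (g : ℕ → ℕ) (p : Polynomial ℕ), Computable g ∧
    ComputableWithin ea eb f (fun a => g (κ a) * p.eval (ea a).length)

namespace ParamProblem

/-- The parameter is computable in polynomial time. -/
def PolyTimeParam (P : ParamProblem) : Prop :=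
  PolyTimeComputable P.encode encNat P.param

/-- `P ≤^fpt Q`: there is an fpt-reduction from `P` to `Q`. -/
def FPTReducible (P Q : ParamProblem) : Prop :=
  ∃ R : P.Inst → Q.Inst,
    (∀ x, P.yes x ↔ Q.yes (R x)) ∧
    FPTComputable P.encode Q.encode P.param R ∧
    ∃ h : ℕ → ℕ, Computable h ∧ ∀ x, Q.param (R x) ≤ h (P.param x)

open Classical in
/-- It can be decided in polynomial time whether a string encodes an instance of `P`. -/
def PolyTimeRecognizable (P : ParamProblem) : Prop :=
  PolyTimeComputable (id : List Sym → List Sym) encBool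
    (fun w => decide (∃ x, P.encode x = w))

/-- `P` as a set of strings: every string is an input, the yes-inputs are the encodings of the
yes-instances, and strings that encode no instance get parameter `0`. -/
noncomputable def asLanguage (P : ParamProblem) : ParamProblem where
  Inst := List Sym
  encode := id
  yes w := ∃ x, P.encode x = w ∧ P.yes x
  param w := sInf {k | ∃ x, P.encode x = w ∧ P.param x = k}

end ParamProblem

/-! ### The class W[1] -/

/-- The relational first-order language with one symbol of arity `ar i` for every `i : ι`. -/
def relLang {ι : Type} (ar : ι → ℕ) : FirstOrder.Language where
  Functions _ := Empty
  Relations n := {i : ι // ar i = n}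

/-- The interpretation of `relLang ar` in `A` that is given by the relations `I i`. -/
abbrev relStructure {ι : Type} (ar : ι → ℕ) {A : Type} (I : ∀ i, Set (Fin (ar i) → A)) :
    (relLang ar).Structure A where
  funMap := fun f _ => Empty.elim f
  RelMap := fun r v => (fun j => v (Fin.cast r.2 j)) ∈ I r.1

/-- A finite nonempty structure, with universe `Fin size`, for the vocabulary with relation
symbols of arities `ar i`; the tuples of every relation are listed. -/
structure FinStructure {m : ℕ} (ar : Fin m → ℕ) where
  size : ℕ
  size_pos : 0 < size
  rel : ∀ i, List (Fin (ar i) → Fin size)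

/-- The arities of the vocabulary extended by one relation variable (`none`) of arity `s`. -/
def withVar {m : ℕ} (ar : Fin m → ℕ) (s : ℕ) : Option (Fin m) → ℕ
  | none => s
  | some i => ar i

/-- The interpretation of the vocabulary by `A` and of the relation variable by `S`. -/
def FinStructure.interp {m : ℕ} {ar : Fin m → ℕ} (A : FinStructure ar) {s : ℕ}
    (S : Finset (Fin s → Fin A.size)) :
    ∀ o : Option (Fin m), Set (Fin (withVar ar s o) → Fin A.size)
  | none => {v | v ∈ S}
  | some i => {v | v ∈ A.rel i}

/-- `A ⊨ φ(S)`. -/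
def FinStructure.Sat {m : ℕ} {ar : Fin m → ℕ} (A : FinStructure ar) {s : ℕ}
    (φ : (relLang (withVar ar s)).Sentence) (S : Finset (Fin s → Fin A.size)) : Prop :=
  @FirstOrder.Language.Sentence.Realize (relLang (withVar ar s)) (Fin A.size)
    (relStructure (withVar ar s) (A.interp S)) φ

/-- An instance of a weighted definability problem: a finite structure and a positive integer. -/
structure WDInst {m : ℕ} (ar : Fin m → ℕ) where
  str : FinStructure ar
  weight : ℕ
  weight_pos : 0 < weight

/-- The number `k`, the list of the elements, and for every relation symbol the list of its
tuples. -/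
def WDInst.encode {m : ℕ} {ar : Fin m → ℕ} (J : WDInst ar) : List Sym :=
  encNat J.weight ++ encNats (List.range J.str.size) ++
    (List.finRange m).flatMap (fun i =>
      (J.str.rel i).flatMap (fun t => encNats (List.ofFn (fun j => (t j : ℕ)))) ++ [Sym.bar])

/-- The weighted definability problem `p-WD_φ` of a formula `φ(X)` with one free relation
variable `X` of arity `s`: given a finite structure `A` and a positive integer `k`, is there a
relation `S` with exactly `k` tuples such that `A ⊨ φ(S)`? The parameter is `k`. -/
def weightedDefinability {m : ℕ} (ar : Fin m → ℕ) (s : ℕ)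
    (φ : (relLang (withVar ar s)).Sentence) : ParamProblem where
  Inst := WDInst ar
  encode := WDInst.encode
  yes J := ∃ S : Finset (Fin s → Fin J.str.size), S.card = J.weight ∧ J.str.Sat φ S
  param J := J.weight

/-- `W[1]`: the parameterized problems that are fpt-reducible to `p-WD_φ` for some
`Π₁`-formula `φ(X)`, that is, a formula of the form `∀ x₁ … ∀ xₗ ψ` with `ψ` quantifier-free. -/
def InW1 (P : ParamProblem) : Prop :=
  P.PolyTimeParam ∧
  ∃ (m : ℕ) (ar : Fin m → ℕ) (s : ℕ) (φ : (relLang (withVar ar s)).Sentence),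
    (∀ i, 0 < ar i) ∧ 0 < s ∧ FirstOrder.Language.BoundedFormula.IsUniversal φ ∧
    P.FPTReducible (weightedDefinability ar s φ)

/-! ### Boolean constraint languages -/

/-- A Boolean constraint language `Γ = {R_i}`: `R_i` has arity `arity i`, and a Boolean tuple is
identified with the set of its 1-positions. Repetitions `R_i = R_j` are allowed, so `Γ` may be a
finite or an infinite set of relations. -/
structure BoolConstraintLanguage where
  arity : ℕ → ℕ
  rel : ∀ i, Set (Finset (Fin (arity i)))

/-- The symmetric relation `W^A_m` of arity `m`, with set `A` of permitted weights. -/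
def weightRel (A : Set ℕ) (m : ℕ) : Set (Finset (Fin m)) :=
  {T | T.card ∈ A}

namespace BoolConstraintLanguage

/-- The inputs `(i, T)`, with `T` a set of positions of `R_i`, of a membership checker. -/
structure Query (Γ : BoolConstraintLanguage) where
  idx : ℕ
  set : Finset (Fin (Γ.arity idx))

/-- The index in binary, followed by the increasing list of the positions in `T`. -/
def Query.encode {Γ : BoolConstraintLanguage} (q : Γ.Query) : List Sym :=
  encNat q.idx ++ encNats (q.set.sort.map (fun j => (j : ℕ)))

open Classical in
/-- There is an fpt-algorithm that decides, given `(i, T)` with `T` a set of positions of `R_i`,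
whether `T ∈ R_i`; the parameter is `|T|`. -/
def FPTMembershipCheckable (Γ : BoolConstraintLanguage) : Prop :=
  FPTComputable (Query.encode (Γ := Γ)) encBool (fun q => q.set.card)
    (fun q => decide (q.set ∈ Γ.rel q.idx))

end BoolConstraintLanguage

/-! ### Constraint satisfaction with the weight parameter -/

/-- The assignment `D` satisfies the constraint `R⟨ω⟩`. -/
def Satisfies {r n : ℕ} (R : Set (Finset (Fin r))) (ω : Fin r → Fin n) (D : Finset (Fin n)) :
    Prop :=
  Finset.univ.filter (fun j => ω j ∈ D) ∈ R

/-- A constraint `R_i⟨v_1, …, v_r⟩` over the variables `Fin n`. -/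
structure Constraint (Γ : BoolConstraintLanguage) (n : ℕ) where
  idx : ℕ
  scope : Fin (Γ.arity idx) → Fin n

/-- An instance of `CSP(Γ)_k`: the set `V = Fin numVars` of variables, the number `k₀` of the first
constraint `W_{|V|}^{{k₀}}⟨v_1, …, v_{|V|}⟩`, and the sequence of the further constraints,
which are constraints for `Γ`. -/
structure CSPInst (Γ : BoolConstraintLanguage) where
  numVars : ℕ
  weight : ℕ
  constraints : List (Constraint Γ numVars)

/-- The number `k₀`, the list of the variables, and every constraint as its index followed by the
list of its variables. -/
def CSPInst.encode {Γ : BoolConstraintLanguage} (I : CSPInst Γ) : List Sym :=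
  encNat I.weight ++ encNats (List.range I.numVars) ++
    I.constraints.flatMap (fun c =>
      encNat c.idx ++ encNats (List.ofFn (fun j => (c.scope j : ℕ))))

/-- The assignment `D` satisfies every constraint of `I`, the first constraint included. -/
def CSPInst.SatisfiedBy {Γ : BoolConstraintLanguage} (I : CSPInst Γ)
    (D : Finset (Fin I.numVars)) : Prop :=
  Satisfies (weightRel {I.weight} I.numVars) id D ∧
    ∀ c ∈ I.constraints, Satisfies (Γ.rel c.idx) c.scope D

/-- The parameterized problem `CSP(Γ)_k`. -/
def weightCSP (Γ : BoolConstraintLanguage) : ParamProblem where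
  Inst := CSPInst Γ
  encode := CSPInst.encode
  yes I := ∃ D, I.SatisfiedBy D
  param I := I.weight

end ParamCSP

namespace ParamCSP

open Turing

instance : Fintype Sym :=
  ⟨{Sym.zero, Sym.one, Sym.comma, Sym.semi, Sym.bar}, fun x => by cases x <;> simp⟩

/-! ### Fragments of stack machines -/

/-- A family of machines that may be called by programs. -/
structure MachineFamily (J : Type) where
  machine : J → TM2ComputableAux Sym Sym

instance (J : Type) : CoeFun (MachineFamily J) fun _ => J → TM2ComputableAux Sym Sym :=
  ⟨MachineFamily.machine⟩

section Routines

/-- The work stacks. -/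
inductive Reg
  | D
  | A
  | B
  | C
  deriving DecidableEq

instance : Fintype Reg := ⟨{Reg.D, Reg.A, Reg.B, Reg.C}, fun x => by cases x <;> simp⟩

variable {J : Type} [DecidableEq J] (O : MachineFamily J)

/-- The stackMap of a machine with the four work stacks and all the stacks of the machines `O j`. -/
abbrev Stk : Type := Reg ⊕ (Σ j, (O j).tm.K)

/-- The stack alphabets. -/
abbrev Alph : Stk O → Type
  | .inl _ => Sym
  | .inr p => (O p.1).tm.Γ p.2

/-- The internal states: the last symbol read, and the states of the machines `O j`. -/
abbrev St : Type := Option Sym × (∀ j, (O j).tm.σ)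

/-- The initial states of the machines `O j`. -/
def initSt : ∀ j, (O j).tm.σ := fun j => (O j).tm.initialState

/-- A program fragment with one entry and one exit, whose labels may be placed anywhere in a
bigger program. -/
structure Routine where
  Λ : Type
  fin : Fintype Λ
  entry : Λ
  code : ∀ L : Type, (Λ → L) → L → Λ → TM2.Stmt (Alph O) L (St O)

attribute [instance] Routine.fin

variable {O}

/-- The machine reaches the configuration `c'` from `c` in `n` steps. -/
def StepsTo {L : Type} (M : L → TM2.Stmt (Alph O) L (St O)) (n : ℕ)
    (c c' : TM2.Cfg (Alph O) L (St O)) : Prop :=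
  (flip bind (TM2.step M))^[n] (some c) = some c'

theorem StepsTo.trans {L : Type} {M : L → TM2.Stmt (Alph O) L (St O)} {n n' : ℕ}
    {c c' c'' : TM2.Cfg (Alph O) L (St O)} (h : StepsTo M n c c') (h' : StepsTo M n' c' c'') :
    StepsTo M (n' + n) c c'' := by
  unfold StepsTo at *
  rw [Function.iterate_add_apply, h, h']

theorem StepsTo.single {L : Type} {M : L → TM2.Stmt (Alph O) L (St O)}
    {c c' : TM2.Cfg (Alph O) L (St O)} (h : TM2.step M c = some c') : StepsTo M 1 c c' := by
  simpa [StepsTo, flip] using h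

/-- Started with the stacks `S`, the fragment reaches its exit with the stacks `S'` after at most
`t` steps. -/
def Routine.Runs (r : Routine O) (S : ∀ k, List (Alph O k)) (t : ℕ)
    (S' : ∀ k, List (Alph O k)) : Prop :=
  ∀ (L : Type) (M : L → TM2.Stmt (Alph O) L (St O)) (emb : r.Λ → L) (exit : L),
    (∀ l, M (emb l) = r.code L emb exit l) → ∀ v, ∃ v' n, n ≤ t ∧
      StepsTo M n ⟨some (emb r.entry), (v, initSt O), S⟩ ⟨some exit, (v', initSt O), S'⟩

variable {S S' S'' : ∀ k, List (Alph O k)} {t t' : ℕ}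

theorem Routine.Runs.mono {r : Routine O} (h : r.Runs S t S') (ht : t ≤ t') : r.Runs S t' S' := by
  intro L M emb exit hM v
  obtain ⟨v', n, hn, hs⟩ := h L M emb exit hM v
  exact ⟨v', n, hn.trans ht, hs⟩

namespace Routine

/-- Push a fixed symbol. -/
def push (k : Stk O) (a : Alph O k) : Routine O where
  Λ := Unit
  fin := inferInstance
  entry := ()
  code _ _ exit _ := .push k (fun _ => a) (.goto fun _ => exit)

theorem Runs.push (k : Stk O) (a : Alph O k) :
    (Routine.push k a).Runs S 1 (Function.update S k (a :: S k)) := by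
  intro L M emb exit hM v
  refine ⟨v, 1, le_rfl, StepsTo.single ?_⟩
  change some (TM2.stepAux (M (emb ())) _ _) = _
  rw [hM ()]
  simp [Routine.push]

/-- Run one fragment after the other. -/
def seq (r₁ r₂ : Routine O) : Routine O where
  Λ := r₁.Λ ⊕ r₂.Λ
  fin := inferInstance
  entry := .inl r₁.entry
  code L emb exit
    | .inl l => r₁.code L (emb ∘ .inl) (emb (.inr r₂.entry)) l
    | .inr l => r₂.code L (emb ∘ .inr) exit l

theorem Runs.seq {r₁ r₂ : Routine O} (h₁ : r₁.Runs S t S') (h₂ : r₂.Runs S' t' S'') :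
    (r₁.seq r₂).Runs S (t + t') S'' := by
  intro L M emb exit hM v
  obtain ⟨v', n, hn, hs⟩ := h₁ L M (emb ∘ .inl) (emb (.inr r₂.entry)) (fun l => hM (.inl l)) v
  obtain ⟨v'', n', hn', hs'⟩ := h₂ L M (emb ∘ .inr) exit (fun l => hM (.inr l)) v'
  exact ⟨v'', n' + n, by omega, hs.trans hs'⟩

/-- Pop a symbol and continue according to what it was. -/
def popCase (k : Stk O) (e : Alph O k → Sym) (f : Option Sym → Routine O) : Routine O where
  Λ := Option (Σ s, (f s).Λ)
  fin := inferInstance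
  entry := none
  code L emb exit
    | none => .pop k (fun s o => (o.map e, s.2)) (.goto fun s => emb (some ⟨s.1, (f s.1).entry⟩))
    | some ⟨s, l⟩ => (f s).code L (fun l => emb (some ⟨s, l⟩)) exit l

theorem Runs.popCase {k : Stk O} {e : Alph O k → Sym} {f : Option Sym → Routine O}
    (h : (f ((S k).head?.map e)).Runs (Function.update S k (S k).tail) t S') :
    (Routine.popCase k e f).Runs S (t + 1) S' := by
  intro L M emb exit hM v
  obtain ⟨v', n, hn, hs⟩ := h L M _ exit (fun l => hM (some ⟨_, l⟩)) ((S k).head?.map e)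
  refine ⟨v', n + 1, by omega, StepsTo.trans (StepsTo.single ?_) hs⟩
  change some (TM2.stepAux (M (emb none)) _ _) = _
  rw [hM none]
  simp only [Routine.popCase, TM2.stepAux]

/-- Pop symbols, and run for each of them the fragment that it selects, until a symbol (or the
bottom of the stack) is found that satisfies `isEnd`. -/
def loop (k : Stk O) (e : Alph O k → Sym) (isEnd : Option Sym → Bool)
    (f : Option Sym → Routine O) : Routine O where
  Λ := Option (Σ s, (f s).Λ)
  fin := inferInstance
  entry := none
  code L emb exit
    | none => .pop k (fun s o => (o.map e, s.2))
        (.goto fun s => if isEnd s.1 then exit else emb (some ⟨s.1, (f s.1).entry⟩))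
    | some ⟨s, l⟩ => (f s).code L (fun l => emb (some ⟨s, l⟩)) (emb none) l

theorem Runs.loop_stop {k : Stk O} {e : Alph O k → Sym} {isEnd : Option Sym → Bool}
    {f : Option Sym → Routine O} (h : isEnd ((S k).head?.map e) = true) :
    (Routine.loop k e isEnd f).Runs S 1 (Function.update S k (S k).tail) := by
  intro L M emb exit hM v
  refine ⟨(S k).head?.map e, 1, le_rfl, StepsTo.single ?_⟩
  change some (TM2.stepAux (M (emb none)) _ _) = _
  rw [hM none]
  simp only [Routine.loop, TM2.stepAux, h, if_true]

theorem Runs.loop_step {k : Stk O} {e : Alph O k → Sym} {isEnd : Option Sym → Bool}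
    {f : Option Sym → Routine O} (h : isEnd ((S k).head?.map e) = false)
    (hf : (f ((S k).head?.map e)).Runs (Function.update S k (S k).tail) t S')
    (hl : (Routine.loop k e isEnd f).Runs S' t' S'') :
    (Routine.loop k e isEnd f).Runs S (t + t' + 1) S'' := by
  intro L M emb exit hM v
  obtain ⟨v', n, hn, hs⟩ := hf L M _ (emb none) (fun l => hM (some ⟨_, l⟩)) ((S k).head?.map e)
  obtain ⟨v'', n', hn', hs'⟩ := hl L M emb exit hM v'
  refine ⟨v'', n' + (n + 1), by omega, StepsTo.trans (StepsTo.trans (StepsTo.single ?_) hs) hs'⟩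
  change some (TM2.stepAux (M (emb none)) _ _) = _
  rw [hM none]
  simp only [Routine.loop, TM2.stepAux, h, Bool.false_eq_true, if_false]

end Routine

/-- Stacks given by the work stacks and the stacks of the machines `O j`. -/
def stackMap (m : Reg → List Sym) (F : ∀ j k, List ((O j).tm.Γ k)) : ∀ k, List (Alph O k)
  | .inl r => m r
  | .inr p => F p.1 p.2

theorem stackMap_update_inl (m : Reg → List Sym) (F : ∀ j k, List ((O j).tm.Γ k)) (r : Reg)
    (w : List Sym) : Function.update (stackMap m F) (.inl r) w = stackMap (Function.update m r w) F := by
  funext k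
  rcases k with r' | p
  · by_cases h : r' = r
    · subst h; simp [stackMap]
    · simp [stackMap, h]
  · simp [stackMap]

theorem stackMap_update_inr (m : Reg → List Sym) (F : ∀ j k, List ((O j).tm.Γ k)) (j : J)
    (k : (O j).tm.K) (T : ∀ k, List ((O j).tm.Γ k)) (w : List ((O j).tm.Γ k)) :
    Function.update (stackMap m (Function.update F j T)) (.inr ⟨j, k⟩) w =
      stackMap m (Function.update F j (Function.update T k w)) := by
  funext k'
  rcases k' with r' | ⟨j', k'⟩
  · simp [stackMap]
  · by_cases h : j' = j
    · subst h
      by_cases h' : k' = k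
      · subst h'; simp [stackMap]
      · simp [stackMap, h']
    · have : (⟨j', k'⟩ : Σ j, (O j).tm.K) ≠ ⟨j, k⟩ := fun h' => h (congrArg Sigma.fst h')
      simp [stackMap, h, this]

/-- A statement of `O j` as a statement of the big machine; halting becomes a jump. -/
def liftStmt (j : J) {L : Type} (emb : (O j).tm.Λ → L) (exit : L) :
    TM2.Stmt (O j).tm.Γ (O j).tm.Λ (O j).tm.σ → TM2.Stmt (Alph O) L (St O)
  | .push k f q => .push (.inr ⟨j, k⟩) (fun s => f (s.2 j)) (liftStmt j emb exit q)
  | .peek k f q => .peek (.inr ⟨j, k⟩)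
      (fun s o => (s.1, Function.update s.2 j (f (s.2 j) o))) (liftStmt j emb exit q)
  | .pop k f q => .pop (.inr ⟨j, k⟩)
      (fun s o => (s.1, Function.update s.2 j (f (s.2 j) o))) (liftStmt j emb exit q)
  | .load f q => .load (fun s => (s.1, Function.update s.2 j (f (s.2 j)))) (liftStmt j emb exit q)
  | .branch f q₁ q₂ => .branch (fun s => f (s.2 j)) (liftStmt j emb exit q₁)
      (liftStmt j emb exit q₂)
  | .goto f => .goto fun s => emb (f (s.2 j))
  | .halt => .goto fun _ => exit

/-- A configuration of `O j` as a configuration of the big machine. -/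
def liftCfg (j : J) {L : Type} (emb : (O j).tm.Λ → L) (exit : L) (v : Option Sym)
    (m : Reg → List Sym) (F : ∀ j k, List ((O j).tm.Γ k))
    (c : TM2.Cfg (O j).tm.Γ (O j).tm.Λ (O j).tm.σ) : TM2.Cfg (Alph O) L (St O) :=
  ⟨some (c.l.elim exit emb), (v, Function.update (initSt O) j c.var),
    stackMap m (Function.update F j c.stk)⟩

theorem stepAux_liftStmt (j : J) {L : Type} (emb : (O j).tm.Λ → L) (exit : L) (v : Option Sym)
    (m : Reg → List Sym) (F : ∀ j k, List ((O j).tm.Γ k))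
    (q : TM2.Stmt (O j).tm.Γ (O j).tm.Λ (O j).tm.σ) (x : (O j).tm.σ)
    (T : ∀ k, List ((O j).tm.Γ k)) :
    TM2.stepAux (liftStmt j emb exit q) (v, Function.update (initSt O) j x)
        (stackMap m (Function.update F j T)) =
      liftCfg j emb exit v m F (TM2.stepAux q x T) := by
  induction q generalizing x T with
  | push k f q ih =>
    simp only [liftStmt, TM2.stepAux, stackMap_update_inr, ← ih]
    simp [stackMap]
  | peek k f q ih =>
    simp only [liftStmt, TM2.stepAux, ← ih]
    simp [stackMap]
  | pop k f q ih =>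
    simp only [liftStmt, TM2.stepAux, stackMap_update_inr, ← ih]
    simp [stackMap]
  | load f q ih =>
    simp only [liftStmt, TM2.stepAux, ← ih]
    simp
  | branch f q₁ q₂ ih₁ ih₂ =>
    simp only [liftStmt, TM2.stepAux, ih₁, ih₂, Function.update_self]
    cases f x <;> rfl
  | goto f => simp [liftStmt, TM2.stepAux, liftCfg]
  | halt => simp [liftStmt, TM2.stepAux, liftCfg]

/-- Run the machine `O j` on its own stacks. -/
def Routine.call (j : J) : Routine O where
  Λ := (O j).tm.Λ
  fin := (O j).tm.ΛFin
  entry := (O j).tm.main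
  code _ emb exit l := liftStmt j emb exit ((O j).tm.m l)

theorem StepsTo.lift (j : J) {L : Type} {emb : (O j).tm.Λ → L} {exit : L} (v : Option Sym)
    (m : Reg → List Sym) (F : ∀ j k, List ((O j).tm.Γ k))
    {M : L → TM2.Stmt (Alph O) L (St O)}
    (hM : ∀ l, M (emb l) = liftStmt j emb exit ((O j).tm.m l)) (n : ℕ)
    (c c' : TM2.Cfg (O j).tm.Γ (O j).tm.Λ (O j).tm.σ)
    (h : (flip bind (TM2.step (O j).tm.m))^[n] (some c) = some c') :
    StepsTo M n (liftCfg j emb exit v m F c) (liftCfg j emb exit v m F c') := by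
  induction n generalizing c with
  | zero =>
    simp only [Function.iterate_zero, id, Option.some.injEq] at h
    simp [StepsTo, h]
  | succ n ih =>
    rw [Function.iterate_succ_apply] at h
    have hnone : (flip bind (TM2.step (O j).tm.m))^[n] none = none := by
      clear ih h
      induction n with
      | zero => rfl
      | succ n ih => rw [Function.iterate_succ_apply]; exact ih
    obtain ⟨_ | l, x, T⟩ := c
    · simp only [flip, Option.bind_eq_bind, Option.bind_some, TM2.step] at h
      exact absurd (hnone.symm.trans h) (by simp)
    · refine StepsTo.trans (StepsTo.single ?_) (ih (TM2.stepAux ((O j).tm.m l) x T) ?_)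
      · simp only [liftCfg, Option.elim, TM2.step, hM]
        exact congrArg some (stepAux_liftStmt j emb exit v m F _ x T)
      · simpa [flip, TM2.step] using h

theorem initList_eq (M : FinTM2) (w : List (M.Γ M.k₀)) :
    initList M w = ⟨some M.main, M.initialState, Function.update (fun _ => []) M.k₀ w⟩ := by
  have : (initList M w).stk = Function.update (fun _ => []) M.k₀ w := by
    funext k
    by_cases h : k = M.k₀
    · subst h; simp [initList]
    · simp [initList, h]
  rw [← this]; rfl

theorem haltList_eq (M : FinTM2) (w : List (M.Γ M.k₁)) :
    haltList M w = ⟨none, M.initialState, Function.update (fun _ => []) M.k₁ w⟩ := by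
  have : (haltList M w).stk = Function.update (fun _ => []) M.k₁ w := by
    funext k
    by_cases h : k = M.k₁
    · subst h; simp [haltList]
    · simp [haltList, h]
  rw [← this]; rfl

variable (O) in
/-- All stacks of the machines `O j` are empty. -/
def emptyStacks : ∀ j k, List ((O j).tm.Γ k) := fun _ _ => []

theorem Routine.Runs.call (j : J) (m : Reg → List Sym) {w : List ((O j).tm.Γ (O j).tm.k₀)}
    {w' : List ((O j).tm.Γ (O j).tm.k₁)}
    (h : Nonempty (TM2OutputsInTime (O j).tm w (some w') t)) :
    (Routine.call (O := O) j).Runs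
      (stackMap m (Function.update (emptyStacks O) j
        (Function.update (fun _ => []) (O j).tm.k₀ w))) t
      (stackMap m (Function.update (emptyStacks O) j
        (Function.update (fun _ => []) (O j).tm.k₁ w'))) := by
  intro L M emb exit hM v
  obtain ⟨⟨n, hs⟩, hn⟩ := h
  refine ⟨v, n, hn, ?_⟩
  have := StepsTo.lift j v m (emptyStacks O) hM n _ _ hs
  rw [initList_eq, haltList_eq] at this
  simp only [liftCfg] at this
  have e : Function.update (initSt O) j (O j).tm.initialState = initSt O :=
    Function.update_eq_self_iff.2 rfl
  rw [e] at this
  exact this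

end Routines

end ParamCSP

namespace ParamCSP

open Turing

/-! ### Binary trees -/

/-- Binary trees, the data type of the programs. -/
inductive BTree
  | nil
  | node (l r : BTree)

/-- The prefix code of a tree. -/
def BTree.code : BTree → List Sym
  | nil => [Sym.zero]
  | node l r => Sym.one :: (l.code ++ r.code)

theorem BTree.bar_notMem_code (t : BTree) : Sym.bar ∉ t.code := by
  induction t with
  | nil => simp [code]
  | node l r ihl ihr => simp [code, ihl, ihr]

/-- Types whose elements are represented by trees. Elements with equal representations need not
be equal, so that proofs and irrelevant data can be left out. -/
class ToTree (α : Type) where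
  repr : α → BTree

/-- The code of an element. -/
def tcode {α : Type} [ToTree α] (a : α) : List Sym := (ToTree.repr a).code

/-- The length of the code of an element. -/
def tsize {α : Type} [ToTree α] (a : α) : ℕ := (tcode a).length

instance : ToTree BTree := ⟨id⟩

instance {α β : Type} [ToTree α] [ToTree β] : ToTree (α × β) :=
  ⟨fun p => .node (ToTree.repr p.1) (ToTree.repr p.2)⟩

instance {α : Type} [ToTree α] {p : α → Prop} : ToTree {a // p a} := ⟨fun a => ToTree.repr a.1⟩

instance : ToTree Bool := ⟨fun b => if b then .node .nil .nil else .nil⟩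

instance : ToTree Unit := ⟨fun _ => .nil⟩

/-- The right comb with the given left children. -/
def BTree.ofList : List BTree → BTree
  | [] => .nil
  | t :: ts => .node t (ofList ts)

instance {α : Type} [ToTree α] : ToTree (List α) := ⟨fun l => .ofList (l.map ToTree.repr)⟩

instance : ToTree ℕ := ⟨fun n => .ofList (List.replicate n .nil)⟩

/-- A number for each symbol. -/
def Sym.index : Sym → ℕ
  | zero => 0
  | one => 1
  | comma => 2
  | semi => 3
  | bar => 4

instance : ToTree Sym := ⟨fun s => ToTree.repr s.index⟩

section
variable {α β : Type} [ToTree α] [ToTree β]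

theorem tcode_pair (p : α × β) : tcode p = Sym.one :: (tcode p.1 ++ tcode p.2) := rfl

theorem tcode_nil : tcode ([] : List α) = [Sym.zero] := rfl

theorem tcode_cons (a : α) (l : List α) : tcode (a :: l) = Sym.one :: (tcode a ++ tcode l) := rfl

theorem tcode_succ (n : ℕ) : tcode (n + 1) = Sym.one :: Sym.zero :: tcode n := rfl

theorem tsize_pair (p : α × β) : tsize p = tsize p.1 + tsize p.2 + 1 := by
  simp [tsize, tcode_pair]

theorem tsize_nil : tsize ([] : List α) = 1 := rfl

theorem tsize_cons (a : α) (l : List α) : tsize (a :: l) = tsize a + tsize l + 1 := by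
  simp [tsize, tcode_cons]

theorem tsize_nat (n : ℕ) : tsize n = 2 * n + 1 := by
  induction n with
  | zero => rfl
  | succ n ih => simp only [tsize, tcode_succ, List.length_cons] at ih ⊢; omega

theorem bar_notMem_tcode (a : α) : Sym.bar ∉ tcode a := BTree.bar_notMem_code _

theorem tsize_pos (a : α) : 0 < tsize a := by
  unfold tsize tcode
  cases ToTree.repr a <;> simp [BTree.code]

end

/-! ### Basic fragments -/

section Basic

variable {J : Type} [DecidableEq J] {O : MachineFamily J}

/-- The contents of the work stacks. -/
def regs (d a b c : List Sym) : Reg → List Sym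
  | .D => d
  | .A => a
  | .B => b
  | .C => c

@[simp] theorem regs_D (d a b c : List Sym) : regs d a b c .D = d := rfl
@[simp] theorem regs_A (d a b c : List Sym) : regs d a b c .A = a := rfl
@[simp] theorem regs_B (d a b c : List Sym) : regs d a b c .B = b := rfl
@[simp] theorem regs_C (d a b c : List Sym) : regs d a b c .C = c := rfl

@[simp] theorem update_regs_D (d a b c x : List Sym) :
    Function.update (regs d a b c) .D x = regs x a b c := by
  funext r; cases r <;> simp [regs]

@[simp] theorem update_regs_A (d a b c x : List Sym) :
    Function.update (regs d a b c) .A x = regs d x b c := by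
  funext r; cases r <;> simp [regs]

@[simp] theorem update_regs_B (d a b c x : List Sym) :
    Function.update (regs d a b c) .B x = regs d a x c := by
  funext r; cases r <;> simp [regs]

@[simp] theorem update_regs_C (d a b c x : List Sym) :
    Function.update (regs d a b c) .C x = regs d a b x := by
  funext r; cases r <;> simp [regs]

namespace Routine

variable {m : Reg → List Sym} {F : ∀ j k, List ((O j).tm.Γ k)} {S' S'' : ∀ k, List (Alph O k)}
  {t t' : ℕ}

variable (O) in
/-- Push a symbol on a work stack. -/
def pushR (r : Reg) (s : Sym) : Routine O := Routine.push (.inl r) s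

theorem Runs.pushR (r : Reg) (s : Sym) :
    (Routine.pushR O r s).Runs (stackMap m F) 1 (stackMap (Function.update m r (s :: m r)) F) := by
  rw [← stackMap_update_inl]
  exact Runs.push (O := O) (S := stackMap m F) (.inl r) s

/-- Pop a symbol from a work stack and continue according to what it was. -/
def popR (r : Reg) (f : Option Sym → Routine O) : Routine O :=
  Routine.popCase (.inl r) id f

theorem Runs.popR {r : Reg} {f : Option Sym → Routine O}
    (h : (f (m r).head?).Runs (stackMap (Function.update m r (m r).tail) F) t S') :
    (Routine.popR r f).Runs (stackMap m F) (t + 1) S' := by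
  rw [← stackMap_update_inl] at h
  refine Runs.popCase (k := .inl r) (e := id) ?_
  rw [Option.map_id]
  exact h

/-- A loop that is controlled by a work stack. -/
def loopR (r : Reg) (isEnd : Option Sym → Bool) (f : Option Sym → Routine O) : Routine O :=
  Routine.loop (.inl r) id isEnd f

theorem Runs.loopR_stop {r : Reg} {isEnd : Option Sym → Bool} {f : Option Sym → Routine O}
    (h : isEnd (m r).head? = true) :
    (Routine.loopR r isEnd f).Runs (stackMap m F) 1
      (stackMap (Function.update m r (m r).tail) F) := by
  rw [← stackMap_update_inl]
  refine Runs.loop_stop (S := stackMap m F) (k := .inl r) (e := id) ?_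
  rw [Option.map_id]
  exact h

theorem Runs.loopR_step {r : Reg} {isEnd : Option Sym → Bool} {f : Option Sym → Routine O}
    (h : isEnd (m r).head? = false)
    (hf : (f (m r).head?).Runs (stackMap (Function.update m r (m r).tail) F) t S')
    (hl : (Routine.loopR r isEnd f).Runs S' t' S'') :
    (Routine.loopR r isEnd f).Runs (stackMap m F) (t + t' + 1) S'' := by
  rw [← stackMap_update_inl] at hf
  refine Runs.loop_step (k := .inl r) (e := id) ?_ ?_ hl
  · rw [Option.map_id]; exact h
  · rw [Option.map_id]; exact hf

variable (O) in
/-- Do nothing. -/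
def skip : Routine O where
  Λ := Unit
  fin := inferInstance
  entry := ()
  code _ _ exit _ := .goto fun _ => exit

theorem Runs.skip {S : ∀ k, List (Alph O k)} : (Routine.skip O).Runs S 1 S := by
  intro L M emb exit hM v
  refine ⟨v, 1, le_rfl, StepsTo.single ?_⟩
  change some (TM2.stepAux (M (emb ())) _ _) = _
  rw [hM ()]
  simp [Routine.skip]

variable (O) in
/-- Push a word on a work stack, its last symbol first. -/
def pushWord (r : Reg) : List Sym → Routine O
  | [] => skip O
  | s :: w => (pushWord r w).seq (pushR O r s)

theorem Runs.pushWord (r : Reg) (w : List Sym) :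
    (Routine.pushWord O r w).Runs (stackMap m F) (w.length + 1)
      (stackMap (Function.update m r (w ++ m r)) F) := by
  induction w with
  | nil => simpa [Routine.pushWord] using Runs.skip
  | cons s w ih =>
    unfold Routine.pushWord
    simpa using ih.seq (Runs.pushR r s)

/-- A loop that consumes the word above the first stopping symbol. -/
theorem Runs.loopR_word {r : Reg} {isEnd : Option Sym → Bool} {f : Option Sym → Routine O}
    (st : List Sym → List Sym → Reg → List Sym) (rest : List Sym) (hrest : isEnd rest.head? = true)
    (w x : List Sym) (hw : ∀ s ∈ w, isEnd (some s) = false)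
    (hst : ∀ x u, st x u r = u ++ rest)
    (hf : ∀ x s u, s ∈ w → (f (some s)).Runs
      (stackMap (Function.update (st x (s :: u)) r (u ++ rest)) F) t
      (stackMap (st (s :: x) u) F)) :
    (Routine.loopR r isEnd f).Runs (stackMap (st x w) F) ((t + 1) * w.length + 1)
      (stackMap (Function.update (st (w.reverse ++ x) []) r rest.tail) F) := by
  induction w generalizing x with
  | nil =>
    have := Runs.loopR_stop (F := F) (m := st x []) (r := r) (isEnd := isEnd) (f := f)
      (by rw [hst]; exact hrest)
    rw [hst] at this
    simpa using this
  | cons s w ih =>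
    have h1 := hf x s w (by simp)
    have h2 := ih (s :: x) (fun s' hs' => hw s' (by simp [hs']))
      (fun x s u hs => hf x s u (by simp [hs]))
    have h3 := Runs.loopR_step (F := F) (m := st x (s :: w)) (r := r) (isEnd := isEnd) (f := f)
      (by rw [hst]; exact hw s (by simp)) (by rw [hst]; exact h1) h2
    refine Runs.mono (t := t + ((t + 1) * w.length + 1) + 1) ?_ ?_
    · simpa using h3
    · simp only [List.length_cons]; nlinarith

/-- Stop at the mark. -/
def atBar (s : Option Sym) : Bool := s == some Sym.bar

/-- Consume a word that is followed by a mark. -/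
theorem Runs.loopR_bar {r : Reg} {f : Option Sym → Routine O}
    (st : List Sym → List Sym → Reg → List Sym) (rest : List Sym)
    (w : List Sym) (hw : Sym.bar ∉ w)
    (hst : ∀ x u, st x u r = u ++ Sym.bar :: rest)
    (hf : ∀ x s u, (f (some s)).Runs
      (stackMap (Function.update (st x (s :: u)) r (u ++ Sym.bar :: rest)) F) t
      (stackMap (st (s :: x) u) F)) :
    (Routine.loopR r atBar f).Runs (stackMap (st [] w) F) ((t + 1) * w.length + 1)
      (stackMap (Function.update (st w.reverse []) r rest) F) := by
  have := Runs.loopR_word (F := F) (isEnd := atBar) (f := f) (t := t) st (Sym.bar :: rest) rfl w []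
    (fun s hs => by
      have : s ≠ Sym.bar := fun h => hw (h ▸ hs)
      simpa [atBar] using this) hst (fun x s u _ => hf x s u)
  simpa using this

variable (O) in
/-- Move a word from one work stack to another, down to a mark. -/
def pour (src dst : Reg) : Routine O := loopR src atBar fun s => pushR O dst (s.getD Sym.zero)

variable {d a b c w : List Sym}

theorem Runs.pour_AD (hw : Sym.bar ∉ w) :
    (Routine.pour O .A .D).Runs (stackMap (regs d (w ++ Sym.bar :: a) b c) F) (2 * w.length + 1)
      (stackMap (regs (w.reverse ++ d) a b c) F) := by
  have := Runs.loopR_bar (O := O) (F := F) (r := .A) (t := 1)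
    (f := fun s => Routine.pushR O .D (s.getD Sym.zero))
    (fun x u => regs (x ++ d) (u ++ Sym.bar :: a) b c) a w hw (fun _ _ => rfl)
    (fun x s u => by
      simpa using Runs.pushR (O := O) (F := F)
        (m := regs (x ++ d) (u ++ Sym.bar :: a) b c) .D s)
  unfold Routine.pour
  simpa using this

theorem Runs.pour_AB (hw : Sym.bar ∉ w) :
    (Routine.pour O .A .B).Runs (stackMap (regs d (w ++ Sym.bar :: a) b c) F) (2 * w.length + 1)
      (stackMap (regs d a (w.reverse ++ b) c) F) := by
  have := Runs.loopR_bar (O := O) (F := F) (r := .A) (t := 1)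
    (f := fun s => Routine.pushR O .B (s.getD Sym.zero))
    (fun x u => regs d (u ++ Sym.bar :: a) (x ++ b) c) a w hw (fun _ _ => rfl)
    (fun x s u => by
      simpa using Runs.pushR (O := O) (F := F)
        (m := regs d (u ++ Sym.bar :: a) (x ++ b) c) .B s)
  unfold Routine.pour
  simpa using this

theorem Runs.pour_BA (hw : Sym.bar ∉ w) :
    (Routine.pour O .B .A).Runs (stackMap (regs d a (w ++ Sym.bar :: b) c) F) (2 * w.length + 1)
      (stackMap (regs d (w.reverse ++ a) b c) F) := by
  have := Runs.loopR_bar (O := O) (F := F) (r := .B) (t := 1)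
    (f := fun s => Routine.pushR O .A (s.getD Sym.zero))
    (fun x u => regs d (x ++ a) (u ++ Sym.bar :: b) c) b w hw (fun _ _ => rfl)
    (fun x s u => by
      simpa using Runs.pushR (O := O) (F := F)
        (m := regs d (x ++ a) (u ++ Sym.bar :: b) c) .A s)
  unfold Routine.pour
  simpa using this

variable (O) in
/-- The loop that moves as many trees from `D` to `A` as there are symbols above the mark
on `C`. -/
def treeLoop : Routine O :=
  loopR .C atBar fun _ => popR .D fun s =>
    if s = some Sym.one then
      (pushR O .A Sym.one).seq ((pushR O .C Sym.zero).seq (pushR O .C Sym.zero))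
    else pushR O .A Sym.zero

theorem Runs.treeLoop_tree (x : BTree)
    (h : (treeLoop O).Runs (stackMap (regs d (x.code.reverse ++ a) b c) F) t S') :
    (treeLoop O).Runs (stackMap (regs (x.code ++ d) a b (Sym.zero :: c)) F)
      (5 * x.code.length + t) S' := by
  induction x generalizing d a c t with
  | nil =>
    refine Runs.mono (t := 2 + t + 1) (Runs.loopR_step rfl ?_ h) ?_
    · refine Runs.popR (t := 1) ?_
      simpa [BTree.code] using Runs.pushR (O := O) (F := F) (m := regs d a b c) .A Sym.zero
    · simp only [BTree.code, List.length_singleton]; omega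
  | node l r ihl ihr =>
    have h2 := ihl (d := r.code ++ d) (a := Sym.one :: a) (c := Sym.zero :: c) <|
      ihr (d := d) (a := l.code.reverse ++ Sym.one :: a) (c := c) (t := t)
        (by simpa [BTree.code] using h)
    refine Runs.mono (Runs.loopR_step (t := 4) rfl ?_ h2) ?_
    · refine Runs.popR (t := 3) ?_
      have := (Runs.pushR (O := O) (F := F)
        (m := regs (l.code ++ r.code ++ d) a b c) .A Sym.one).seq
        ((Runs.pushR .C Sym.zero).seq (Runs.pushR .C Sym.zero))
      simpa [BTree.code] using this
    · simp only [BTree.code, List.length_cons, List.length_append]; omega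

variable (O) in
/-- Move the tree on top of `D` to `A`, above a mark. -/
def save : Routine O :=
  (pushR O .A Sym.bar).seq <| (pushR O .C Sym.bar).seq <| (pushR O .C Sym.zero).seq (treeLoop O)

theorem Runs.save {x : BTree} :
    (Routine.save O).Runs (stackMap (regs (x.code ++ d) a b c) F) (5 * x.code.length + 4)
      (stackMap (regs d (x.code.reverse ++ Sym.bar :: a) b c) F) := by
  have h1 : (treeLoop O).Runs
      (stackMap (regs d (x.code.reverse ++ Sym.bar :: a) b (Sym.bar :: c)) F) 1
      (stackMap (regs d (x.code.reverse ++ Sym.bar :: a) b c) F) := by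
    unfold treeLoop
    simpa using Runs.loopR_stop (O := O) (F := F) (r := .C) (isEnd := atBar)
      (m := regs d (x.code.reverse ++ Sym.bar :: a) b (Sym.bar :: c)) rfl
  have h2 := Runs.treeLoop_tree x h1
  have h3 := (Runs.pushR (O := O) (F := F) (m := regs (x.code ++ d) a b c) .A Sym.bar).seq
    ((Runs.pushR .C Sym.bar).seq ((Runs.pushR .C Sym.zero).seq (by simpa using h2)))
  exact h3.mono (by omega)

variable (O) in
/-- Remove the tree on top of `D`. -/
def drop : Routine O := (save O).seq (loopR .A atBar fun _ => skip O)

theorem Runs.drop {x : BTree} :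
    (Routine.drop O).Runs (stackMap (regs (x.code ++ d) a b c) F) (7 * x.code.length + 5)
      (stackMap (regs d a b c) F) := by
  have h := Runs.loopR_bar (O := O) (F := F) (r := .A) (t := 1) (f := fun _ => Routine.skip O)
    (fun x u => regs d (u ++ Sym.bar :: a) b c) a x.code.reverse
    (by simpa using x.bar_notMem_code) (fun _ _ => rfl)
    (fun x s u => by simpa using Runs.skip)
  have h' := (Runs.save (O := O) (F := F) (d := d) (a := a) (b := b) (c := c) (x := x)).seq h
  unfold Routine.drop
  refine Runs.mono (t := 5 * x.code.length + 4 + (2 * x.code.length + 1)) ?_ (by omega)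
  simpa using h'

variable (O) in
/-- Duplicate the tree on top of `D`. -/
def dup : Routine O :=
  (save O).seq <| (pushR O .B Sym.bar).seq <|
    (loopR .A atBar fun s =>
      (pushR O .D (s.getD Sym.zero)).seq (pushR O .B (s.getD Sym.zero))).seq <|
    (pushR O .A Sym.bar).seq <| (pour O .B .A).seq (pour O .A .D)

theorem Runs.dup {x : BTree} :
    (Routine.dup O).Runs (stackMap (regs (x.code ++ d) a b c) F) (12 * x.code.length + 9)
      (stackMap (regs (x.code ++ (x.code ++ d)) a b c) F) := by
  have hx := x.bar_notMem_code
  have h1 := Runs.save (O := O) (F := F) (d := d) (a := a) (b := b) (c := c) (x := x)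
  have h2 := Runs.pushR (O := O) (F := F)
    (m := regs d (x.code.reverse ++ Sym.bar :: a) b c) .B Sym.bar
  have h3 := Runs.loopR_bar (O := O) (F := F) (r := .A) (t := 2)
    (f := fun s => (Routine.pushR O .D (s.getD Sym.zero)).seq
      (Routine.pushR O .B (s.getD Sym.zero)))
    (fun x u => regs (x ++ d) (u ++ Sym.bar :: a) (x ++ Sym.bar :: b) c) a x.code.reverse
    (by simpa using hx) (fun _ _ => rfl)
    (fun x s u => by
      simpa using (Runs.pushR (O := O) (F := F)
        (m := regs (x ++ d) (u ++ Sym.bar :: a) (x ++ Sym.bar :: b) c) .D s).seq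
        (Runs.pushR .B s))
  have h4 := Runs.pushR (O := O) (F := F)
    (m := regs (x.code ++ d) a (x.code ++ Sym.bar :: b) c) .A Sym.bar
  have h5 := Runs.pour_BA (O := O) (F := F) (d := x.code ++ d) (a := Sym.bar :: a) (b := b)
    (c := c) hx
  have h6 := Runs.pour_AD (O := O) (F := F) (d := x.code ++ d) (a := a) (b := b)
    (c := c) (w := x.code.reverse) (by simpa using hx)
  simp only [update_regs_B, update_regs_A, regs_A, regs_B, List.reverse_reverse,
    List.nil_append] at h1 h2 h3 h4 h5 h6
  refine (h1.seq (h2.seq (h3.seq (h4.seq (h5.seq h6))))).mono ?_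
  simp; omega

end Routine

end Basic

end ParamCSP

namespace ParamCSP

open Turing

/-! ### Polynomially bounded functions -/

/-- A monotone function that is bounded by a polynomial. -/
structure IsPoly (b : ℕ → ℕ) : Prop where
  mono : Monotone b
  bdd : ∃ p : Polynomial ℕ, ∀ n, b n ≤ p.eval n

theorem polynomial_eval_monotone (p : Polynomial ℕ) : Monotone fun n => p.eval n := by
  intro m n h
  simp only [Polynomial.eval_eq_sum]
  exact Finset.sum_le_sum fun i _ => Nat.mul_le_mul_left _ (Nat.pow_le_pow_left h i)

namespace IsPoly

variable {b c : ℕ → ℕ}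

theorem eval (p : Polynomial ℕ) : IsPoly fun n => p.eval n :=
  ⟨polynomial_eval_monotone p, p, fun _ => le_rfl⟩

theorem const (k : ℕ) : IsPoly fun _ => k :=
  ⟨fun _ _ _ => le_rfl, .C k, fun n => by simp⟩

theorem id : IsPoly fun n => n :=
  ⟨fun _ _ h => h, .X, fun n => by simp⟩

theorem add (hb : IsPoly b) (hc : IsPoly c) : IsPoly fun n => b n + c n := by
  obtain ⟨p, hp⟩ := hb.bdd
  obtain ⟨q, hq⟩ := hc.bdd
  refine ⟨fun m n h => Nat.add_le_add (hb.mono h) (hc.mono h), p + q, fun n => ?_⟩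
  rw [Polynomial.eval_add]
  exact Nat.add_le_add (hp n) (hq n)

theorem mul (hb : IsPoly b) (hc : IsPoly c) : IsPoly fun n => b n * c n := by
  obtain ⟨p, hp⟩ := hb.bdd
  obtain ⟨q, hq⟩ := hc.bdd
  refine ⟨fun m n h => Nat.mul_le_mul (hb.mono h) (hc.mono h), p * q, fun n => ?_⟩
  rw [Polynomial.eval_mul]
  exact Nat.mul_le_mul (hp n) (hq n)

theorem comp (hb : IsPoly b) (hc : IsPoly c) : IsPoly fun n => b (c n) := by
  obtain ⟨p, hp⟩ := hb.bdd
  obtain ⟨q, hq⟩ := hc.bdd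
  refine ⟨fun m n h => hb.mono (hc.mono h), p.comp q, fun n => ?_⟩
  rw [Polynomial.eval_comp]
  exact (hp _).trans (polynomial_eval_monotone p (hq n))

theorem const_mul (k : ℕ) (hb : IsPoly b) : IsPoly fun n => k * b n := (const k).mul hb

theorem add_const (hb : IsPoly b) (k : ℕ) : IsPoly fun n => b n + k := hb.add (const k)

end IsPoly

/-! ### Polynomial-time functions on trees -/

section PolyTime

variable {J : Type} [DecidableEq J] {O : MachineFamily J}
variable {α β γ σ : Type} [ToTree α] [ToTree β] [ToTree γ] [ToTree σ]

variable (O) in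
/-- `f` is computed in polynomial time by a fragment that replaces the code of `a` on top of the
first work stack by the code of `f a`. -/
@[fun_prop]
def PT (f : α → β) : Prop :=
  ∃ (r : Routine O) (b : ℕ → ℕ), IsPoly b ∧ ∀ a, tsize (f a) ≤ b (tsize a) ∧ ∀ d u v w,
    r.Runs (stackMap (regs (tcode a ++ d) u v w) (emptyStacks O)) (b (tsize a))
      (stackMap (regs (tcode (f a) ++ d) u v w) (emptyStacks O))

namespace PT

open Routine

theorem size_le {f : α → β} (hf : PT O f) :
    ∃ b, IsPoly b ∧ ∀ a, tsize (f a) ≤ b (tsize a) := by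
  obtain ⟨r, b, hb, h⟩ := hf
  exact ⟨b, hb, fun a => (h a).1⟩

/-- Only the representations of arguments and values matter. -/
theorem of_repr {α' β' : Type} [ToTree α'] [ToTree β'] {f : α → β} (hf : PT O f) {f' : α' → β'}
    (g : α' → α) (hg : ∀ a, ToTree.repr a = ToTree.repr (g a))
    (hf' : ∀ a, ToTree.repr (f' a) = ToTree.repr (f (g a))) : PT O f' := by
  obtain ⟨r, b, hb, h⟩ := hf
  refine ⟨r, b, hb, fun a => ?_⟩
  simp only [tsize, tcode, hg, hf']
  exact h (g a)

theorem congr {f g : α → β} (hf : PT O f) (h : ∀ a, g a = f a) : PT O g := by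
  rwa [show g = f from funext h]

@[fun_prop]
theorem id : PT O (fun a : α => a) :=
  ⟨skip O, fun n => n + 1, IsPoly.id.add_const 1, fun _ =>
    ⟨Nat.le_succ _, fun _ _ _ _ => Runs.skip.mono (Nat.le_add_left _ _)⟩⟩

@[fun_prop]
theorem comp {g : β → γ} {f : α → β} (hg : PT O g) (hf : PT O f) : PT O fun a => g (f a) := by
  obtain ⟨r, b, hb, h⟩ := hf
  obtain ⟨r', b', hb', h'⟩ := hg
  refine ⟨r.seq r', fun n => b n + b' (b n), hb.add (hb'.comp hb), fun a => ?_⟩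
  have hm := hb'.mono (h a).1
  exact ⟨((h' (f a)).1.trans hm).trans (Nat.le_add_left _ _), fun d u v w =>
    ((h a).2 d u v w).seq (((h' (f a)).2 d u v w).mono hm)⟩

@[fun_prop]
theorem const (x : β) : PT O (fun _ : α => x) := by
  refine ⟨(drop O).seq (pushWord O .D (tcode x)), fun n => 7 * n + (tsize x + 6),
    (IsPoly.const_mul 7 IsPoly.id).add_const _, fun a => ⟨by beta_reduce; omega, fun d u v w => ?_⟩⟩
  have h1 := Runs.drop (O := O) (F := emptyStacks O) (d := d) (a := u) (b := v) (c := w)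
    (x := ToTree.repr a)
  have h2 := Runs.pushWord (O := O) (F := emptyStacks O) (m := regs d u v w) .D (tcode x)
  rw [update_regs_D] at h2
  exact (h1.seq h2).mono (by simp only [tsize, tcode]; omega)

@[fun_prop]
theorem fst : PT O (Prod.fst : α × β → α) := by
  refine ⟨popR .D fun _ => (save O).seq ((drop O).seq (pour O .A .D)), fun n => 7 * n + 15,
    (IsPoly.const_mul 7 IsPoly.id).add_const _,
    fun p => ⟨by rw [tsize_pair]; beta_reduce; omega, ?_⟩⟩
  intro d u v w
  have h1 := Runs.save (O := O) (F := emptyStacks O) (d := tcode p.2 ++ d) (a := u) (b := v)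
    (c := w) (x := ToTree.repr p.1)
  have h2 := Runs.drop (O := O) (F := emptyStacks O) (d := d)
    (a := (tcode p.1).reverse ++ Sym.bar :: u) (b := v) (c := w) (x := ToTree.repr p.2)
  have h3 := Runs.pour_AD (O := O) (F := emptyStacks O) (d := d) (a := u) (b := v) (c := w)
    (w := (tcode p.1).reverse) (by simpa using bar_notMem_tcode p.1)
  rw [List.reverse_reverse] at h3
  have h4 := h1.seq (h2.seq h3)
  rw [tcode_pair, List.cons_append, List.append_assoc]
  refine (Runs.popR (r := .D) (by rw [update_regs_D]; exact h4)).mono ?_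
  simp only [tsize, tcode_pair, List.length_cons, List.length_append, List.length_reverse]
  simp only [tcode]
  omega

@[fun_prop]
theorem snd : PT O (Prod.snd : α × β → β) := by
  refine ⟨popR .D fun _ => drop O, fun n => 7 * n + 6,
    (IsPoly.const_mul 7 IsPoly.id).add_const _,
    fun p => ⟨by rw [tsize_pair]; beta_reduce; omega, ?_⟩⟩
  intro d u v w
  have h2 := Runs.drop (O := O) (F := emptyStacks O) (d := tcode p.2 ++ d)
    (a := u) (b := v) (c := w) (x := ToTree.repr p.1)
  rw [tcode_pair, List.cons_append, List.append_assoc]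
  refine (Runs.popR (r := .D) (by rw [update_regs_D]; exact h2)).mono ?_
  simp only [tsize, tcode_pair, List.length_cons, List.length_append]
  simp only [tcode]
  omega

@[fun_prop]
theorem pair {f : α → β} {g : α → γ} (hf : PT O f) (hg : PT O g) :
    PT O fun a => (f a, g a) := by
  obtain ⟨r, b, hb, h⟩ := hf
  obtain ⟨r', b', hb', h'⟩ := hg
  refine ⟨(dup O).seq (r.seq ((save O).seq (r'.seq ((pour O .A .D).seq (pushR O .D Sym.one))))),
    fun n => 12 * n + 8 * b n + b' n + 15,
    (((IsPoly.const_mul 12 IsPoly.id).add (IsPoly.const_mul 8 hb)).add hb').add_const _,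
    fun a => ?_⟩
  have s1 := (h a).1
  have s2 := (h' a).1
  refine ⟨by rw [tsize_pair]; simp only; omega, fun d u v w => ?_⟩
  have h1 := Runs.dup (O := O) (F := emptyStacks O) (d := d) (a := u) (b := v) (c := w)
    (x := ToTree.repr a)
  have h2 := (h a).2 (tcode a ++ d) u v w
  have h3 := Runs.save (O := O) (F := emptyStacks O) (d := tcode a ++ d) (a := u) (b := v)
    (c := w) (x := ToTree.repr (f a))
  have h4 := (h' a).2 d ((tcode (f a)).reverse ++ Sym.bar :: u) v w
  have h5 := Runs.pour_AD (O := O) (F := emptyStacks O) (d := tcode (g a) ++ d) (a := u) (b := v)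
    (c := w) (w := (tcode (f a)).reverse) (by simpa using bar_notMem_tcode (f a))
  have h6 := Runs.pushR (O := O) (F := emptyStacks O)
    (m := regs (tcode (f a) ++ (tcode (g a) ++ d)) u v w) .D Sym.one
  rw [List.reverse_reverse] at h5
  rw [update_regs_D] at h6
  have h7 := h1.seq (h2.seq (h3.seq (h4.seq (h5.seq h6))))
  rw [tcode_pair, List.cons_append, List.append_assoc]
  refine h7.mono ?_
  simp only [tsize, List.length_reverse] at s1 s2 ⊢
  simp only [tcode] at s1 s2 ⊢
  omega

/-- Case distinction; the branches only have to be defined on their cases. -/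
theorem dite {c : α → Bool} {f : {a // c a = true} → β} {g : {a // ¬ c a = true} → β}
    (hc : PT O c) (hf : PT O f) (hg : PT O g) :
    PT O fun a => if h : c a = true then f ⟨a, h⟩ else g ⟨a, h⟩ := by
  obtain ⟨r₀, b₀, hb₀, h₀⟩ := hc.pair (PT.id (O := O))
  obtain ⟨r, b, hb, h⟩ := hf
  obtain ⟨r', b', hb', h'⟩ := hg
  refine ⟨r₀.seq (popR .D fun _ => popR .D fun s => if s = some Sym.one then
      (popR .D fun _ => popR .D fun _ => r) else r'),
    fun n => b₀ n + b n + b' n + 4, ((hb₀.add hb).add hb').add_const _, fun a => ?_⟩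
  have h1 := (h₀ a).2
  by_cases hca : c a = true
  · have h2 := h ⟨a, hca⟩
    simp only [hca, dif_pos]
    refine ⟨h2.1.trans (by change b (tsize a) ≤ _; omega), fun d u v w => ?_⟩
    refine ((h1 d u v w).seq (Runs.popR (t := b (tsize a) + 3) (Runs.popR ?_))).mono
      (t := b₀ (tsize a) + (b (tsize a) + 3 + 1)) (by omega)
    have : tcode (c a, a) ++ d = Sym.one :: Sym.one :: Sym.zero :: Sym.zero :: (tcode a ++ d) := by
      rw [tcode_pair, hca]; rfl
    rw [this]
    simp only [update_regs_D, regs_D, List.head?, List.tail, if_true]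
    refine Runs.popR (Runs.popR ?_)
    simp only [update_regs_D, regs_D, List.tail]
    exact h2.2 d u v w
  · have h2 := h' ⟨a, hca⟩
    simp only [hca]
    refine ⟨h2.1.trans (by change b' (tsize a) ≤ _; omega), fun d u v w => ?_⟩
    refine ((h1 d u v w).seq (Runs.popR (Runs.popR (t := b' (tsize a)) ?_))).mono
      (t := b₀ (tsize a) + (b' (tsize a) + 1 + 1)) (by omega)
    have : tcode (c a, a) ++ d = Sym.one :: Sym.zero :: (tcode a ++ d) := by
      rw [tcode_pair, Bool.eq_false_iff.2 hca]; rfl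
    rw [this]
    simp only [update_regs_D, regs_D, List.head?, List.tail]
    exact h2.2 d u v w

/-- A left fold is computable in polynomial time if its step is, and if the states remain of
polynomial size. -/
theorem foldl_of_bound {ι : α → List β × σ} {f : β × σ → σ} (hι : PT O ι) (hf : PT O f)
    {q : ℕ → ℕ} (hq : IsPoly q)
    (hb : ∀ a l, l <+: (ι a).1 → tsize (l.foldl (fun s x => f (x, s)) (ι a).2) ≤ q (tsize a)) :
    PT O fun a => (ι a).1.foldl (fun s x => f (x, s)) (ι a).2 := by
  obtain ⟨r₀, b₀, hb₀, h₀⟩ := hι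
  obtain ⟨r, b, hbb, h⟩ := hf
  set body : Routine O := (save O).seq <| (save O).seq <| (pushR O .B Sym.bar).seq <|
    (pour O .A .B).seq <| (pour O .A .D).seq <| (pushR O .D Sym.one).seq <| r.seq <|
    (pushR O .A Sym.bar).seq <| (pour O .B .A).seq (pour O .A .D) with hbody
  have body_runs : ∀ (x : β) (l : List β) (s : σ) (d u v w : List Sym),
      body.Runs (stackMap (regs (tcode x ++ (tcode l ++ (tcode s ++ d))) u v w) (emptyStacks O))
        (7 * tsize x + 11 * tsize l + b (tsize x + tsize s + 1) + 15)
        (stackMap (regs (tcode l ++ (tcode (f (x, s)) ++ d)) u v w) (emptyStacks O)) := by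
    intro x l s d u v w
    have h1 := Runs.save (O := O) (F := emptyStacks O) (d := tcode l ++ (tcode s ++ d)) (a := u)
      (b := v) (c := w) (x := ToTree.repr x)
    have h2 := Runs.save (O := O) (F := emptyStacks O) (d := tcode s ++ d)
      (a := (tcode x).reverse ++ Sym.bar :: u) (b := v) (c := w) (x := ToTree.repr l)
    have h3 := Runs.pushR (O := O) (F := emptyStacks O) (m := regs (tcode s ++ d)
      ((tcode l).reverse ++ Sym.bar :: ((tcode x).reverse ++ Sym.bar :: u)) v w) .B Sym.bar
    have h4 := Runs.pour_AB (O := O) (F := emptyStacks O) (d := tcode s ++ d)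
      (a := (tcode x).reverse ++ Sym.bar :: u) (b := Sym.bar :: v) (c := w)
      (w := (tcode l).reverse) (by simpa using bar_notMem_tcode l)
    have h5 := Runs.pour_AD (O := O) (F := emptyStacks O) (d := tcode s ++ d) (a := u)
      (b := tcode l ++ Sym.bar :: v) (c := w)
      (w := (tcode x).reverse) (by simpa using bar_notMem_tcode x)
    have h6 := Runs.pushR (O := O) (F := emptyStacks O) (m := regs (tcode x ++ (tcode s ++ d))
      u (tcode l ++ Sym.bar :: v) w) .D Sym.one
    have h7 := (h (x, s)).2 d u (tcode l ++ Sym.bar :: v) w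
    have h8 := Runs.pushR (O := O) (F := emptyStacks O) (m := regs (tcode (f (x, s)) ++ d)
      u (tcode l ++ Sym.bar :: v) w) .A Sym.bar
    have h9 := Runs.pour_BA (O := O) (F := emptyStacks O) (d := tcode (f (x, s)) ++ d)
      (a := Sym.bar :: u) (b := v) (c := w) (bar_notMem_tcode l)
    have h10 := Runs.pour_AD (O := O) (F := emptyStacks O) (d := tcode (f (x, s)) ++ d) (a := u)
      (b := v) (c := w) (w := (tcode l).reverse) (by simpa using bar_notMem_tcode l)
    simp only [update_regs_D, update_regs_B, update_regs_A, regs_D, regs_B, regs_A,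
      List.reverse_reverse] at h3 h4 h5 h6 h8 h10
    rw [tcode_pair, List.cons_append, List.append_assoc, tsize_pair] at h7
    have h11 := h1.seq (h2.seq (h3.seq (h4.seq (h5.seq (h6.seq (h7.seq (h8.seq (h9.seq h10))))))))
    refine h11.mono ?_
    simp only [tsize, List.length_reverse]
    simp only [tcode]
    omega
  set isEnd : Option Sym → Bool := fun s => !(s == some Sym.one)
  have loop_runs : ∀ (N Q : ℕ) (l : List β) (s : σ) (d u v w : List Sym), tsize l ≤ N →
      (∀ l', l' <+: l → tsize (l'.foldl (fun s x => f (x, s)) s) ≤ Q) →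
      (loopR .D isEnd fun _ => body).Runs
        (stackMap (regs (tcode l ++ (tcode s ++ d)) u v w) (emptyStacks O))
        (l.length * (18 * N + b (N + Q + 1) + 16) + 1)
        (stackMap (regs (tcode (l.foldl (fun s x => f (x, s)) s) ++ d) u v w)
          (emptyStacks O)) := by
    intro N Q l
    induction l with
    | nil =>
      intro s d u v w _ _
      have := Runs.loopR_stop (O := O) (F := emptyStacks O) (r := .D) (isEnd := isEnd)
        (f := fun _ => body) (m := regs (Sym.zero :: (tcode s ++ d)) u v w) (by simp [isEnd])
      rw [update_regs_D] at this
      simpa [tcode_nil] using this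
    | cons x l ih =>
      intro s d u v w hN hQ
      rw [tsize_cons] at hN
      have hs : tsize s ≤ Q := hQ [] (List.nil_prefix)
      have hl := ih (f (x, s)) d u v w (by omega)
        (fun l' hl' => hQ (x :: l') (by simpa using hl'))
      have hx := body_runs x l s d u v w
      have := Runs.loopR_step (O := O) (F := emptyStacks O) (r := .D) (isEnd := isEnd)
        (f := fun _ => body)
        (m := regs (Sym.one :: (tcode x ++ (tcode l ++ (tcode s ++ d)))) u v w)
        (by simp [isEnd]) (by rw [update_regs_D]; exact hx) hl
      rw [tcode_cons, List.cons_append, List.append_assoc]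
      refine this.mono ?_
      have hbm : b (tsize x + tsize s + 1) ≤ b (N + Q + 1) := hbb.mono (by omega)
      simp only [List.length_cons]
      rw [Nat.succ_mul l.length]
      generalize l.length * _ = z
      omega
  refine ⟨r₀.seq (popR .D fun _ => loopR .D isEnd fun _ => body), fun n => q n + (b₀ n +
    (b₀ n * (18 * b₀ n + b (b₀ n + q n + 1) + 16) + 2)), ?_, fun a => ?_⟩
  · exact hq.add (hb₀.add ((hb₀.mul (((IsPoly.const_mul 18 hb₀).add
      (hbb.comp ((hb₀.add hq).add_const 1))).add_const 16)).add_const 2))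
  · refine ⟨(hb a _ (List.prefix_refl _)).trans (Nat.le_add_right _ _), fun d u v w => ?_⟩
    have h1 := (h₀ a).2 d u v w
    have hs := (h₀ a).1
    rw [tsize_pair] at hs
    rw [tcode_pair, List.cons_append, List.append_assoc] at h1
    have h2 := loop_runs (b₀ (tsize a)) (q (tsize a)) (ι a).1 (ι a).2 d u v w (by omega) (hb a)
    refine (h1.seq (Runs.popR (r := .D) (m := regs (Sym.one :: (tcode (ι a).1 ++
      (tcode (ι a).2 ++ d))) u v w) (f := fun _ => loopR .D isEnd fun _ => body)
      (by rw [update_regs_D]; exact h2))).mono ?_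
    have hlen : (ι a).1.length ≤ b₀ (tsize a) := by
      have : ∀ l : List β, l.length ≤ tsize l := by
        intro l
        induction l with
        | nil => simp
        | cons x l ih => rw [tsize_cons, List.length_cons]; omega
      have := this (ι a).1
      omega
    have := Nat.mul_le_mul_right
      (18 * b₀ (tsize a) + b (b₀ (tsize a) + q (tsize a) + 1) + 16) hlen
    beta_reduce
    omega

end PT

end PolyTime

end ParamCSP

namespace ParamCSP

open Turing

section Interface

variable {J : Type} [DecidableEq J] {O : MachineFamily J}
variable {α β : Type} [ToTree α] [ToTree β]

namespace Routine

variable {m : Reg → List Sym} {F : ∀ j k, List ((O j).tm.Γ k)} {S' : ∀ k, List (Alph O k)}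
  {t : ℕ} {d u v w : List Sym}

/-- Remove the code of one of the listed symbols from `D` and continue accordingly. -/
def decodeAux (f : Sym → Routine O) : List Sym → Routine O
  | [] => skip O
  | s :: ss => popR .D fun x =>
      if x = some Sym.one then popR .D fun _ => decodeAux f ss else f s

/-- Remove the code of a symbol from `D` and continue accordingly. -/
def decode (f : Sym → Routine O) : Routine O :=
  decodeAux f [Sym.zero, Sym.one, Sym.comma, Sym.semi, Sym.bar]

theorem Runs.decodeAux_next {f : Sym → Routine O} {s : Sym} {ss : List Sym}
    (h : (decodeAux f ss).Runs (stackMap (regs d u v w) F) t S') :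
    (decodeAux f (s :: ss)).Runs (stackMap (regs (Sym.one :: Sym.zero :: d) u v w) F)
      (t + 1 + 1) S' := by
  unfold decodeAux
  refine Runs.popR ?_
  simp only [regs_D, List.head?, if_true, List.tail, update_regs_D]
  refine Runs.popR ?_
  simpa using h

theorem Runs.decodeAux_this {f : Sym → Routine O} {s : Sym} {ss : List Sym}
    (h : (f s).Runs (stackMap (regs d u v w) F) t S') :
    (decodeAux f (s :: ss)).Runs (stackMap (regs (Sym.zero :: d) u v w) F) (t + 1) S' := by
  unfold decodeAux
  refine Runs.popR ?_
  simpa using h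

theorem Runs.decode {f : Sym → Routine O} {s : Sym}
    (h : (f s).Runs (stackMap (regs d u v w) F) t S') :
    (Routine.decode f).Runs (stackMap (regs (tcode s ++ d) u v w) F) (t + 9) S' := by
  cases s
  · exact (Runs.decodeAux_this h).mono (by omega)
  · exact (Runs.decodeAux_next (Runs.decodeAux_this h)).mono (by omega)
  · exact (Runs.decodeAux_next (Runs.decodeAux_next (Runs.decodeAux_this h))).mono (by omega)
  · exact (Runs.decodeAux_next (Runs.decodeAux_next (Runs.decodeAux_next
      (Runs.decodeAux_this h)))).mono (by omega)
  · exact Runs.decodeAux_next (Runs.decodeAux_next (Runs.decodeAux_next (Runs.decodeAux_next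
      (Runs.decodeAux_this h))))

/-- Stop unless there is a node on top. -/
def notOne (s : Option Sym) : Bool := !(s == some Sym.one)

/-- A loop that consumes the code of a list of symbols. -/
theorem Runs.loopR_list {f : Sym → Routine O} (A : List Sym → List Sym)
    (F : List Sym → ∀ j k, List ((O j).tm.Γ k))
    (hf : ∀ x s z, (f s).Runs (stackMap (regs z (A x) v w) (F x)) t
      (stackMap (regs z (A (s :: x)) v w) (F (s :: x)))) (l x d : List Sym) :
    (loopR .D notOne fun _ => Routine.decode f).Runs
      (stackMap (regs (tcode l ++ d) (A x) v w) (F x)) ((t + 10) * l.length + 1)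
      (stackMap (regs d (A (l.reverse ++ x)) v w) (F (l.reverse ++ x))) := by
  induction l generalizing x with
  | nil =>
    have := Runs.loopR_stop (O := O) (F := F x) (r := .D) (isEnd := notOne)
      (f := fun _ => Routine.decode f) (m := regs (Sym.zero :: d) (A x) v w) rfl
    simpa [tcode_nil] using this
  | cons s l ih =>
    have h1 := Runs.decode (hf x s (tcode l ++ d))
    have := Runs.loopR_step (O := O) (F := F x) (r := .D) (isEnd := notOne)
      (f := fun _ => Routine.decode f)
      (m := regs (Sym.one :: (tcode s ++ (tcode l ++ d))) (A x) v w) rfl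
      (by rw [update_regs_D]; exact h1) (ih (s :: x))
    rw [tcode_cons, List.cons_append, List.append_assoc, List.reverse_cons, List.append_assoc]
    refine this.mono ?_
    simp only [List.length_cons]
    nlinarith

/-- Only the stack `k` of the machine `O j` is nonempty. -/
def oneStack (j : J) (k : (O j).tm.K) (W : List ((O j).tm.Γ k)) :
    ∀ j k, List ((O j).tm.Γ k) :=
  Function.update (emptyStacks O) j (Function.update (fun _ => []) k W)

theorem oneStack_nil (j : J) (k : (O j).tm.K) : oneStack j k [] = emptyStacks O := by
  have : Function.update (fun _ => []) k [] = fun k => ([] : List ((O j).tm.Γ k)) :=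
    Function.update_eq_self_iff.2 rfl
  rw [oneStack, this]
  exact Function.update_eq_self_iff.2 rfl

theorem stackMap_oneStack (j : J) (k : (O j).tm.K) (W : List ((O j).tm.Γ k)) :
    stackMap m (oneStack j k W) (.inr ⟨j, k⟩) = W := by
  simp [stackMap, oneStack]

theorem update_oneStack (j : J) (k : (O j).tm.K) (W W' : List ((O j).tm.Γ k)) :
    Function.update (stackMap m (oneStack j k W)) (.inr ⟨j, k⟩) W' =
      stackMap m (oneStack j k W') := by
  rw [oneStack, stackMap_update_inr, Function.update_idem]
  rfl

theorem Runs.push_oneStack (j : J) (k : (O j).tm.K) (W : List ((O j).tm.Γ k))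
    (s : (O j).tm.Γ k) :
    (Routine.push (O := O) (.inr ⟨j, k⟩) s).Runs (stackMap m (oneStack j k W)) 1
      (stackMap m (oneStack j k (s :: W))) := by
  have := Runs.push (S := stackMap m (oneStack j k W)) (.inr ⟨j, k⟩ : Stk O) s
  rwa [stackMap_oneStack, update_oneStack] at this

/-- Empty a stack of the machine `O j` onto `D`, as the code of a list. -/
theorem Runs.unload (j : J) (k : (O j).tm.K) (e : (O j).tm.Γ k ≃ Sym) (W x : List Sym) :
    (Routine.loop (O := O) (.inr ⟨j, k⟩) e (fun s => s == none)
      fun s => Routine.pushWord O .D (Sym.one :: tcode (s.getD Sym.zero))).Runs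
      (stackMap (regs (tcode x ++ d) u v w) (oneStack j k (W.map e.invFun)))
      (12 * W.length + 1)
      (stackMap (regs (tcode (W.reverse ++ x) ++ d) u v w) (emptyStacks O)) := by
  induction W generalizing x with
  | nil =>
    have := Runs.loop_stop (S := stackMap (regs (tcode x ++ d) u v w) (oneStack j k []))
      (k := (.inr ⟨j, k⟩ : Stk O)) (e := e) (isEnd := fun s => s == none)
      (f := fun s => Routine.pushWord O .D (Sym.one :: tcode (s.getD Sym.zero)))
      (by rw [stackMap_oneStack]; rfl)
    rw [update_oneStack, stackMap_oneStack] at this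
    simpa [oneStack_nil] using this
  | cons s W ih =>
    have h1 := Runs.pushWord (O := O) (F := oneStack j k (W.map e.invFun))
      (m := regs (tcode x ++ d) u v w) .D (Sym.one :: tcode s)
    have h2 := ih (s :: x)
    rw [tcode_cons, List.cons_append, List.append_assoc] at h2
    rw [update_regs_D, regs_D, List.cons_append] at h1
    have h3 := Runs.loop_step
      (S := stackMap (regs (tcode x ++ d) u v w) (oneStack j k ((s :: W).map e.invFun)))
      (k := (.inr ⟨j, k⟩ : Stk O)) (e := e) (isEnd := fun s => s == none)
      (f := fun s => Routine.pushWord O .D (Sym.one :: tcode (s.getD Sym.zero)))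
      (by rw [stackMap_oneStack]; rfl)
      (by
        rw [stackMap_oneStack, update_oneStack]
        simpa using h1) h2
    rw [List.reverse_cons, List.append_assoc]
    refine h3.mono ?_
    have : (tcode s).length ≤ 9 := by cases s <;> decide
    simp only [List.length_cons]
    omega

end Routine

namespace PT

open Routine

theorem symCase (h : Sym → β) : PT O h := by
  refine ⟨Routine.decode fun s => pushWord O .D (tcode (h s)),
    fun _ => (∑ s : Sym, tsize (h s)) + 10, IsPoly.const _, fun s => ?_⟩
  have hs : tsize (h s) ≤ ∑ s : Sym, tsize (h s) :=
    Finset.single_le_sum (f := fun s => tsize (h s)) (fun _ _ => Nat.zero_le _)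
      (Finset.mem_univ s)
  refine ⟨by beta_reduce; omega, fun d u v w => ?_⟩
  have h2 := Runs.pushWord (O := O) (F := emptyStacks O) (m := regs d u v w) .D (tcode (h s))
  rw [update_regs_D] at h2
  exact (Runs.decode h2).mono (by simp only [tsize] at hs ⊢; omega)

/-- If `O j` computes `G a` from `F a`, then the reversal of `G a` can be computed from the
reversal of `F a`. -/
theorem oracle_reverse (j : J) {F G : α → List Sym} (hF : PT O fun a => (F a).reverse)
    {q : ℕ → ℕ} (hq : IsPoly q) (hG : ∀ a, tsize (G a).reverse ≤ q (tsize a))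
    (hO : ∀ a, Nonempty (TM2OutputsInTime (O j).tm ((F a).map (O j).inputAlphabet.invFun)
      (some ((G a).map (O j).outputAlphabet.invFun)) (q (tsize a)))) :
    PT O fun a => (G a).reverse := by
  obtain ⟨r, b, hb, h⟩ := hF
  refine ⟨r.seq <| (loopR .D notOne fun _ => Routine.decode fun s =>
      Routine.push (.inr ⟨j, (O j).tm.k₀⟩) ((O j).inputAlphabet.invFun s)).seq <|
    (Routine.call j).seq <| (pushR O .D Sym.zero).seq <|
    (Routine.loop (O := O) (.inr ⟨j, (O j).tm.k₁⟩) (O j).outputAlphabet (fun s => s == none)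
      fun s => pushWord O .D (Sym.one :: tcode (s.getD Sym.zero))),
    fun n => 12 * b n + 13 * q n + 3,
    ((IsPoly.const_mul 12 hb).add (IsPoly.const_mul 13 hq)).add_const 3, fun a => ?_⟩
  have hlen : ∀ l : List Sym, l.length ≤ tsize l := by
    intro l
    induction l with
    | nil => simp
    | cons x l ih => rw [tsize_cons, List.length_cons]; omega
  have l1 := (hlen _).trans (h a).1
  have l2 := (hlen _).trans (hG a)
  refine ⟨(hG a).trans (by beta_reduce; omega), fun d u v w => ?_⟩
  have h1 := (h a).2 d u v w
  have h2 := Runs.loopR_list (O := O) (v := v) (w := w) (t := 1)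
    (f := fun s => Routine.push (O := O) (.inr ⟨j, (O j).tm.k₀⟩) ((O j).inputAlphabet.invFun s))
    (fun _ => u) (fun x => oneStack j (O j).tm.k₀ (x.map (O j).inputAlphabet.invFun))
    (fun x s z => Runs.push_oneStack j _ _ _) (F a).reverse [] d
  have h3 := Runs.call (O := O) j (regs d u v w) (hO a)
  have h4 := Runs.pushR (O := O) (F := oneStack j (O j).tm.k₁
    ((G a).map (O j).outputAlphabet.invFun)) (m := regs d u v w) .D Sym.zero
  have h5 := Runs.unload (O := O) (d := d) (u := u) (v := v) (w := w) j (O j).tm.k₁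
    (O j).outputAlphabet (G a) []
  rw [List.map_nil, oneStack_nil, List.append_nil, List.reverse_reverse] at h2
  rw [tcode_nil, List.append_nil] at h5
  rw [update_regs_D] at h4
  refine (h1.seq (h2.seq (h3.seq (h4.seq h5)))).mono ?_
  rw [List.length_reverse] at l1 l2
  rw [List.length_reverse]
  beta_reduce
  omega

end PT

/-! ### Machines for the computed functions -/

open Routine in
/-- A function of strings that is computed in polynomial time by a program is computed in
polynomial time by a machine. -/
theorem PT.computableWithin [Fintype J] {ea : α → List Sym} {F : α → List Sym}
    (hF : PT O F) (ha : ∀ a, ToTree.repr a = ToTree.repr (ea a)) {γ : Type}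
    {eb : γ → List Sym} {G : α → γ} (hG : ∀ a, F a = eb (G a)) :
    PolyTimeComputable ea eb G := by
  obtain ⟨r, b, hb, h⟩ := hF
  have hlen : ∀ l : List Sym, l.length ≤ tsize l := by
    intro l
    induction l with
    | nil => simp
    | cons x l ih => rw [tsize_cons, List.length_cons]; omega
  have hlen' : ∀ l : List Sym, tsize l ≤ 10 * l.length + 1 := by
    intro l
    induction l with
    | nil => rfl
    | cons s l ih =>
      have : tsize s ≤ 9 := by cases s <;> decide
      rw [tsize_cons, List.length_cons]; omega
  set read : Routine O := (loopR .D (fun s => s == none) fun s =>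
    pushR O .A (s.getD Sym.zero)).seq <| (pushR O .D Sym.zero).seq <|
    loopR .A (fun s => s == none) fun s => pushWord O .D (Sym.one :: tcode (s.getD Sym.zero))
  set write : Routine O := (loopR .D notOne fun _ => Routine.decode fun s => pushR O .A s).seq <|
    loopR .A (fun s => s == none) fun s => pushR O .D (s.getD Sym.zero)
  have read_runs : ∀ w : List Sym, read.Runs (stackMap (regs w [] [] []) (emptyStacks O))
      (14 * w.length + 3) (stackMap (regs (tcode w) [] [] []) (emptyStacks O)) := by
    intro w
    have h1 := Runs.loopR_word (O := O) (F := emptyStacks O) (r := .D) (t := 1)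
      (isEnd := fun s => s == none) (f := fun s => pushR O .A (s.getD Sym.zero))
      (fun x u => regs u x [] []) [] rfl w [] (fun _ _ => rfl) (fun x u => by simp)
      (fun x s u _ => by
        simpa using Runs.pushR (O := O) (F := emptyStacks O) (m := regs u x [] []) .A s)
    have h2 := Runs.pushR (O := O) (F := emptyStacks O) (m := regs [] w.reverse [] [])
      .D Sym.zero
    have h3 := Runs.loopR_word (O := O) (F := emptyStacks O) (r := .A) (t := 11)
      (isEnd := fun s => s == none)
      (f := fun s => pushWord O .D (Sym.one :: tcode (s.getD Sym.zero)))
      (fun x u => regs (tcode x) u [] []) [] rfl w.reverse [] (fun _ _ => rfl)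
      (fun x u => by simp)
      (fun x s u _ => by
        have := Runs.pushWord (O := O) (F := emptyStacks O) (m := regs (tcode x) u [] []) .D
          (Sym.one :: tcode s)
        have hs : (tcode s).length ≤ 9 := by cases s <;> decide
        refine Runs.mono (t := (Sym.one :: tcode s).length + 1) ?_ (by simp; omega)
        simpa [tcode_cons] using this)
    simp only [update_regs_D, update_regs_A, List.append_nil, List.reverse_reverse,
      List.tail_nil] at h1 h2 h3
    refine (h1.seq (h2.seq h3)).mono ?_
    simp only [List.length_reverse]
    omega
  have write_runs : ∀ w : List Sym, write.Runs
      (stackMap (regs (tcode w) [] [] []) (emptyStacks O))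
      (13 * w.length + 2) (stackMap (regs w [] [] []) (emptyStacks O)) := by
    intro w
    have h1 := Runs.loopR_list (O := O) (v := []) (w := []) (t := 1)
      (f := fun s => pushR O .A s) (fun x => x) (fun _ => emptyStacks O)
      (fun x s z => by
        simpa using Runs.pushR (O := O) (F := emptyStacks O) (m := regs z x [] []) .A s) w [] []
    have h2 := Runs.loopR_word (O := O) (F := emptyStacks O) (r := .A) (t := 1)
      (isEnd := fun s => s == none) (f := fun s => pushR O .D (s.getD Sym.zero))
      (fun x u => regs x u [] []) [] rfl w.reverse [] (fun _ _ => rfl) (fun x u => by simp)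
      (fun x s u _ => by
        simpa using Runs.pushR (O := O) (F := emptyStacks O) (m := regs x u [] []) .D s)
    simp only [update_regs_A, List.append_nil, List.reverse_reverse,
      List.tail_nil] at h1 h2
    refine (h1.seq h2).mono ?_
    simp only [List.length_reverse]
    omega
  set R : Routine O := read.seq (r.seq write)
  let tm : FinTM2 :=
    { K := Stk O
      k₀ := .inl .D
      k₁ := .inl .D
      kFin := haveI := fun j => (O j).tm.kFin; inferInstanceAs (Fintype (Stk O))
      Γ := Alph O
      Γk₀Fin := inferInstanceAs (Fintype Sym)
      Λ := Option R.Λ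
      main := some R.entry
      σ := St O
      σFin := haveI := fun j => (O j).tm.σFin; inferInstanceAs (Fintype (St O))
      initialState := (none, initSt O)
      m := fun l => match l with
        | none => .load (fun _ => (none, initSt O)) .halt
        | some l => R.code _ some none l }
  have hb2 : IsPoly fun n => 14 * n + b (10 * n + 1) + 13 * b (10 * n + 1) + 6 :=
    (((IsPoly.const_mul 14 .id).add
      (hb.comp ((IsPoly.const_mul 10 .id).add_const 1))).add
      (IsPoly.const_mul 13 (hb.comp ((IsPoly.const_mul 10 .id).add_const 1)))).add_const 6
  obtain ⟨p, hp⟩ := hb2.bdd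
  refine ⟨p, ⟨tm, .refl Sym, .refl Sym⟩, fun a => ?_⟩
  have hmap : ∀ l : List Sym, l.map (Equiv.refl Sym).invFun = l := fun l => List.map_id l
  have hca : tcode a = tcode (ea a) := by simp only [tcode, ha]
  have hsa : tsize a ≤ 10 * (ea a).length + 1 := by
    simp only [tsize, hca]; exact hlen' _
  have hrun : R.Runs (stackMap (regs (ea a) [] [] []) (emptyStacks O))
      (14 * (ea a).length + 3 + (b (tsize a) + (13 * (F a).length + 2)))
      (stackMap (regs (eb (G a)) [] [] []) (emptyStacks O)) := by
    have h1 := (h a).2 [] [] [] []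
    rw [List.append_nil, List.append_nil, hca] at h1
    rw [← hG]
    exact (read_runs _).seq (h1.seq (write_runs _))
  obtain ⟨v', n, hn, hs⟩ := hrun (Option R.Λ) tm.m some none (fun _ => rfl) none
  have hfin : StepsTo (O := O) tm.m 1
      ⟨some none, (v', initSt O), stackMap (regs (eb (G a)) [] [] []) (emptyStacks O)⟩
      ⟨none, (none, initSt O), stackMap (regs (eb (G a)) [] [] []) (emptyStacks O)⟩ :=
    StepsTo.single rfl
  have hstk : ∀ l : List Sym, stackMap (regs l [] [] []) (emptyStacks O) =
      Function.update (fun k : Stk O => ([] : List (Alph O k))) (.inl .D) l := by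
    intro l
    funext k
    rcases k with k | k
    · cases k <;> simp [stackMap, regs]
    · simp [stackMap, emptyStacks]
  refine ⟨⟨⟨1 + n, ?_⟩, ?_⟩⟩
  · have := hs.trans hfin
    rw [hstk, hstk] at this
    rw [initList_eq, Option.map_some, haltList_eq]
    simp only [hmap]
    exact this
  · have h1 := hb.mono hsa
    have h2 := (hlen (F a)).trans ((h a).1.trans h1)
    have h3 := hp (ea a).length
    beta_reduce at h3
    change 1 + n ≤ p.eval (ea a).length
    omega

end Interface

end ParamCSP

namespace ParamCSP

open Turing

section Library

variable {J : Type} [DecidableEq J] {O : MachineFamily J}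
variable {α β γ σ : Type} [ToTree α] [ToTree β] [ToTree γ] [ToTree σ]

theorem length_le_tsize (l : List α) : l.length ≤ tsize l := by
  induction l with
  | nil => simp
  | cons x l ih => rw [tsize_cons, List.length_cons]; omega

theorem tsize_le_of_mem {l : List α} {x : α} (h : x ∈ l) : tsize x ≤ tsize l := by
  induction l with
  | nil => simp at h
  | cons y l ih =>
    rw [tsize_cons]
    rcases List.mem_cons.1 h with rfl | h
    · omega
    · have := ih h; omega

theorem tsize_append (l l' : List α) : tsize (l ++ l') + 1 = tsize l + tsize l' := by
  induction l with
  | nil => rw [tsize_nil, List.nil_append]; omega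
  | cons x l ih => rw [List.cons_append, tsize_cons, tsize_cons]; omega

theorem tsize_reverse (l : List α) : tsize l.reverse = tsize l := by
  induction l with
  | nil => rfl
  | cons x l ih =>
    have := tsize_append l.reverse [x]
    rw [List.reverse_cons, tsize_cons]
    rw [tsize_cons, tsize_nil] at this
    omega

theorem tsize_list_le {l : List α} {M : ℕ} (h : ∀ x ∈ l, tsize x ≤ M) :
    tsize l ≤ l.length * (M + 1) + 1 := by
  induction l with
  | nil => simp [tsize_nil]
  | cons x l ih =>
    have h1 := ih fun y hy => h y (by simp [hy])
    have h2 := h x (by simp)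
    rw [tsize_cons, List.length_cons, Nat.succ_mul]
    omega

theorem tsize_prefix_le {l l' : List α} (h : l' <+: l) : tsize l' ≤ tsize l := by
  obtain ⟨t, rfl⟩ := h
  have := tsize_append l' t
  have := tsize_pos t
  omega

theorem tsize_bool_le (b : Bool) : tsize b ≤ 3 := by cases b <;> decide

theorem tsize_sym_le (s : Sym) : tsize s ≤ 9 := by cases s <;> decide

namespace PT

@[fun_prop]
theorem ite {c : α → Bool} {F G : α → β} (hc : PT O c) (hF : PT O F) (hG : PT O G) :
    PT O fun a => if c a then F a else G a :=
  (dite hc (f := fun a => F a.1) (g := fun a => G a.1)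
    (hF.of_repr Subtype.val (fun _ => rfl) fun _ => rfl)
    (hG.of_repr Subtype.val (fun _ => rfl) fun _ => rfl)).congr
    fun a => by split_ifs <;> rfl

@[fun_prop]
theorem cons {F : α → β} {G : α → List β} (hF : PT O F) (hG : PT O G) :
    PT O fun a => F a :: G a :=
  (hF.pair hG).of_repr (fun a => a) (fun _ => rfl) fun _ => rfl

@[fun_prop]
theorem natSucc {F : α → ℕ} (hF : PT O F) : PT O fun a => F a + 1 :=
  ((const BTree.nil).pair hF).of_repr (fun a => a) (fun _ => rfl) fun _ => rfl

/-- A number as a list of units. -/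
theorem units {F : α → ℕ} (hF : PT O F) : PT O fun a => List.replicate (F a) () :=
  hF.of_repr (fun a => a) (fun _ => rfl) fun a => by
    change BTree.ofList _ = BTree.ofList _
    rw [List.map_replicate]
    rfl

/-- A left fold with a context, whose states remain of polynomial size. -/
theorem foldl' {F : α → List β} {G : α → σ} {H : α → σ → β → σ} (hF : PT O F) (hG : PT O G)
    (hH : PT O fun p : α × σ × β => H p.1 p.2.1 p.2.2) {q : ℕ → ℕ} (hq : IsPoly q)
    (hb : ∀ a l, l <+: F a → tsize (l.foldl (H a) (G a)) ≤ q (tsize a)) :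
    PT O fun a => (F a).foldl (H a) (G a) := by
  have key : ∀ (a : α) (l : List β) (s : σ),
      l.foldl (fun (s : α × σ) x => (s.1, H s.1 s.2 x)) (a, s) = (a, l.foldl (H a) s) := by
    intro a l
    induction l with
    | nil => intro s; rfl
    | cons x l ih => intro s; exact ih _
  have h1 : PT O fun a => (F a, (a, G a)) := by fun_prop
  have h2 : PT O fun p : β × (α × σ) => (p.2.1, H p.2.1 p.2.2 p.1) := by
    have : PT O fun p : β × (α × σ) => H p.2.1 p.2.2 p.1 :=
      hH.comp (f := fun p : β × (α × σ) => (p.2.1, p.2.2, p.1)) (by fun_prop)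
    fun_prop
  have h3 := foldl_of_bound h1 h2 (q := fun n => n + q n + 1) ((IsPoly.id.add hq).add_const 1)
    (fun a l hl => by
      simp only at hl ⊢
      rw [key, tsize_pair]
      have := hb a l hl
      simp only
      omega)
  have h4 : PT O fun a => ((F a).foldl (fun (s : α × σ) x => (s.1, H s.1 s.2 x)) (a, G a)).2 :=
    snd.comp h3
  exact h4.congr fun a => by rw [key]

/-- A left fold with a context, each of whose steps adds a bounded amount to the size of the
state. -/
theorem foldl {F : α → List β} {G : α → σ} {H : α → σ → β → σ} (hF : PT O F) (hG : PT O G)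
    (hH : PT O fun p : α × σ × β => H p.1 p.2.1 p.2.2) {q : ℕ → ℕ} (hq : IsPoly q)
    (hb : ∀ a s x, tsize (H a s x) ≤ tsize s + q (tsize a + tsize x)) :
    PT O fun a => (F a).foldl (H a) (G a) := by
  obtain ⟨bF, hbF, hF'⟩ := hF.size_le
  obtain ⟨bG, hbG, hG'⟩ := hG.size_le
  refine foldl' hF hG hH (q := fun n => bG n + bF n * q (n + bF n))
    (hbG.add (hbF.mul (hq.comp (IsPoly.id.add hbF)))) fun a l hl => ?_
  have key : ∀ (l : List β) (s : σ), (∀ x ∈ l, tsize x ≤ bF (tsize a)) →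
      tsize (l.foldl (H a) s) ≤ tsize s + l.length * q (tsize a + bF (tsize a)) := by
    intro l
    induction l with
    | nil => intro s _; simp
    | cons x l ih =>
      intro s hx
      have h1 := ih (H a s x) fun y hy => hx y (by simp [hy])
      have h2 := hb a s x
      have h3 := hq.mono (Nat.add_le_add_left (hx x (by simp)) (tsize a))
      rw [List.foldl_cons, List.length_cons, Nat.succ_mul]
      omega
  have h1 := tsize_prefix_le hl
  have h2 := hF' a
  have h3 := key l (G a) fun x hx => (tsize_le_of_mem hx).trans (h1.trans h2)
  have h4 := length_le_tsize l
  have h5 := Nat.mul_le_mul_right (q (tsize a + bF (tsize a))) ((h4.trans h1).trans h2)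
  have h6 := hG' a
  omega

@[fun_prop]
theorem reverse {F : α → List β} (hF : PT O F) : PT O fun a => (F a).reverse := by
  refine (foldl (H := fun (_ : α) (s : List β) x => x :: s) hF (const []) (by fun_prop)
    (q := fun n => n + 1) (IsPoly.id.add_const 1) fun a s x => ?_).congr fun a => ?_
  · rw [tsize_cons]; omega
  · rw [List.foldl_flip_cons_eq_append, List.append_nil, List.map_id']

theorem foldr {F : α → List β} {G : α → σ} {H : α → β → σ → σ} (hF : PT O F) (hG : PT O G)
    (hH : PT O fun p : α × β × σ => H p.1 p.2.1 p.2.2) {q : ℕ → ℕ} (hq : IsPoly q)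
    (hb : ∀ a s x, tsize (H a x s) ≤ tsize s + q (tsize a + tsize x)) :
    PT O fun a => (F a).foldr (H a) (G a) := by
  refine (foldl (H := fun (a : α) (s : σ) x => H a x s) hF.reverse hG ?_ hq hb).congr fun a => ?_
  · exact hH.comp (f := fun p : α × σ × β => (p.1, p.2.2, p.2.1)) (by fun_prop)
  · rw [List.foldl_reverse]

@[fun_prop]
theorem map {F : α → List β} {g : α → β → γ} (hF : PT O F)
    (hg : PT O fun p : α × β => g p.1 p.2) : PT O fun a => (F a).map (g a) := by
  obtain ⟨b, hb, hs⟩ := hg.size_le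
  refine (foldr (H := fun a x (s : List γ) => g a x :: s) hF (const []) ?_
    (q := fun n => b (n + 1) + 1) ((hb.comp (IsPoly.id.add_const 1)).add_const 1)
    fun a s x => ?_).congr fun a => ?_
  · have : PT O fun p : α × β × List γ => g p.1 p.2.1 :=
      hg.comp (f := fun p : α × β × List γ => (p.1, p.2.1)) (by fun_prop)
    fun_prop
  · have := hs (a, x)
    rw [tsize_pair] at this
    rw [tsize_cons]
    simp only at this ⊢
    omega
  · exact List.map_eq_foldr

@[fun_prop]
theorem append {F G : α → List β} (hF : PT O F) (hG : PT O G) : PT O fun a => F a ++ G a := by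
  refine (foldr (H := fun (_ : α) x (s : List β) => x :: s) hF hG (by fun_prop)
    (q := fun n => n + 1) (IsPoly.id.add_const 1) fun a s x => ?_).congr fun a => ?_
  · rw [tsize_cons]; omega
  · exact List.foldr_cons_eq_append'.symm

@[fun_prop]
theorem flatMap {F : α → List β} {g : α → β → List γ} (hF : PT O F)
    (hg : PT O fun p : α × β => g p.1 p.2) : PT O fun a => (F a).flatMap (g a) := by
  obtain ⟨b, hb, hs⟩ := hg.size_le
  refine (foldr (H := fun a x (s : List γ) => g a x ++ s) hF (const []) ?_
    (q := fun n => b (n + 1)) (hb.comp (IsPoly.id.add_const 1))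
    fun a s x => ?_).congr fun a => ?_
  · have : PT O fun p : α × β × List γ => g p.1 p.2.1 :=
      hg.comp (f := fun p : α × β × List γ => (p.1, p.2.1)) (by fun_prop)
    fun_prop
  · have := hs (a, x)
    rw [tsize_pair] at this
    have := tsize_append (g a x) s
    simp only at *
    omega
  · induction F a with
    | nil => rfl
    | cons x l ih => rw [List.flatMap_cons, List.foldr_cons, ih]

@[fun_prop]
theorem filter {F : α → List β} {g : α → β → Bool} (hF : PT O F)
    (hg : PT O fun p : α × β => g p.1 p.2) : PT O fun a => (F a).filter (g a) := by
  refine (flatMap (g := fun a x => if g a x then [x] else []) hF (by fun_prop)).congr fun a => ?_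
  induction F a with
  | nil => rfl
  | cons x l ih =>
    rw [List.flatMap_cons, List.filter_cons, ih]
    split_ifs <;> rfl

@[fun_prop]
theorem length {F : α → List β} (hF : PT O F) : PT O fun a => (F a).length := by
  refine (foldl (H := fun (_ : α) (s : ℕ) (_ : β) => s + 1) hF (const 0) (by fun_prop)
    (q := fun _ => 2) (IsPoly.const 2) fun a s x => ?_).congr fun a => ?_
  · rw [tsize_nat, tsize_nat]; omega
  · have : ∀ (l : List β) (k : ℕ), l.foldl (fun s _ => s + 1) k = k + l.length := by
      intro l
      induction l with
      | nil => intro k; rfl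
      | cons x l ih => intro k; rw [List.foldl_cons, ih, List.length_cons]; omega
    rw [this, Nat.zero_add]

@[fun_prop]
theorem isEmpty {F : α → List β} (hF : PT O F) : PT O fun a => (F a).isEmpty := by
  refine (foldl (H := fun (_ : α) (_ : Bool) (_ : β) => false) hF (const true) (by fun_prop)
    (q := fun _ => 3) (IsPoly.const 3) fun a s x => ?_).congr fun a => ?_
  · exact (tsize_bool_le _).trans (Nat.le_add_left _ _)
  · cases F a with
    | nil => rfl
    | cons x l =>
      have : ∀ l : List β, l.foldl (fun _ _ => false) false = false := by
        intro l
        induction l with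
        | nil => rfl
        | cons x l ih => exact ih
      exact (this l).symm

@[fun_prop]
theorem tail {F : α → List β} (hF : PT O F) : PT O fun a => (F a).tail := by
  have h1 : PT O fun l : {l : List β // ¬ l.isEmpty = true} => l.1.tail :=
    (snd (O := O) (α := β) (β := List β)).of_repr
      (fun l => (l.1.head (by simpa using l.2), l.1.tail))
      (fun ⟨l, hl⟩ => by
        cases l with
        | nil => simp at hl
        | cons => rfl)
      fun _ => rfl
  have h2 : PT O fun l : List β => l.tail :=
    (dite (c := fun l : List β => l.isEmpty) (f := fun _ => []) (isEmpty id) (const _) h1).congr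
      fun l => by cases l <;> rfl
  exact h2.comp hF

@[fun_prop]
theorem headD {F : α → List β} {G : α → β} (hF : PT O F) (hG : PT O G) :
    PT O fun a => (F a).headD (G a) := by
  have h1 : PT O fun l : {p : List β × β // ¬ p.1.isEmpty = true} => l.1.1.headD l.1.2 :=
    ((fst (O := O) (α := β) (β := List β)).comp fst).of_repr
      (fun l => ((l.1.1.head (by simpa using l.2), l.1.1.tail), l.1.2))
      (fun ⟨⟨l, d⟩, hl⟩ => by
        cases l with
        | nil => simp at hl
        | cons => rfl)
      fun ⟨⟨l, d⟩, hl⟩ => by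
        cases l with
        | nil => simp at hl
        | cons => rfl
  have h0 : PT O fun l : {p : List β × β // p.1.isEmpty = true} => l.1.2 :=
    (snd (O := O) (α := List β) (β := β)).of_repr Subtype.val (fun _ => rfl) fun _ => rfl
  have h2 : PT O fun p : List β × β => p.1.headD p.2 :=
    (dite (c := fun p : List β × β => p.1.isEmpty) (by fun_prop) h0 h1).congr
      fun ⟨l, _⟩ => by cases l <;> rfl
  exact h2.comp (hF.pair hG)

@[fun_prop]
theorem not {F : α → Bool} (hF : PT O F) : PT O fun a => !(F a) := by
  refine (ite (F := fun _ => false) (G := fun _ => true) hF (const _) (const _)).congr fun a => ?_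
  cases F a <;> rfl

@[fun_prop]
theorem and {F G : α → Bool} (hF : PT O F) (hG : PT O G) : PT O fun a => F a && G a := by
  refine (ite (G := fun _ => false) hF hG (const _)).congr fun a => ?_
  cases F a <;> rfl

@[fun_prop]
theorem or {F G : α → Bool} (hF : PT O F) (hG : PT O G) : PT O fun a => F a || G a := by
  refine (ite (F := fun _ => true) hF (const _) hG).congr fun a => ?_
  cases F a <;> rfl

@[fun_prop]
theorem any {F : α → List β} {g : α → β → Bool} (hF : PT O F)
    (hg : PT O fun p : α × β => g p.1 p.2) : PT O fun a => (F a).any (g a) := by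
  refine (not (isEmpty (filter hF hg))).congr fun a => ?_
  rw [Bool.eq_iff_iff]
  simp

@[fun_prop]
theorem all {F : α → List β} {g : α → β → Bool} (hF : PT O F)
    (hg : PT O fun p : α × β => g p.1 p.2) : PT O fun a => (F a).all (g a) := by
  refine (not (any (g := fun a x => !(g a x)) hF (by fun_prop))).congr fun a => ?_
  rw [Bool.eq_iff_iff]
  simp

@[fun_prop]
theorem zipIdx {F : α → List β} (hF : PT O F) : PT O fun a => (F a).zipIdx := by
  obtain ⟨b, hb, hs⟩ := hF.size_le
  have key : ∀ l : List β, l.foldl (fun (s : ℕ × List (β × ℕ)) x => (s.1 + 1, (x, s.1) :: s.2))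
      (0, []) = (l.length, l.zipIdx.reverse) := by
    intro l
    induction l using List.reverseRecOn with
    | nil => rfl
    | append_singleton l x ih =>
      rw [List.foldl_append, ih, List.zipIdx_append, List.reverse_append]
      simp
  refine (reverse (snd.comp (foldl' (H := fun (_ : α) (s : ℕ × List (β × ℕ)) x =>
    (s.1 + 1, (x, s.1) :: s.2)) hF (const (0, [])) (by fun_prop)
    (q := fun n => (2 * b n + 1) + (b n * ((b n + (2 * b n + 1) + 1) + 1) + 1) + 1) ?_
    fun a l hl => ?_))).congr fun a => ?_
  · have h2 := (IsPoly.const_mul 2 hb).add_const 1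
    exact (h2.add ((hb.mul (((hb.add h2).add_const 1).add_const 1)).add_const 1)).add_const 1
  · rw [key, tsize_pair, tsize_reverse, tsize_nat]
    have h1 := (tsize_prefix_le hl).trans (hs a)
    have h2 := (length_le_tsize l).trans h1
    have h3 : tsize l.zipIdx ≤
        l.zipIdx.length * ((b (tsize a) + (2 * b (tsize a) + 1) + 1) + 1) + 1 := by
      refine tsize_list_le fun ⟨x, i⟩ hx => ?_
      have hm := List.mem_zipIdx' hx
      rw [tsize_pair, tsize_nat]
      have : tsize x ≤ b (tsize a) := (tsize_le_of_mem (hm.2 ▸ List.getElem_mem hm.1)).trans h1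
      simp only
      omega
    rw [List.length_zipIdx] at h3
    have h4 := Nat.mul_le_mul_right ((b (tsize a) + (2 * b (tsize a) + 1) + 1) + 1) h2
    simp only
    omega
  · rw [key, List.reverse_reverse]

@[fun_prop]
theorem range {F : α → ℕ} (hF : PT O F) : PT O fun a => List.range (F a) := by
  refine (map (g := fun (_ : α) (x : Unit × ℕ) => x.2) (zipIdx (units hF))
    (by fun_prop)).congr fun a => ?_
  rw [List.range_eq_range', ← List.length_replicate (n := F a) (a := ()), ← List.zipIdx_map_snd]
  simp

@[fun_prop]
theorem natAdd {F G : α → ℕ} (hF : PT O F) (hG : PT O G) : PT O fun a => F a + G a := by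
  refine (length (append (units hF) (units hG))).congr fun a => ?_
  simp

@[fun_prop]
theorem natMul {F G : α → ℕ} (hF : PT O F) (hG : PT O G) : PT O fun a => F a * G a := by
  have h := units hF
  have h' := units hG
  refine (length (flatMap (g := fun a (_ : Unit) => List.replicate (G a) ()) h
    (h'.comp fst))).congr fun a => ?_
  simp

theorem natPred {F : α → ℕ} (hF : PT O F) : PT O fun a => F a - 1 := by
  refine (length (tail (units hF))).congr fun a => ?_
  simp

@[fun_prop]
theorem natSub {F G : α → ℕ} (hF : PT O F) (hG : PT O G) : PT O fun a => F a - G a := by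
  refine (foldl (H := fun (_ : α) (s : ℕ) (_ : Unit) => s - 1) (units hG) hF
    (natPred (by fun_prop)) (q := fun _ => 0) (IsPoly.const 0) fun a s x => ?_).congr fun a => ?_
  · rw [tsize_nat, tsize_nat]; omega
  · have : ∀ k m : ℕ, (List.replicate k ()).foldl (fun (s : ℕ) _ => s - 1) m = m - k := by
      intro k
      induction k with
      | zero => intro m; rfl
      | succ k ih => intro m; rw [List.replicate_succ, List.foldl_cons, ih]; omega
    rw [this]

@[fun_prop]
theorem natLE {F G : α → ℕ} (hF : PT O F) (hG : PT O G) : PT O fun a => decide (F a ≤ G a) := by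
  refine (isEmpty (units (natSub hF hG))).congr fun a => ?_
  rw [Bool.eq_iff_iff]
  simp
  omega

@[fun_prop]
theorem natLT {F G : α → ℕ} (hF : PT O F) (hG : PT O G) : PT O fun a => decide (F a < G a) :=
  (natLE (natSucc hF) hG).congr fun _ => rfl

@[fun_prop]
theorem natEq {F G : α → ℕ} (hF : PT O F) (hG : PT O G) : PT O fun a => decide (F a = G a) := by
  refine (and (natLE hF hG) (natLE hG hF)).congr fun a => ?_
  rw [Bool.eq_iff_iff]
  simp
  omega

/-- The result that `O j` computes, provided that the query can be computed. -/
theorem oracle (j : J) {F G : α → List Sym} (hF : PT O F)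
    {q : ℕ → ℕ} (hq : IsPoly q) (hG : ∀ a, (G a).length ≤ q (tsize a))
    (hO : ∀ a, Nonempty (TM2OutputsInTime (O j).tm ((F a).map (O j).inputAlphabet.invFun)
      (some ((G a).map (O j).outputAlphabet.invFun)) (q (tsize a)))) :
    PT O G := by
  refine (reverse (oracle_reverse j hF.reverse (q := fun n => q n + (q n * 10 + 1))
    (hq.add ((hq.mul (IsPoly.const 10)).add_const 1)) (fun a => ?_) fun a => ?_)).congr
    fun a => (List.reverse_reverse _).symm
  · have h1 := tsize_list_le (l := G a) fun s _ => tsize_sym_le s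
    have h2 := hG a
    rw [tsize_reverse]
    omega
  · obtain ⟨h⟩ := hO a
    exact ⟨⟨h.toEvalsTo, h.steps_le_m.trans (Nat.le_add_right _ _)⟩⟩

end PT

end Library

end ParamCSP

namespace ParamCSP

/-! ### Increasing lists -/

theorem nodup_of_pairwise_lt {t : List ℕ} (ht : t.Pairwise (· < ·)) : t.Nodup :=
  ht.imp fun h => ne_of_lt h

theorem eq_of_pairwise_lt {t t' : List ℕ} (ht : t.Pairwise (· < ·)) (ht' : t'.Pairwise (· < ·))
    (h : ∀ x, x ∈ t ↔ x ∈ t') : t = t' :=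
  ((List.perm_ext_iff_of_nodup (nodup_of_pairwise_lt ht) (nodup_of_pairwise_lt ht')).2
    h).eq_of_pairwise (fun _ _ _ _ h1 h2 => absurd h1 (lt_asymm h2)) ht ht'

/-- The strictly increasing lists of length at most `j` with entries from `l`. -/
def incLists : ℕ → List ℕ → List (List ℕ)
  | 0, _ => [[]]
  | j + 1, l => [] :: l.flatMap fun a =>
      (incLists j (l.filter fun b => decide (a < b))).map fun t => a :: t

theorem mem_incLists {j : ℕ} {l t : List ℕ} :
    t ∈ incLists j l ↔ t.length ≤ j ∧ t.Pairwise (· < ·) ∧ ∀ x ∈ t, x ∈ l := by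
  induction j generalizing l t with
  | zero => cases t <;> simp [incLists]
  | succ j ih =>
    cases t with
    | nil => simp [incLists]
    | cons a t =>
      simp only [incLists, List.mem_cons, reduceCtorEq, List.mem_flatMap, List.mem_map, ih,
        List.cons.injEq, false_or, List.length_cons, List.pairwise_cons, List.mem_filter,
        decide_eq_true_eq, forall_eq_or_imp, Nat.add_le_add_iff_right]
      constructor
      · rintro ⟨a', ha', t', ⟨h1, h2, h3⟩, rfl, rfl⟩
        exact ⟨h1, ⟨fun x hx => (h3 x hx).2, h2⟩, ha', fun x hx => (h3 x hx).1⟩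
      · rintro ⟨h1, ⟨h2, h3⟩, ha, h4⟩
        exact ⟨a, ha, t, ⟨h1, h3, fun x hx => ⟨h4 x hx, h2 x hx⟩⟩, rfl, rfl⟩

theorem nodup_incLists {j : ℕ} {l : List ℕ} (hl : l.Nodup) : (incLists j l).Nodup := by
  induction j generalizing l with
  | zero => simp [incLists]
  | succ j ih =>
    rw [incLists, List.nodup_cons, List.nodup_flatMap]
    refine ⟨by simp, fun a _ => (ih (hl.filter _)).map (List.cons_injective), ?_⟩
    refine hl.imp fun {a b} hab => ?_
    simp only [Function.onFun, List.disjoint_left, List.mem_map, not_exists, not_and]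
    rintro _ ⟨t, _, rfl⟩ t' _ h
    exact hab (List.cons.inj h).1.symm

theorem incLists_map {j : ℕ} {l : List ℕ} {v : ℕ → ℕ}
    (hv : ∀ a ∈ l, ∀ b ∈ l, a < b ↔ v a < v b) :
    incLists j (l.map v) = (incLists j l).map (List.map v) := by
  induction j generalizing l with
  | zero => rfl
  | succ j ih =>
    simp only [incLists, List.map_cons, List.map_nil, List.flatMap_map, List.map_flatMap,
      List.map_map]
    congr 1
    refine List.flatMap_congr fun a ha => ?_
    have : (l.map v).filter (fun b => decide (v a < b)) =
        (l.filter fun b => decide (a < b)).map v := by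
      rw [List.filter_map]
      congr 1
      refine List.filter_congr fun b hb => ?_
      simp [hv a ha b hb]
    rw [this, ih fun a' ha' b' hb' => hv a' (List.mem_of_mem_filter ha') b'
      (List.mem_of_mem_filter hb'), List.map_map]
    rfl

theorem sum_incLists {M : Type} [AddCommMonoid M] {j : ℕ} {l : List ℕ} (hl : l.Nodup)
    (f : Finset ℕ → M) :
    ((incLists j l).map fun t => f t.toFinset).sum =
      ∑ B ∈ l.toFinset.powerset with B.card ≤ j, f B := by
  rw [← List.sum_toFinset _ (nodup_incLists hl)]
  refine Finset.sum_bij (fun t _ => t.toFinset) (fun t ht => ?_) (fun t ht t' ht' h => ?_)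
    (fun B hB => ?_) fun _ _ => rfl
  · rw [List.mem_toFinset, mem_incLists] at ht
    simp only [Finset.mem_filter, Finset.mem_powerset]
    refine ⟨fun x hx => ?_, ?_⟩
    · simpa using ht.2.2 x (by simpa using hx)
    · rw [List.toFinset_card_of_nodup (nodup_of_pairwise_lt ht.2.1)]
      exact ht.1
  · rw [List.mem_toFinset, mem_incLists] at ht ht'
    exact eq_of_pairwise_lt ht.2.1 ht'.2.1 fun x => by simpa using congrArg (x ∈ ·) h
  · simp only [Finset.mem_filter, Finset.mem_powerset] at hB
    refine ⟨B.sort, ?_, by simp⟩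
    rw [List.mem_toFinset, mem_incLists]
    refine ⟨by simpa using hB.2, B.sortedLT_sort.pairwise, fun x hx => ?_⟩
    simpa using hB.1 (by simpa using hx)

/-! ### Möbius inversion on finite sets -/

theorem sum_powerset_alternating (A : Finset ℕ) (g : Finset ℕ → ℤ) :
    ∑ B ∈ A.powerset, ∑ C ∈ B.powerset, (-1) ^ (B.card + C.card) * g C = g A := by
  induction A using Finset.induction_on generalizing g with
  | empty => simp
  | insert a A ha ih =>
    rw [Finset.sum_powerset_insert ha, ← Finset.sum_add_distrib, ← ih fun B => g (insert a B)]
    refine Finset.sum_congr rfl fun B hB => ?_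
    have haB : a ∉ B := fun h => ha (Finset.mem_powerset.1 hB h)
    rw [Finset.sum_powerset_insert haB, Finset.card_insert_of_notMem haB, ← add_assoc,
      ← Finset.sum_add_distrib]
    have h0 : ∑ C ∈ B.powerset, ((-1) ^ (B.card + C.card) * g C +
        (-1) ^ (B.card + 1 + C.card) * g C) = 0 :=
      Finset.sum_eq_zero fun C _ => by ring
    rw [h0, zero_add]
    refine Finset.sum_congr rfl fun C hC => ?_
    rw [Finset.card_insert_of_notMem fun h => haB (Finset.mem_powerset.1 hC h)]
    ring

end ParamCSP

namespace ParamCSP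

/-! ### Counting satisfied constraints by inclusion and exclusion -/

section Counting

variable {C : Type} (d : ℕ) (cs : List C) (scope : C → List ℕ) (good : C → List ℕ → Bool)

/-- Whether the length of a list is even. -/
def isEven (l : List ℕ) : Bool := decide (Even l.length)

/-- Whether all entries of `x` are in the scope of `c`. -/
def covers (c : C) (x : List ℕ) : Bool :=
  x.all fun v => (scope c).any fun u => decide (u = v)

theorem covers_iff {c : C} {x : List ℕ} :
    covers scope c x = true ↔ x.toFinset ⊆ (scope c).toFinset := by
  simp [covers, Finset.subset_iff]

/-- The number of pairs of a constraint `c` whose scope covers `x` and a subset `t` of `x` that is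
good for `c`, whose parity agrees (`b = true`) or disagrees (`b = false`) with that of `x`. -/
def goodCount (b : Bool) (x : List ℕ) : ℕ :=
  (cs.flatMap fun c => if covers scope c x then
    (incLists (d + 1) x).filter fun t => ((isEven t == isEven x) == b) && good c t
    else []).length

theorem length_filter_sub_length_filter {α : Type} (l : List α) (p q : α → Bool) :
    ((l.filter p).length : ℤ) - (l.filter q).length =
      (l.map fun t => (if p t then 1 else 0) - (if q t then (1 : ℤ) else 0)).sum := by
  induction l with
  | nil => simp
  | cons a l ih =>
    rw [List.map_cons, List.sum_cons, ← ih, List.filter_cons, List.filter_cons]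
    split_ifs <;> push_cast [List.length_cons] <;> ring

theorem goodCount_sub_goodCount (g : C → Finset ℕ → ℤ)
    (hg : ∀ c t, g c t.toFinset = if good c t then 1 else 0) {x : List ℕ}
    (hx : x.Pairwise (· < ·)) (hxd : x.length ≤ d + 1) :
    (goodCount d cs scope good true x : ℤ) - goodCount d cs scope good false x =
      (cs.map fun c => if x.toFinset ⊆ (scope c).toFinset then
        ∑ B ∈ x.toFinset.powerset, (-1) ^ (x.toFinset.card + B.card) * g c B else 0).sum := by
  induction cs with
  | nil => simp [goodCount]
  | cons c cs ih =>
    simp only [goodCount, List.flatMap_cons, List.length_append] at ih ⊢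
    rw [List.map_cons, List.sum_cons, ← ih]
    push_cast
    rw [add_sub_add_comm]
    congr 1
    by_cases hc : x.toFinset ⊆ (scope c).toFinset
    · rw [if_pos ((covers_iff scope).2 hc), if_pos ((covers_iff scope).2 hc), if_pos hc,
        length_filter_sub_length_filter]
      have hcard : x.toFinset.card = x.length :=
        List.toFinset_card_of_nodup (nodup_of_pairwise_lt hx)
      have h1 : ∀ t ∈ incLists (d + 1) x,
          ((if (((isEven t == isEven x) == true) && good c t) then 1 else 0) -
            (if (((isEven t == isEven x) == false) && good c t) then (1 : ℤ) else 0)) =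
          (-1) ^ (x.toFinset.card + t.toFinset.card) * g c t.toFinset := by
        intro t ht
        rw [mem_incLists] at ht
        rw [hg, hcard, List.toFinset_card_of_nodup (nodup_of_pairwise_lt ht.2.1)]
        by_cases h1 : Even t.length <;> by_cases h2 : Even x.length <;>
          cases good c t <;>
          simp [isEven, h1, h2, pow_add,
            Odd.neg_one_pow, Nat.not_even_iff_odd.1]
      rw [List.map_congr_left h1,
        sum_incLists (nodup_of_pairwise_lt hx)
          fun B => (-1) ^ (x.toFinset.card + B.card) * g c B]
      refine Finset.sum_congr (Finset.filter_true_of_mem fun B hB => ?_) fun _ _ => rfl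
      exact (Finset.card_le_card (Finset.mem_powerset.1 hB)).trans (hcard.le.trans hxd)
    · have hc' : ¬ covers scope c x = true := fun h => hc ((covers_iff scope).1 h)
      rw [if_neg hc', if_neg hc', if_neg hc]
      simp

theorem sum_goodCount (g : C → Finset ℕ → ℤ)
    (hg : ∀ c t, g c t.toFinset = if good c t then 1 else 0) {l : List ℕ}
    (hl : l.Pairwise (· < ·))
    (hlim : ∀ c ∈ cs, (l.toFinset ∩ (scope c).toFinset).card ≤ d) :
    (((incLists (d + 1) l).map fun x => goodCount d cs scope good true x).sum : ℤ) -
      ((incLists (d + 1) l).map fun x => goodCount d cs scope good false x).sum =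
      (cs.map fun c => g c (l.toFinset ∩ (scope c).toFinset)).sum := by
  have h0 : ∀ (L : List (List ℕ)) (f h : List ℕ → ℕ),
      ((L.map f).sum : ℤ) - (L.map h).sum = (L.map fun x => (f x : ℤ) - h x).sum := by
    intro L f h
    induction L with
    | nil => simp
    | cons a L ih => simp only [List.map_cons, List.sum_cons, ← ih]; push_cast; ring
  rw [h0, List.map_congr_left fun x hx => goodCount_sub_goodCount d cs scope good g hg
    (mem_incLists.1 hx).2.1 (mem_incLists.1 hx).1]
  induction cs with
  | nil => simp
  | cons c cs ih =>
    simp only [List.map_cons, List.sum_cons, List.sum_map_add]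
    rw [ih fun c' hc' => hlim c' (by simp [hc'])]
    congr 1
    rw [sum_incLists (nodup_of_pairwise_lt hl) fun B => if B ⊆ (scope c).toFinset then
      ∑ A ∈ B.powerset, (-1) ^ (B.card + A.card) * g c A else 0,
      ← sum_powerset_alternating (l.toFinset ∩ (scope c).toFinset) (g c), ← Finset.sum_filter]
    refine Finset.sum_congr ?_ fun _ _ => rfl
    ext B
    simp only [Finset.mem_filter, Finset.mem_powerset, Finset.subset_inter_iff]
    constructor
    · rintro ⟨⟨h1, -⟩, h2⟩
      exact ⟨h1, h2⟩
    · rintro ⟨h1, h2⟩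
      refine ⟨⟨h1, ?_⟩, h2⟩
      have := (Finset.card_le_card (Finset.subset_inter h1 h2)).trans (hlim c (by simp))
      omega

theorem goodCount_le (b : Bool) {x l : List ℕ} (hx : x.Pairwise (· < ·)) (hxl : ∀ a ∈ x, a ∈ l) :
    goodCount d cs scope good b x ≤ cs.length * (incLists (d + 1) l).length := by
  unfold goodCount
  induction cs with
  | nil => simp
  | cons c cs ih =>
    rw [List.flatMap_cons, List.length_append, List.length_cons, Nat.succ_mul, add_comm]
    refine Nat.add_le_add ih ?_
    split_ifs
    · refine (List.length_filter_le _ _).trans ?_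
      refine ((nodup_incLists (nodup_of_pairwise_lt hx)).subperm fun t ht => ?_).length_le
      rw [mem_incLists] at ht ⊢
      exact ⟨ht.1, ht.2.1, fun a ha => hxl a (ht.2.2 a ha)⟩
    · simp

end Counting

/-! ### The universe of the structure and its relation -/

/-- An element of the structure: an index list with its position, the variables chosen for the
indices, and the sums of the positive and the negative counts at smaller positions. -/
structure Cell where
  pos : ℕ
  idx : List ℕ
  val : List ℕ
  pls : ℕ
  mns : ℕ

section Cells

variable {C : Type} (d k n : ℕ) (cs : List C) (scope : C → List ℕ) (good : C → List ℕ → Bool)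

/-- The sets of at most `d + 1` indices. -/
def indexLists : List (List ℕ) := incLists (d + 1) (List.range k)

/-- A bound on the sums of counts. -/
def sumBound : ℕ :=
  (indexLists d k).length * (cs.length * (incLists (d + 1) (List.range n)).length)

/-- The universe. -/
def cells : List Cell :=
  (indexLists d k).zipIdx.flatMap fun e =>
    ((incLists (d + 1) (List.range n)).filter fun x => decide (x.length = e.1.length)).flatMap
      fun x => (List.range (sumBound d k n cs + 1)).flatMap fun p =>
        (List.range (sumBound d k n cs + 1)).map fun q => ⟨e.2, e.1, x, p, q⟩

theorem mem_cells {y : Cell} : y ∈ cells d k n cs ↔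
    (indexLists d k)[y.pos]? = some y.idx ∧ y.val ∈ incLists (d + 1) (List.range n) ∧
      y.val.length = y.idx.length ∧ y.pls ≤ sumBound d k n cs ∧ y.mns ≤ sumBound d k n cs := by
  obtain ⟨pos, idx, val, p, q⟩ := y
  simp only [cells, List.mem_flatMap, List.mem_filter, List.mem_map, List.mem_range, Cell.mk.injEq,
    List.mem_zipIdx_iff_getElem?, Prod.exists, decide_eq_true_eq, Nat.lt_succ_iff]
  constructor
  · rintro ⟨e, i, h1, x, ⟨h2, h3⟩, p, h4, q, h5, rfl, rfl, rfl, rfl, rfl⟩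
    exact ⟨h1, h2, h3, h4, h5⟩
  · rintro ⟨h1, h2, h3, h4, h5⟩
    exact ⟨idx, pos, h1, val, ⟨h2, h3⟩, p, h4, q, h5, rfl, rfl, rfl, rfl, rfl⟩

/-- Whether two elements choose the same variables for the same indices. -/
def consistent (a b : Cell) : Bool :=
  a.idx.zipIdx.all fun i => a.val.zipIdx.all fun u =>
    b.idx.zipIdx.all fun j => b.val.zipIdx.all fun v =>
      !(decide (i.2 = u.2) && (decide (j.2 = v.2) && decide (i.1 = j.1))) || decide (u.1 = v.1)

theorem consistent_iff {a b : Cell} : consistent a b = true ↔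
    ∀ (i u v r s : ℕ), a.idx[r]? = some i → a.val[r]? = some u → b.idx[s]? = some i →
      b.val[s]? = some v → u = v := by
  simp only [consistent, List.all_eq_true, Prod.forall, List.mem_zipIdx_iff_getElem?,
    Bool.or_eq_true, Bool.not_eq_true', Bool.and_eq_false_iff, decide_eq_false_iff_not,
    decide_eq_true_eq]
  constructor
  · intro h i u v r s h1 h2 h3 h4
    have := h i r h1 u r h2 i s h3 v s h4
    tauto
  · intro h i r h1 u r' h2 j s h3 v s' h4
    by_cases e1 : r = r'
    · by_cases e2 : s = s'
      · by_cases e3 : i = j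
        · subst e1 e2 e3
          exact Or.inr (h i u v r s h1 h2 h3 h4)
        · tauto
      · tauto
    · tauto

/-- Whether the sums of `b` are those of `a` together with the counts at `a`. -/
def stepOK (a b : Cell) : Bool :=
  decide (b.pls = a.pls + goodCount d cs scope good true a.val) &&
    decide (b.mns = a.mns + goodCount d cs scope good false a.val)

/-- Whether all constraints are counted after `a`. -/
def finalOK (a : Cell) : Bool :=
  decide (a.pls + goodCount d cs scope good true a.val =
    a.mns + goodCount d cs scope good false a.val + cs.length)

/-- Whether `a` consists of `d + 1` variables in a common scope. -/
def tooBig (a : Cell) : Bool :=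
  decide (a.val.length = d + 1) && cs.any fun c => covers scope c a.val

/-- The binary relation of the structure: two elements, given with their numbers, that must not
be chosen together. -/
def conflict (a b : Cell × ℕ) : Bool :=
  (decide (a.1.pos = b.1.pos) && !decide (a.2 = b.2)) ||
  (!consistent a.1 b.1 ||
  ((decide (b.1.pos = a.1.pos + 1) && !stepOK d cs scope good a.1 b.1) ||
  ((decide (a.1.pos = 0) && !(decide (a.1.pls = 0) && decide (a.1.mns = 0))) ||
  ((decide (a.1.pos + 1 = (indexLists d k).length) && !finalOK d cs scope good a.1) ||
  tooBig d cs scope a.1))))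

/-- The conflicting pairs of numbers of elements. -/
def conflicts : List (ℕ × ℕ) :=
  (cells d k n cs).zipIdx.flatMap fun a =>
    ((cells d k n cs).zipIdx.filter fun b => conflict d k cs scope good a b).map fun b =>
      (a.2, b.2)

theorem conflict_eq_false_iff {a b : Cell × ℕ} : conflict d k cs scope good a b = false ↔
    (a.1.pos = b.1.pos → a.2 = b.2) ∧ consistent a.1 b.1 = true ∧
    (b.1.pos = a.1.pos + 1 → b.1.pls = a.1.pls + goodCount d cs scope good true a.1.val ∧
      b.1.mns = a.1.mns + goodCount d cs scope good false a.1.val) ∧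
    (a.1.pos = 0 → a.1.pls = 0 ∧ a.1.mns = 0) ∧
    (a.1.pos + 1 = (indexLists d k).length →
      a.1.pls + goodCount d cs scope good true a.1.val =
        a.1.mns + goodCount d cs scope good false a.1.val + cs.length) ∧
    (a.1.val.length = d + 1 → ∀ c ∈ cs, ¬ a.1.val.toFinset ⊆ (scope c).toFinset) := by
  simp only [conflict, stepOK, finalOK, tooBig, Bool.or_eq_false_iff, Bool.and_eq_false_imp,
    Bool.not_eq_false', decide_eq_true_eq, Bool.and_eq_true, List.any_eq_false, covers_iff]

theorem mem_conflicts {i j : ℕ} : (i, j) ∈ conflicts d k n cs scope good ↔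
    ∃ a b, (cells d k n cs)[i]? = some a ∧ (cells d k n cs)[j]? = some b ∧
      conflict d k cs scope good (a, i) (b, j) = true := by
  simp only [conflicts, List.mem_flatMap, List.mem_map, List.mem_filter, Prod.exists,
    List.mem_zipIdx_iff_getElem?, Prod.mk.injEq]
  constructor
  · rintro ⟨a, i, h1, b, j, ⟨h2, h3⟩, rfl, rfl⟩
    exact ⟨a, b, h1, h2, h3⟩
  · rintro ⟨a, b, h1, h2, h3⟩
    exact ⟨a, i, h1, b, j, ⟨h2, h3⟩, rfl, rfl⟩

end Cells

end ParamCSP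

namespace ParamCSP

/-! ### Correctness of the structure -/

section Correctness

variable {C : Type} {d k n : ℕ} {cs : List C} {scope : C → List ℕ} {good : C → List ℕ → Bool}
  {P : C → Finset ℕ → Prop}

theorem sum_goodCount_eq_iff (hgood : ∀ c t, good c t = true ↔ P c t.toFinset)
    (hP : ∀ c D, P c D ↔ P c (D ∩ (scope c).toFinset)) {l : List ℕ} (hl : l.Pairwise (· < ·))
    (hlim : ∀ c ∈ cs, (l.toFinset ∩ (scope c).toFinset).card ≤ d) :
    ((incLists (d + 1) l).map fun x => goodCount d cs scope good true x).sum =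
      ((incLists (d + 1) l).map fun x => goodCount d cs scope good false x).sum + cs.length ↔
    ∀ c ∈ cs, P c l.toFinset := by
  classical
  have h := sum_goodCount d cs scope good (fun c B => if P c B then 1 else 0)
    (fun c t => by simp only [hgood]) hl hlim
  have h2 : (cs.map fun c => if P c (l.toFinset ∩ (scope c).toFinset) then (1 : ℤ) else 0).sum =
      cs.countP fun c => decide (P c l.toFinset) := by
    clear h hlim
    induction cs with
    | nil => simp
    | cons c cs ih =>
      rw [List.map_cons, List.sum_cons, ih, List.countP_cons]
      by_cases hc : P c l.toFinset
      · have := (hP c _).1 hc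
        simp [hc, this, add_comm]
      · have : ¬ P c (l.toFinset ∩ (scope c).toFinset) := fun h => hc ((hP c _).2 h)
        simp [hc, this]
  rw [h2] at h
  have h3 := List.countP_eq_length (p := fun c => decide (P c l.toFinset)) (l := cs)
  simp only [decide_eq_true_eq] at h3
  rw [← h3]
  omega

/-- The sum of the counts at the positions below `t`, for the variables `v`. -/
def prefixSum (d k : ℕ) (cs : List C) (scope : C → List ℕ) (good : C → List ℕ → Bool)
    (v : ℕ → ℕ) (b : Bool) (t : ℕ) : ℕ :=
  (((indexLists d k).take t).map fun e => goodCount d cs scope good b (e.map v)).sum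

theorem prefixSum_succ {v : ℕ → ℕ} {b : Bool} {t : ℕ} {e : List ℕ}
    (he : (indexLists d k)[t]? = some e) :
    prefixSum d k cs scope good v b (t + 1) =
      prefixSum d k cs scope good v b t + goodCount d cs scope good b (e.map v) := by
  rw [prefixSum, List.take_add_one, he]
  simp [prefixSum]

theorem prefixSum_length {v : ℕ → ℕ} {b : Bool}
    (hv : ∀ i < k, ∀ j < k, i < j ↔ v i < v j) :
    prefixSum d k cs scope good v b (indexLists d k).length =
      ((incLists (d + 1) ((List.range k).map v)).map fun x =>
        goodCount d cs scope good b x).sum := by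
  rw [prefixSum, List.take_length, incLists_map (by simpa using hv), List.map_map]
  rfl

theorem prefixSum_le {v : ℕ → ℕ} {b : Bool} {t : ℕ}
    (hv : ∀ i < k, ∀ j < k, i < j ↔ v i < v j) (hvn : ∀ i < k, v i < n) :
    prefixSum d k cs scope good v b t ≤ sumBound d k n cs := by
  refine (List.sum_le_card_nsmul _
    (cs.length * (incLists (d + 1) (List.range n)).length) fun x hx => ?_).trans ?_
  · obtain ⟨e, he, rfl⟩ := List.mem_map.1 hx
    have he' := mem_incLists.1 (List.mem_of_mem_take he)
    refine goodCount_le d cs scope good b ?_ ?_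
    · rw [List.pairwise_map]
      refine he'.2.1.imp_of_mem fun {i j} hi hj hij => ?_
      exact (hv i (by simpa using he'.2.2 i hi) j (by simpa using he'.2.2 j hj)).1 hij
    · simp only [List.mem_map, List.mem_range, forall_exists_index, and_imp]
      rintro _ i hi rfl
      exact hvn i (by simpa using he'.2.2 i hi)
  · rw [List.length_map, smul_eq_mul, sumBound]
    exact Nat.mul_le_mul_right _ (by simp)

theorem map_mem_incLists {v : ℕ → ℕ} {e : List ℕ} (he : e ∈ indexLists d k)
    (hv : ∀ i < k, ∀ j < k, i < j ↔ v i < v j) (hvn : ∀ i < k, v i < n) :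
    e.map v ∈ incLists (d + 1) (List.range n) := by
  rw [indexLists, mem_incLists] at he
  rw [mem_incLists]
  refine ⟨by simpa using he.1, ?_, ?_⟩
  · rw [List.pairwise_map]
    refine he.2.1.imp_of_mem fun {i j} hi hj hij => ?_
    exact (hv i (by simpa using he.2.2 i hi) j (by simpa using he.2.2 j hj)).1 hij
  · simp only [List.mem_map, List.mem_range, forall_exists_index, and_imp]
    rintro _ i hi rfl
    exact hvn i (by simpa using he.2.2 i hi)

theorem pairwise_map_range {v : ℕ → ℕ} (hv : ∀ i < k, ∀ j < k, i < j ↔ v i < v j) :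
    ((List.range k).map v).Pairwise (· < ·) := by
  rw [List.pairwise_map]
  refine List.pairwise_lt_range.imp_of_mem fun {i j} hi hj hij => ?_
  exact (hv i (by simpa using hi) j (by simpa using hj)).1 hij

theorem cells_length_pos : 0 < (cells d k n cs).length := by
  have h1 : [] ∈ indexLists d k := by simp [indexLists, mem_incLists]
  obtain ⟨t, ht⟩ := List.mem_iff_getElem?.1 h1
  refine List.length_pos_of_mem (a := ⟨t, [], [], 0, 0⟩) ?_
  rw [mem_cells]
  exact ⟨ht, by simp [mem_incLists], rfl, Nat.zero_le _, Nat.zero_le _⟩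

/-- A solution gives a set of elements without conflicts. -/
theorem exists_independent_of_solution (hgood : ∀ c t, good c t = true ↔ P c t.toFinset)
    (hP : ∀ c D, P c D ↔ P c (D ∩ (scope c).toFinset))
    (hlim : ∀ c D, P c D → (D ∩ (scope c).toFinset).card ≤ d)
    {v : ℕ → ℕ} (hv : ∀ i < k, ∀ j < k, i < j ↔ v i < v j) (hvn : ∀ i < k, v i < n)
    (hsat : ∀ c ∈ cs, P c ((List.range k).map v).toFinset) :
    ∃ S : Finset (Fin (cells d k n cs).length), S.card = (indexLists d k).length ∧
      ∀ i ∈ S, ∀ j ∈ S, ((i : ℕ), (j : ℕ)) ∉ conflicts d k n cs scope good := by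
  classical
  set L := indexLists d k with hL
  let y : Fin L.length → Cell := fun t => ⟨t, L[t], (L[t]).map v,
    prefixSum d k cs scope good v true t, prefixSum d k cs scope good v false t⟩
  have hget : ∀ t : Fin L.length, L[(t : ℕ)]? = some L[t] := fun t => by simp
  have hy : ∀ t, y t ∈ cells d k n cs := fun t => by
    rw [mem_cells]
    refine ⟨hget t, map_mem_incLists (List.getElem_mem _) hv hvn, by simp [y],
      prefixSum_le hv hvn, prefixSum_le hv hvn⟩
  choose f hf using fun t => List.mem_iff_get.1 (hy t)
  have hinj : Function.Injective f := fun s t hst => by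
    have h := congrArg Cell.pos ((hf s).symm.trans ((congrArg _ hst).trans (hf t)))
    exact Fin.ext h
  refine ⟨Finset.univ.image f, by rw [Finset.card_image_of_injective _ hinj]; simp, ?_⟩
  simp only [Finset.mem_image, Finset.mem_univ, true_and]
  rintro _ ⟨s, rfl⟩ _ ⟨t, rfl⟩ hmem
  obtain ⟨a, b, ha, hb, hab⟩ := (mem_conflicts d k n cs scope good).1 hmem
  have hget' : ∀ t, (cells d k n cs)[(f t : ℕ)]? = some (y t) := fun t => by
    rw [List.getElem?_eq_getElem (f t).2]; exact congrArg some (hf t)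
  obtain rfl : y s = a := Option.some.inj ((hget' s).symm.trans ha)
  obtain rfl : y t = b := Option.some.inj ((hget' t).symm.trans hb)
  rw [← Bool.not_eq_false, conflict_eq_false_iff] at hab
  refine hab ⟨fun h => ?_, ?_, fun h => ?_, fun h => ?_, fun h => ?_, fun h c hc hsub => ?_⟩
  · have : s = t := Fin.ext h
    rw [this]
  · rw [consistent_iff]
    intro i u w r r' h1 h2 h3 h4
    simp only [y, List.getElem?_map] at h1 h2 h3 h4
    rw [h1] at h2
    rw [h3] at h4
    exact (Option.some.inj h2).symm.trans (Option.some.inj h4)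
  · have h' : (t : ℕ) = s + 1 := h
    simp only [y, h']
    exact ⟨prefixSum_succ (hget s), prefixSum_succ (hget s)⟩
  · have h' : (s : ℕ) = 0 := h
    simp [y, h', prefixSum]
  · have h' : (s : ℕ) + 1 = L.length := h
    simp only [y]
    rw [← prefixSum_succ (hget s), ← prefixSum_succ (hget s), h', prefixSum_length hv,
      prefixSum_length hv, sum_goodCount_eq_iff hgood hP (pairwise_map_range hv)
        fun c hc => hlim c _ (hsat c hc)]
    exact hsat
  · have hx := map_mem_incLists (n := n) (List.getElem_mem s.2) hv hvn
    have hcard := List.toFinset_card_of_nodup (nodup_of_pairwise_lt (mem_incLists.1 hx).2.1)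
    have hs : (y s).val.toFinset ⊆ ((List.range k).map v).toFinset := by
      intro a ha
      have he := mem_incLists.1 (List.getElem_mem s.2 : L[(s : ℕ)] ∈ incLists _ _)
      simp only [y, List.mem_toFinset, List.mem_map] at ha ⊢
      obtain ⟨i, hi, rfl⟩ := ha
      exact ⟨i, he.2.2 i hi, rfl⟩
    have h1 := Finset.card_le_card (Finset.subset_inter hs hsub)
    have h2 := hlim c _ (hsat c hc)
    have h3 : (y s).val.toFinset.card = d + 1 := hcard.trans h
    omega

/-- A set of elements without conflicts gives a solution. -/
theorem exists_solution_of_independent (hd : 1 ≤ d)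
    (hgood : ∀ c t, good c t = true ↔ P c t.toFinset)
    (hP : ∀ c D, P c D ↔ P c (D ∩ (scope c).toFinset))
    {S : Finset (Fin (cells d k n cs).length)} (hcard : S.card = (indexLists d k).length)
    (hS : ∀ i ∈ S, ∀ j ∈ S, ((i : ℕ), (j : ℕ)) ∉ conflicts d k n cs scope good) :
    ∃ v : ℕ → ℕ, (∀ i < k, ∀ j < k, i < j ↔ v i < v j) ∧ (∀ i < k, v i < n) ∧
      ∀ c ∈ cs, P c ((List.range k).map v).toFinset := by
  classical
  set L := indexLists d k with hL
  obtain ⟨u, hu⟩ : ∃ u : Fin (cells d k n cs).length → Cell,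
      ∀ i : Fin (cells d k n cs).length, (cells d k n cs)[(i : ℕ)]? = some (u i) :=
    ⟨fun i => (cells d k n cs)[(i : ℕ)], fun i => by simp⟩
  have : Nonempty (Fin (cells d k n cs).length) := ⟨⟨0, cells_length_pos⟩⟩
  have hno : ∀ i ∈ S, ∀ j ∈ S, conflict d k cs scope good (u i, i) (u j, j) = false := by
    intro i hi j hj
    by_contra h
    exact hS i hi j hj ((mem_conflicts d k n cs scope good).2 ⟨u i, u j, hu i, hu j,
      by simpa using h⟩)
  have hmem : ∀ i, u i ∈ cells d k n cs := fun i => List.mem_of_getElem? (hu i)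
  have himage : S.image (fun i => (u i).pos) = Finset.range L.length := by
    refine Finset.eq_of_subset_of_card_le (fun t ht => ?_) ?_
    · obtain ⟨i, _, rfl⟩ := Finset.mem_image.1 ht
      have := ((mem_cells d k n cs).1 (hmem i)).1
      rw [Finset.mem_range]
      exact (List.getElem?_eq_some_iff.1 this).1
    · rw [Finset.card_range, Finset.card_image_of_injOn, hcard]
      intro i hi j hj hij
      exact Fin.ext (((conflict_eq_false_iff d k cs scope good).1 (hno i hi j hj)).1 hij)
  have hex : ∀ t < L.length, ∃ i ∈ S, (u i).pos = t := fun t ht => by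
    have : t ∈ S.image (fun i => (u i).pos) := by rw [himage]; simpa using ht
    simpa using this
  choose! f hfS hfpos using hex
  have hcell : ∀ t (ht : t < L.length), L[t]? = some (u (f t)).idx ∧
      (u (f t)).val ∈ incLists (d + 1) (List.range n) ∧
      (u (f t)).val.length = (u (f t)).idx.length := fun t ht => by
    obtain ⟨h1, h2, h3, -⟩ := (mem_cells d k n cs).1 (hmem (f t))
    rw [hfpos t ht] at h1
    exact ⟨h1, h2, h3⟩
  have hpair : ∀ s < L.length, ∀ t < L.length, _ := fun s hs t ht =>
    (conflict_eq_false_iff d k cs scope good).1 (hno (f s) (hfS s hs) (f t) (hfS t ht))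
  have hposof : ∀ e ∈ L, ∃ t < L.length, (u (f t)).idx = e := fun e he => by
    obtain ⟨t, ht, rfl⟩ := List.mem_iff_getElem.1 he
    refine ⟨t, ht, ?_⟩
    have := (hcell t ht).1
    rw [List.getElem?_eq_getElem ht] at this
    exact (Option.some.inj this).symm
  have hsingle : ∀ i, i < k → ∃ a t, t < L.length ∧ (u (f t)).idx = [i] ∧ (u (f t)).val = [a] := by
    intro i hi
    obtain ⟨t, ht, hidx⟩ := hposof [i] (by simp [hL, indexLists, mem_incLists, hi])
    have h3 := (hcell t ht).2.2
    rw [hidx, List.length_singleton] at h3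
    obtain ⟨a, ha⟩ := List.length_eq_one_iff.1 h3
    exact ⟨a, t, ht, hidx, ha⟩
  choose! v τ hτ hτidx hτval using hsingle
  have hval : ∀ t < L.length, (u (f t)).val = (u (f t)).idx.map v := by
    intro t ht
    refine List.ext_getElem (by simpa using (hcell t ht).2.2) fun r h1 h2 => ?_
    rw [List.length_map] at h2
    have hi : (u (f t)).idx[r] < k := by
      have := mem_incLists.1 (List.mem_of_getElem? (hcell t ht).1 : (u (f t)).idx ∈ incLists _ _)
      simpa using this.2.2 _ (List.getElem_mem h2)
    have hc := (consistent_iff.1 (hpair t ht (τ _) (hτ _ hi)).2.1) ((u (f t)).idx[r])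
      ((u (f t)).val[r]) (v ((u (f t)).idx[r])) r 0 (by simp) (by simp)
      (by rw [hτidx _ hi]; rfl) (by rw [hτval _ hi]; rfl)
    rw [List.getElem_map]
    exact hc
  have hlt : ∀ i j, i < j → j < k → v i < v j := by
    intro i j hij hj
    obtain ⟨t, ht, hidx⟩ := hposof [i, j] (by
      simp [hL, indexLists, mem_incLists, hij, hj, hij.trans hj, hd])
    have h2 := (mem_incLists.1 (hcell t ht).2.1).2.1
    rw [hval t ht, hidx] at h2
    simpa using h2
  have hv : ∀ i < k, ∀ j < k, i < j ↔ v i < v j := by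
    intro i hi j hj
    refine ⟨fun h => hlt i j h hj, fun h => ?_⟩
    rcases lt_trichotomy i j with h' | rfl | h'
    · exact h'
    · exact absurd h (lt_irrefl _)
    · exact absurd h (lt_asymm (hlt j i h' hi))
  have hvn : ∀ i < k, v i < n := by
    intro i hi
    have := (mem_incLists.1 (hcell _ (hτ i hi)).2.1).2.2 (v i) (by rw [hτval i hi]; simp)
    simpa using this
  refine ⟨v, hv, hvn, ?_⟩
  have hlim : ∀ c ∈ cs, (((List.range k).map v).toFinset ∩ (scope c).toFinset).card ≤ d := by
    intro c hc
    by_contra! hbig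
    obtain ⟨B, hB, hBc⟩ := Finset.exists_subset_card_eq (Nat.succ_le_of_lt hbig)
    rw [Finset.subset_inter_iff] at hB
    have hBmem : B.sort ∈ incLists (d + 1) ((List.range k).map v) := by
      rw [mem_incLists]
      refine ⟨by simp [hBc], B.sortedLT_sort.pairwise, fun x hx => ?_⟩
      have := hB.1 (by simpa using hx)
      rwa [List.mem_toFinset] at this
    rw [incLists_map (by simpa using hv)] at hBmem
    obtain ⟨e, he, heB⟩ := List.mem_map.1 hBmem
    obtain ⟨t, ht, hidx⟩ := hposof e he
    have hvalB : (u (f t)).val = B.sort := by rw [hval t ht, hidx, heB]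
    refine (hpair t ht t ht).2.2.2.2.2 ?_ c hc ?_
    · change (u (f t)).val.length = d + 1
      rw [hvalB]; simpa using hBc
    · change (u (f t)).val.toFinset ⊆ _
      rw [hvalB]; simpa using hB.2
  have hsums : ∀ t < L.length,
      (u (f t)).pls = prefixSum d k cs scope good v true t ∧
      (u (f t)).mns = prefixSum d k cs scope good v false t := by
    intro t
    induction t with
    | zero =>
      intro ht
      have := (hpair 0 ht 0 ht).2.2.2.1 (hfpos 0 ht)
      exact ⟨this.1.trans (by simp [prefixSum]), this.2.trans (by simp [prefixSum])⟩
    | succ t ih =>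
      intro ht
      have ht' : t < L.length := by omega
      have h1 := (hpair t ht' (t + 1) ht).2.2.1
        ((hfpos _ ht).trans (congrArg (· + 1) (hfpos t ht').symm))
      have h2 := ih ht'
      rw [prefixSum_succ (hcell t ht').1, prefixSum_succ (hcell t ht').1, ← hval t ht', ← h2.1,
        ← h2.2]
      exact h1
  rw [← sum_goodCount_eq_iff hgood hP (pairwise_map_range hv) hlim, ← prefixSum_length hv,
    ← prefixSum_length hv]
  have hpos : 0 < L.length := List.length_pos_of_mem
    (show [] ∈ L by simp [hL, indexLists, mem_incLists])
  have hlast : L.length - 1 < L.length := by omega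
  have hlast' : L.length - 1 + 1 = L.length := by omega
  have h1 := (hpair _ hlast _ hlast).2.2.2.2.1 ((congrArg (· + 1) (hfpos _ hlast)).trans hlast')
  have h2 := hsums _ hlast
  change (u (f (L.length - 1))).pls + goodCount d cs scope good true (u (f (L.length - 1))).val =
    (u (f (L.length - 1))).mns + goodCount d cs scope good false (u (f (L.length - 1))).val +
      cs.length at h1
  rw [h2.1, h2.2, hval _ hlast, ← prefixSum_succ (hcell _ hlast).1,
    ← prefixSum_succ (hcell _ hlast).1, hlast'] at h1
  exact h1

/-- The structure has an independent set with one element for every position if and only if there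
is a solution of size `k`. -/
theorem exists_independent_iff (hd : 1 ≤ d) (hgood : ∀ c t, good c t = true ↔ P c t.toFinset)
    (hP : ∀ c D, P c D ↔ P c (D ∩ (scope c).toFinset))
    (hlim : ∀ c D, P c D → (D ∩ (scope c).toFinset).card ≤ d) :
    (∃ S : Finset (Fin (cells d k n cs).length), S.card = (indexLists d k).length ∧
      ∀ i ∈ S, ∀ j ∈ S, ((i : ℕ), (j : ℕ)) ∉ conflicts d k n cs scope good) ↔
    ∃ D : Finset ℕ, D ⊆ Finset.range n ∧ D.card = k ∧ ∀ c ∈ cs, P c D := by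
  constructor
  · rintro ⟨S, hcard, hS⟩
    obtain ⟨v, hv, hvn, hsat⟩ := exists_solution_of_independent hd hgood hP hcard hS
    refine ⟨((List.range k).map v).toFinset, fun a ha => ?_, ?_, hsat⟩
    · simp only [List.mem_toFinset, List.mem_map, List.mem_range] at ha
      obtain ⟨i, hi, rfl⟩ := ha
      simpa using hvn i hi
    · rw [List.toFinset_card_of_nodup (nodup_of_pairwise_lt (pairwise_map_range hv))]
      simp
  · rintro ⟨D, hD, rfl, hsat⟩
    have hmap : (List.range D.card).map (fun i => D.sort.getD i 0) = D.sort :=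
      List.ext_getElem (by simp) fun i h1 h2 => by simp [List.getElem?_eq_getElem h2]
    have hlt : ∀ i j, i < j → j < D.card → D.sort.getD i 0 < D.sort.getD j 0 := by
      intro i j hij hj
      rw [List.getD_eq_getElem _ _ (by simp; omega), List.getD_eq_getElem _ _ (by simpa using hj)]
      exact List.pairwise_iff_getElem.1 D.sortedLT_sort.pairwise i j _ _ hij
    refine exists_independent_of_solution hgood hP hlim (v := fun i => D.sort.getD i 0)
      (fun i hi j hj => ⟨fun h => hlt i j h hj, fun h => ?_⟩) (fun i hi => ?_) ?_
    · rcases lt_trichotomy i j with h' | rfl | h'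
      · exact h'
      · exact absurd h (lt_irrefl _)
      · exact absurd h (lt_asymm (hlt j i h' hi))
    · have hi' : i < D.sort.length := by simpa using hi
      have : D.sort.getD i 0 ∈ D.sort := by
        rw [List.getD_eq_getElem _ _ hi']
        exact List.getElem_mem _
      simpa using hD (by simpa using this)
    · rw [hmap]
      simpa using hsat

end Correctness

end ParamCSP

namespace ParamCSP

open Turing

/-! ### Reading and printing binary numbers -/

/-- The digits of a number, least significant first. -/
def digits (n : ℕ) : List Sym := n.bits.map fun b => if b then Sym.one else Sym.zero

/-- One step of the reader: the digits of the current number, the numbers of the current list and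
the finished lists, all in reverse order. -/
def readStep (st : List Sym × List (List Sym) × List (List (List Sym))) (s : Sym) :
    List Sym × List (List Sym) × List (List (List Sym)) :=
  if (s == Sym.zero || s == Sym.one) then (s :: st.1, st.2.1, st.2.2)
  else if s == Sym.comma then ([], st.1.reverse :: st.2.1, st.2.2)
  else ([], [], st.2.1.reverse :: st.2.2)

/-- Read a sequence of lists of numbers; every number is returned as its word of digits. -/
def readLists (w : List Sym) : List (List (List Sym)) :=
  (w.foldl readStep ([], [], [])).2.2.reverse

theorem foldl_readStep_digits (n : ℕ) (cur : List Sym) (rest) :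
    (digits n).foldl readStep (cur, rest) = ((digits n).reverse ++ cur, rest) := by
  unfold digits
  induction n.bits generalizing cur with
  | nil => rfl
  | cons b l ih =>
    have : readStep (cur, rest) (if b then Sym.one else Sym.zero) =
        ((if b then Sym.one else Sym.zero) :: cur, rest) := by
      cases b <;> rfl
    rw [List.map_cons, List.foldl_cons, this, ih, List.reverse_cons, List.append_assoc]
    rfl

theorem foldl_readStep_numbers (l : List ℕ) (nums : List (List Sym)) (rest) :
    (l.flatMap encNat).foldl readStep ([], nums, rest) =
      ([], (l.map digits).reverse ++ nums, rest) := by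
  induction l generalizing nums with
  | nil => rfl
  | cons n l ih =>
    have : encNat n = digits n ++ [Sym.comma] := rfl
    rw [List.flatMap_cons, List.foldl_append, this, List.foldl_append, foldl_readStep_digits]
    have h2 : [Sym.comma].foldl readStep ((digits n).reverse ++ [], nums, rest) =
        ([], digits n :: nums, rest) := by
      simp [readStep]
    rw [h2, ih, List.map_cons, List.reverse_cons, List.append_assoc]
    rfl

theorem readLists_flatMap_encNats (L : List (List ℕ)) :
    readLists (L.flatMap encNats) = L.map (List.map digits) := by
  have key : ∀ rest, (L.flatMap encNats).foldl readStep ([], [], rest) =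
      ([], [], (L.map (List.map digits)).reverse ++ rest) := by
    induction L with
    | nil => intro rest; rfl
    | cons l L ih =>
      intro rest
      rw [List.flatMap_cons, List.foldl_append, encNats, List.foldl_append,
        foldl_readStep_numbers]
      have h2 : [Sym.semi].foldl readStep ([], (l.map digits).reverse ++ [], rest) =
          ([], [], l.map digits :: rest) := by
        simp [readStep]
      rw [h2, ih, List.map_cons, List.reverse_cons, List.append_assoc]
      rfl
  rw [readLists, key]
  simp

/-- The minimum of `N` and the number with the given digits. -/
def valueUpTo (N : ℕ) (w : List Sym) : ℕ :=
  w.foldr (fun s v => if decide (v + v + (if s == Sym.one then 1 else 0) ≤ N) then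
    v + v + (if s == Sym.one then 1 else 0) else N) 0

theorem valueUpTo_digits (N n : ℕ) : valueUpTo N (digits n) = min n N := by
  unfold digits
  induction n using Nat.binaryRec' with
  | zero => simp [valueUpTo]
  | bit b n hb ih =>
    rw [Nat.bits_append_bit _ _ hb, List.map_cons, valueUpTo, List.foldr_cons, ← valueUpTo, ih]
    cases b <;> simp [Nat.bit] <;> split_ifs <;> omega

theorem valueUpTo_le (N : ℕ) (w : List Sym) : valueUpTo N w ≤ N := by
  cases w with
  | nil => simp [valueUpTo]
  | cons s w =>
    rw [valueUpTo, List.foldr_cons, ← valueUpTo]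
    generalize valueUpTo N w + valueUpTo N w + (if s == Sym.one then 1 else 0) = m
    by_cases h : m ≤ N <;> simp [h]

/-- One step of the binary increment, from the least significant digit: the carry and the digits
that were output, in reverse order. -/
def incStep (st : Bool × List Sym) (s : Sym) : Bool × List Sym :=
  if st.1 then (if s == Sym.one then (true, Sym.zero :: st.2) else (false, Sym.one :: st.2))
  else (false, s :: st.2)

/-- The digits of the successor. -/
def incDigits (w : List Sym) : List Sym :=
  (if (w.foldl incStep (true, [])).1 then Sym.one :: (w.foldl incStep (true, [])).2
    else (w.foldl incStep (true, [])).2).reverse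

theorem incDigits_digits (n : ℕ) : incDigits (digits n) = digits (n + 1) := by
  have hfalse : ∀ (w o : List Sym), w.foldl incStep (false, o) = (false, w.reverse ++ o) := by
    intro w
    induction w with
    | nil => intro o; rfl
    | cons s w ih => intro o; rw [List.foldl_cons]; simp [incStep, ih]
  have key : ∀ (n : ℕ) (o : List Sym), (if ((digits n).foldl incStep (true, o)).1 then
      Sym.one :: ((digits n).foldl incStep (true, o)).2
      else ((digits n).foldl incStep (true, o)).2) = (digits (n + 1)).reverse ++ o := by
    intro n
    induction n using Nat.binaryRec' with
    | zero => intro o; simp [digits]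
    | bit b n hb ih =>
      intro o
      cases b with
      | false =>
        have h1 : digits (Nat.bit false n) = Sym.zero :: digits n := by
          rw [digits, Nat.bits_append_bit _ _ hb]; rfl
        have h2 : digits (Nat.bit false n + 1) = Sym.one :: digits n := by
          have : Nat.bit false n + 1 = Nat.bit true n := by simp [Nat.bit]
          rw [this, digits, Nat.bits_append_bit _ _ (fun _ => rfl)]; rfl
        rw [h1, h2, List.foldl_cons]
        have h3 : incStep (true, o) Sym.zero = (false, Sym.one :: o) := rfl
        rw [h3, hfalse]
        simp
      | true =>
        have h1 : digits (Nat.bit true n) = Sym.one :: digits n := by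
          rw [digits, Nat.bits_append_bit _ _ hb]; rfl
        have h2 : digits (Nat.bit true n + 1) = Sym.zero :: digits (n + 1) := by
          have : Nat.bit true n + 1 = Nat.bit false (n + 1) := by simp [Nat.bit]; ring
          rw [this, digits, Nat.bits_append_bit _ _ (by simp)]; rfl
        rw [h1, h2, List.foldl_cons]
        have h3 : incStep (true, o) Sym.one = (true, Sym.zero :: o) := rfl
        rw [h3, ih]
        simp
  rw [incDigits, key]
  simp

theorem foldl_incDigits (n : ℕ) :
    (List.replicate n ()).foldl (fun w _ => incDigits w) [] = digits n := by
  induction n with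
  | zero => simp [digits]
  | succ n ih => rw [List.replicate_succ', List.foldl_append, ih]; exact incDigits_digits n

theorem length_digits_le (n : ℕ) : (digits n).length ≤ n := by
  rw [digits, List.length_map, Nat.size_eq_bits_len]
  exact Nat.size_le.2 n.lt_two_pow_self

section Programs

variable {J : Type} [DecidableEq J] {O : MachineFamily J}
variable {α β : Type} [ToTree α] [ToTree β]

namespace PT

@[fun_prop]
theorem symEq {F : α → Sym} (hF : PT O F) (s : Sym) : PT O fun a => F a == s :=
  (symCase fun x => x == s).comp hF

@[fun_prop]
theorem boolEq {F G : α → Bool} (hF : PT O F) (hG : PT O G) : PT O fun a => F a == G a := by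
  refine (ite (F := G) (G := fun a => !(G a)) hF hG (by fun_prop)).congr fun a => ?_
  cases F a <;> cases G a <;> rfl

theorem readStep' : PT O fun p : List Sym × (List Sym × List (List Sym) ×
    List (List (List Sym))) × Sym => readStep p.2.1 p.2.2 := by
  unfold readStep
  fun_prop

@[fun_prop]
theorem readLists {F : α → List Sym} (hF : PT O F) : PT O fun a => readLists (F a) := by
  have h : PT O fun w : List Sym => w.foldl readStep ([], [], []) := by
    refine foldl (H := fun (_ : List Sym) st s => readStep st s) id (const _) readStep'
      (q := fun n => n + 2) (IsPoly.id.add_const 2) fun w st s => ?_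
    simp only [readStep]
    split_ifs <;> simp only [tsize_pair, tsize_cons, tsize_nil, tsize_reverse]
    · omega
    · omega
    · have := tsize_pos st.1
      omega
  have h2 : PT O fun w : List Sym => (w.foldl readStep ([], [], [])).2.2.reverse := by fun_prop
  exact h2.comp hF

@[fun_prop]
theorem valueUpTo {F : α → ℕ} {G : α → List Sym} (hF : PT O F) (hG : PT O G) :
    PT O fun a => valueUpTo (F a) (G a) := by
  have h : PT O fun p : ℕ × List Sym => ParamCSP.valueUpTo p.1 p.2 := by
    refine (foldl' (F := fun p : ℕ × List Sym => p.2.reverse) (G := fun _ => 0)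
      (H := fun (p : ℕ × List Sym) v s =>
        if decide (v + v + (if s == Sym.one then 1 else 0) ≤ p.1) then
          v + v + (if s == Sym.one then 1 else 0) else p.1) (by fun_prop) (by fun_prop)
      (by fun_prop) (q := fun n => n) IsPoly.id ?_).congr fun p => ?_
    · rintro ⟨N, w⟩ l -
      have := valueUpTo_le N l.reverse
      rw [ParamCSP.valueUpTo, List.foldr_reverse] at this
      rw [tsize_nat, tsize_pair, tsize_nat]
      simp only at this ⊢
      omega
    · rw [List.foldl_reverse]; rfl
  exact h.comp (hF.pair hG)

theorem incStep' : PT O fun p : List Sym × (Bool × List Sym) × Sym => incStep p.2.1 p.2.2 := by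
  unfold incStep
  fun_prop

@[fun_prop]
theorem incDigits {F : α → List Sym} (hF : PT O F) : PT O fun a => incDigits (F a) := by
  have h : PT O fun w : List Sym => w.foldl incStep (true, []) := by
    refine foldl (H := fun (_ : List Sym) st s => incStep st s) id (const _) incStep'
      (q := fun n => n + 5) (IsPoly.id.add_const 5) fun w st s => ?_
    have h3 : tsize Sym.zero = 1 := rfl
    have h4 : tsize Sym.one = 3 := rfl
    have h5 := tsize_pos st.1
    have h6 : tsize false = 1 := rfl
    have h7 : tsize true = 3 := rfl
    simp only [incStep]
    split_ifs <;> simp only [tsize_pair, tsize_cons] <;> omega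
  have h2 : PT O fun w : List Sym => ParamCSP.incDigits w := by
    unfold ParamCSP.incDigits
    fun_prop
  exact h2.comp hF

@[fun_prop]
theorem digits {F : α → ℕ} (hF : PT O F) : PT O fun a => digits (F a) := by
  have h : PT O fun n : ℕ => ParamCSP.digits n := by
    refine (foldl' (F := fun n : ℕ => List.replicate n ()) (G := fun _ => [])
      (H := fun (_ : ℕ) w (_ : Unit) => ParamCSP.incDigits w) (units id) (const _) (by fun_prop)
      (q := fun n => n * 10 + 1) ((IsPoly.id.mul (IsPoly.const 10)).add_const 1)
      fun n l hl => ?_).congr fun n => (foldl_incDigits n).symm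
    have hlen := hl.length_le
    rw [List.length_replicate] at hlen
    rw [List.eq_replicate_of_mem (l := l) (a := ()) fun _ _ => rfl, foldl_incDigits]
    have h1 := tsize_list_le (l := ParamCSP.digits l.length) fun s _ => tsize_sym_le s
    have h2 := length_digits_le l.length
    rw [tsize_nat]
    omega
  exact h.comp hF

@[fun_prop]
theorem encNat {F : α → ℕ} (hF : PT O F) : PT O fun a => encNat (F a) := by
  have : PT O fun a => ParamCSP.digits (F a) ++ [Sym.comma] := by fun_prop
  exact this

@[fun_prop]
theorem encNats {F : α → List ℕ} (hF : PT O F) : PT O fun a => encNats (F a) := by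
  unfold ParamCSP.encNats
  fun_prop

end PT

end Programs

end ParamCSP

namespace ParamCSP

open Turing

/-! ### The reduction is computable in polynomial time -/

/-- A constraint, without its set of variables. -/
structure RawConstraint (Γ : BoolConstraintLanguage) where
  idx : ℕ
  scope : List ℕ
  length_scope : scope.length = Γ.arity idx

variable {Γ : BoolConstraintLanguage}

namespace RawConstraint

/-- The positions of the variables in `D`. -/
def positions (c : RawConstraint Γ) (D : Finset ℕ) : Finset (Fin (Γ.arity c.idx)) :=
  Finset.univ.filter fun j => c.scope[(j : ℕ)]'(by rw [c.length_scope]; exact j.2) ∈ D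

/-- The constraint is satisfied by `D`. -/
def Holds (c : RawConstraint Γ) (D : Finset ℕ) : Prop := c.positions D ∈ Γ.rel c.idx

open Classical in
/-- Whether the constraint is satisfied by the entries of a list. -/
noncomputable def good (c : RawConstraint Γ) (t : List ℕ) : Bool := decide (c.Holds t.toFinset)

/-- The list of the positions of the variables in `t`. -/
def positionList (c : RawConstraint Γ) (t : List ℕ) : List ℕ :=
  (c.scope.zipIdx.filter fun v => t.any fun u => decide (u = v.1)).map fun v => v.2

theorem positionList_eq (c : RawConstraint Γ) (t : List ℕ) :
    c.positionList t = List.map (fun j : Fin (Γ.arity c.idx) => (j : ℕ)) (c.positions t.toFinset).sort := by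
  refine eq_of_pairwise_lt ?_ ?_ fun i => ?_
  · have h : c.scope.zipIdx.map (fun v => v.2) = List.range' 0 c.scope.length :=
      List.zipIdx_map_snd 0 c.scope
    have h2 : (c.scope.zipIdx.map fun v => v.2).Pairwise (· < ·) := by
      rw [h]; exact List.pairwise_lt_range'
    exact h2.sublist (List.filter_sublist.map _)
  · rw [List.pairwise_map]
    exact (Finset.sortedLT_sort _).pairwise
  · simp only [positionList, List.mem_map, List.mem_filter, Prod.exists, Finset.mem_sort,
      positions, Finset.mem_filter, Finset.mem_univ, true_and, List.any_eq_true,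
      decide_eq_true_eq, List.mem_zipIdx_iff_getElem?, List.mem_toFinset, exists_eq_right,
      List.getElem?_eq_some_iff]
    constructor
    · rintro ⟨a, ⟨h1, h⟩, h2⟩
      exact ⟨⟨i, by rwa [← c.length_scope]⟩, h.symm ▸ h2, rfl⟩
    · rintro ⟨j, h, rfl⟩
      exact ⟨_, ⟨by rw [c.length_scope]; exact j.2, rfl⟩, h⟩

theorem length_positionList (c : RawConstraint Γ) (t : List ℕ) :
    (c.positionList t).length = (c.positions t.toFinset).card := by
  rw [positionList_eq, List.length_map, Finset.length_sort]

instance : ToTree (RawConstraint Γ) := ⟨fun c => ToTree.repr (digits c.idx, c.scope)⟩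

end RawConstraint

instance : ToTree Cell := ⟨fun y => ToTree.repr (y.pos, y.idx, y.val, y.pls, y.mns)⟩

instance : ToTree (CSPInst Γ) := ⟨fun I => ToTree.repr I.encode⟩

/-- The encoding of a structure with a binary relation and of a weight. -/
def outWord (K N : ℕ) (pairs : List (ℕ × ℕ)) : List Sym :=
  encNat K ++ encNats (List.range N) ++
    (pairs.flatMap (fun p => encNats [p.1, p.2]) ++ [Sym.bar])

/-- The constraint without its set of variables. -/
def Constraint.toRaw {n : ℕ} (c : Constraint Γ n) : RawConstraint Γ :=
  ⟨c.idx, List.ofFn fun j => (c.scope j : ℕ), by simp⟩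

/-- The lists of numbers of which the encoding of an instance consists. -/
def CSPInst.lists (I : CSPInst Γ) : List (List ℕ) :=
  (I.weight :: List.range I.numVars) ::
    I.constraints.map fun c => c.idx :: List.ofFn fun j => (c.scope j : ℕ)

theorem CSPInst.encode_eq (I : CSPInst Γ) : I.encode = I.lists.flatMap encNats := by
  simp [CSPInst.encode, CSPInst.lists, List.flatMap_cons, List.flatMap_map, encNats]

theorem CSPInst.readLists_encode (I : CSPInst Γ) :
    readLists I.encode = I.lists.map (List.map digits) := by
  rw [I.encode_eq, readLists_flatMap_encNats]

section Programs

variable {J : Type} [DecidableEq J] {O : MachineFamily J}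
variable {α β : Type} [ToTree α] [ToTree β]

namespace PT

@[fun_prop]
theorem cell_pos {F : α → Cell} (hF : PT O F) : PT O fun a => (F a).pos :=
  ((fst (O := O) (α := ℕ) (β := List ℕ × List ℕ × ℕ × ℕ)).of_repr (f' := Cell.pos)
    (fun y => (y.pos, y.idx, y.val, y.pls, y.mns)) (fun _ => rfl) fun _ => rfl).comp hF

@[fun_prop]
theorem cell_idx {F : α → Cell} (hF : PT O F) : PT O fun a => (F a).idx :=
  ((show PT O fun p : ℕ × List ℕ × List ℕ × ℕ × ℕ => p.2.1 by fun_prop).of_repr (f' := Cell.idx)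
    (fun y => (y.pos, y.idx, y.val, y.pls, y.mns)) (fun _ => rfl) fun _ => rfl).comp hF

@[fun_prop]
theorem cell_val {F : α → Cell} (hF : PT O F) : PT O fun a => (F a).val :=
  ((show PT O fun p : ℕ × List ℕ × List ℕ × ℕ × ℕ => p.2.2.1 by fun_prop).of_repr
    (f' := Cell.val)
    (fun y => (y.pos, y.idx, y.val, y.pls, y.mns)) (fun _ => rfl) fun _ => rfl).comp hF

@[fun_prop]
theorem cell_pls {F : α → Cell} (hF : PT O F) : PT O fun a => (F a).pls :=
  ((show PT O fun p : ℕ × List ℕ × List ℕ × ℕ × ℕ => p.2.2.2.1 by fun_prop).of_repr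
    (f' := Cell.pls)
    (fun y => (y.pos, y.idx, y.val, y.pls, y.mns)) (fun _ => rfl) fun _ => rfl).comp hF

@[fun_prop]
theorem cell_mns {F : α → Cell} (hF : PT O F) : PT O fun a => (F a).mns :=
  ((show PT O fun p : ℕ × List ℕ × List ℕ × ℕ × ℕ => p.2.2.2.2 by fun_prop).of_repr
    (f' := Cell.mns)
    (fun y => (y.pos, y.idx, y.val, y.pls, y.mns)) (fun _ => rfl) fun _ => rfl).comp hF

@[fun_prop]
theorem cell_mk {F P Q : α → ℕ} {G H : α → List ℕ} (hF : PT O F) (hG : PT O G) (hH : PT O H)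
    (hP : PT O P) (hQ : PT O Q) : PT O fun a => (⟨F a, G a, H a, P a, Q a⟩ : Cell) :=
  (show PT O fun a => (F a, G a, H a, P a, Q a) by fun_prop).of_repr (fun a => a)
    (fun _ => rfl) fun _ => rfl

@[fun_prop]
theorem raw_digits {F : α → RawConstraint Γ} (hF : PT O F) : PT O fun a => ParamCSP.digits (F a).idx :=
  ((fst (O := O) (α := List Sym) (β := List ℕ)).of_repr
    (f' := fun c : RawConstraint Γ => ParamCSP.digits c.idx)
    (fun c => (ParamCSP.digits c.idx, c.scope)) (fun _ => rfl) fun _ => rfl).comp hF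

@[fun_prop]
theorem raw_scope {F : α → RawConstraint Γ} (hF : PT O F) : PT O fun a => (F a).scope :=
  ((snd (O := O) (α := List Sym) (β := List ℕ)).of_repr (f' := RawConstraint.scope)
    (fun c => (ParamCSP.digits c.idx, c.scope)) (fun _ => rfl) fun _ => rfl).comp hF

@[fun_prop]
theorem positionList {F : α → RawConstraint Γ} {G : α → List ℕ} (hF : PT O F) (hG : PT O G) :
    PT O fun a => (F a).positionList (G a) := by
  unfold RawConstraint.positionList
  fun_prop

@[fun_prop]
theorem incLists (j : ℕ) {F : α → List ℕ} (hF : PT O F) : PT O fun a => ParamCSP.incLists j (F a) := by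
  have h : PT O fun l : List ℕ => ParamCSP.incLists j l := by
    induction j with
    | zero => exact const _
    | succ j ih =>
      unfold ParamCSP.incLists
      fun_prop
  exact h.comp hF

@[fun_prop]
theorem isEven {F : α → List ℕ} (hF : PT O F) : PT O fun a => ParamCSP.isEven (F a) := by
  refine (foldl (H := fun (_ : α) b (_ : ℕ) => !b) hF (const true) (by fun_prop)
    (q := fun _ => 3) (IsPoly.const 3) fun a s x =>
      (tsize_bool_le _).trans (Nat.le_add_left _ _)).congr fun a => ?_
  have : ∀ (l : List ℕ) (b : Bool), l.foldl (fun b _ => !b) b = (ParamCSP.isEven l == b) := by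
    intro l
    induction l with
    | nil => intro b; cases b <;> simp [ParamCSP.isEven]
    | cons x l ih =>
      intro b
      rw [List.foldl_cons, ih]
      by_cases h : Even l.length <;> cases b <;>
        simp [ParamCSP.isEven, h, Nat.even_add_one]
  rw [this]
  simp

@[fun_prop]
theorem covers {F : α → RawConstraint Γ} {G : α → List ℕ} (hF : PT O F) (hG : PT O G) :
    PT O fun a => ParamCSP.covers RawConstraint.scope (F a) (G a) := by
  unfold ParamCSP.covers
  fun_prop

/-- The oracle decides membership for queries of bounded size. -/
theorem raw_good {d : ℕ} (hsize : ∀ i, ∀ T ∈ Γ.rel i, T.card ≤ d) (j : J) {g : ℕ → ℕ}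
    {p : Polynomial ℕ}
    (hO : ∀ q : Γ.Query, Nonempty (TM2OutputsInTime (O j).tm
      (q.encode.map (O j).inputAlphabet.invFun)
      (some ((encBool (@decide (q.set ∈ Γ.rel q.idx) (Classical.propDecidable _))).map
        (O j).outputAlphabet.invFun)) (g q.set.card * p.eval q.encode.length))) :
    PT O fun x : RawConstraint Γ × List ℕ => x.1.good x.2 := by
  classical
  have hF : PT O fun x : RawConstraint Γ × List ℕ =>
      ParamCSP.digits x.1.idx ++ [Sym.comma] ++ ParamCSP.encNats (x.1.positionList x.2) := by
    fun_prop
  obtain ⟨b, hb, hbF⟩ := hF.size_le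
  have h1 : PT O fun x : {x : RawConstraint Γ × List ℕ //
      decide ((x.1.positionList x.2).length ≤ d) = true} => encBool (x.1.1.good x.1.2) := by
    refine oracle j (hF.of_repr Subtype.val (fun _ => rfl) fun _ => rfl)
      (q := fun n => (∑ i ∈ Finset.range (d + 1), g i) * p.eval (b n) + 1)
      (((IsPoly.const _).mul ((IsPoly.eval p).comp hb)).add_const 1) (fun x => ?_) fun x => ?_
    · simp [encBool]
    · obtain ⟨⟨c, t⟩, hx⟩ := x
      have hcard : (c.positions t.toFinset).card ≤ d := by
        rw [← c.length_positionList]; simpa using hx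
      obtain ⟨h⟩ := hO ⟨c.idx, c.positions t.toFinset⟩
      have henc : (⟨c.idx, c.positions t.toFinset⟩ : Γ.Query).encode =
          ParamCSP.digits c.idx ++ [Sym.comma] ++ ParamCSP.encNats (c.positionList t) := by
        rw [c.positionList_eq, BoolConstraintLanguage.Query.encode]
        simp only [List.bind_eq_flatMap, List.pure_def, List.map_id', ← List.map_eq_flatMap]
        rfl
      rw [henc] at h
      refine ⟨⟨h.toEvalsTo, h.steps_le_m.trans ((Nat.mul_le_mul ?_ ?_).trans
        (Nat.le_add_right _ 1))⟩⟩
      · exact Finset.single_le_sum (f := g) (fun _ _ => Nat.zero_le _)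
          (Finset.mem_range.2 (Nat.lt_succ_of_le hcard))
      · exact polynomial_eval_monotone p ((length_le_tsize _).trans (hbF (c, t)))
  have h2 : PT O fun x : {x : RawConstraint Γ × List ℕ //
      decide ((x.1.positionList x.2).length ≤ d) = true} =>
      (encBool (x.1.1.good x.1.2)).headD Sym.zero == Sym.one := by fun_prop
  refine (dite (c := fun x : RawConstraint Γ × List ℕ =>
    decide ((x.1.positionList x.2).length ≤ d)) (g := fun _ => false) (by fun_prop) h2
    (const _)).congr fun x => ?_
  split_ifs with h
  · cases x.1.good x.2 <;> rfl
  · rw [RawConstraint.good, decide_eq_false_iff_not]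
    intro hmem
    have := hsize _ _ hmem
    rw [← x.1.length_positionList] at this
    exact h (by simpa using this)

@[fun_prop]
theorem indexLists (d : ℕ) {F : α → ℕ} (hF : PT O F) :
    PT O fun a => ParamCSP.indexLists d (F a) := by
  unfold ParamCSP.indexLists
  fun_prop

@[fun_prop]
theorem sumBound (d : ℕ) {F G : α → ℕ} {H : α → List β} (hF : PT O F) (hG : PT O G)
    (hH : PT O H) : PT O fun a => ParamCSP.sumBound d (F a) (G a) (H a) := by
  unfold ParamCSP.sumBound
  fun_prop

@[fun_prop]
theorem cells (d : ℕ) {F G : α → ℕ} {H : α → List β} (hF : PT O F) (hG : PT O G)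
    (hH : PT O H) : PT O fun a => ParamCSP.cells d (F a) (G a) (H a) := by
  unfold ParamCSP.cells
  fun_prop

@[fun_prop]
theorem consistent {F G : α → Cell} (hF : PT O F) (hG : PT O G) :
    PT O fun a => ParamCSP.consistent (F a) (G a) := by
  unfold ParamCSP.consistent
  fun_prop

theorem goodCount (hgood : PT O fun x : RawConstraint Γ × List ℕ => x.1.good x.2) (d : ℕ)
    (b : Bool) {F : α → List (RawConstraint Γ)} {G : α → List ℕ} (hF : PT O F) (hG : PT O G) :
    PT O fun a =>
      ParamCSP.goodCount d (F a) RawConstraint.scope RawConstraint.good b (G a) := by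
  have h : PT O fun q : ((α × RawConstraint Γ) × List ℕ) => q.1.2.good q.2 :=
    hgood.comp (show PT O fun q : ((α × RawConstraint Γ) × List ℕ) => (q.1.2, q.2) by fun_prop)
  unfold ParamCSP.goodCount
  fun_prop

theorem stepOK (hgood : PT O fun x : RawConstraint Γ × List ℕ => x.1.good x.2) (d : ℕ)
    {F : α → List (RawConstraint Γ)} {G H : α → Cell} (hF : PT O F) (hG : PT O G)
    (hH : PT O H) :
    PT O fun a => ParamCSP.stepOK d (F a) RawConstraint.scope RawConstraint.good (G a) (H a) := by
  have h1 := goodCount hgood d true hF (cell_val hG)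
  have h2 := goodCount hgood d false hF (cell_val hG)
  unfold ParamCSP.stepOK
  fun_prop

theorem finalOK (hgood : PT O fun x : RawConstraint Γ × List ℕ => x.1.good x.2) (d : ℕ)
    {F : α → List (RawConstraint Γ)} {G : α → Cell} (hF : PT O F) (hG : PT O G) :
    PT O fun a => ParamCSP.finalOK d (F a) RawConstraint.scope RawConstraint.good (G a) := by
  have h1 := goodCount hgood d true hF (cell_val hG)
  have h2 := goodCount hgood d false hF (cell_val hG)
  unfold ParamCSP.finalOK
  fun_prop

@[fun_prop]
theorem tooBig (d : ℕ) {F : α → List (RawConstraint Γ)} {G : α → Cell} (hF : PT O F)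
    (hG : PT O G) : PT O fun a => ParamCSP.tooBig d (F a) RawConstraint.scope (G a) := by
  unfold ParamCSP.tooBig
  fun_prop

theorem conflict (hgood : PT O fun x : RawConstraint Γ × List ℕ => x.1.good x.2) (d : ℕ)
    {P : α → ℕ} {F : α → List (RawConstraint Γ)} {G H : α → Cell × ℕ} (hP : PT O P)
    (hF : PT O F) (hG : PT O G) (hH : PT O H) :
    PT O fun a => ParamCSP.conflict d (P a) (F a) RawConstraint.scope RawConstraint.good
      (G a) (H a) := by
  have h1 := stepOK hgood d hF (G := fun a => (G a).1) (H := fun a => (H a).1) (by fun_prop)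
    (by fun_prop)
  have h2 := finalOK hgood d hF (G := fun a => (G a).1) (by fun_prop)
  unfold ParamCSP.conflict
  fun_prop

theorem conflicts (hgood : PT O fun x : RawConstraint Γ × List ℕ => x.1.good x.2) (d : ℕ)
    {P Q : α → ℕ} {F : α → List (RawConstraint Γ)} (hP : PT O P) (hQ : PT O Q) (hF : PT O F) :
    PT O fun a => ParamCSP.conflicts d (P a) (Q a) (F a) RawConstraint.scope
      RawConstraint.good := by
  have h : PT O fun x : (α × (Cell × ℕ)) × (Cell × ℕ) =>
      ParamCSP.conflict d (P x.1.1) (F x.1.1) RawConstraint.scope RawConstraint.good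
        x.1.2 x.2 :=
    conflict hgood d (by fun_prop) (by fun_prop) (by fun_prop) (by fun_prop)
  unfold ParamCSP.conflicts
  fun_prop

@[fun_prop]
theorem outWord {F G : α → ℕ} {H : α → List (ℕ × ℕ)} (hF : PT O F) (hG : PT O G)
    (hH : PT O H) : PT O fun a => ParamCSP.outWord (F a) (G a) (H a) := by
  unfold ParamCSP.outWord
  fun_prop

end PT

end Programs

end ParamCSP

namespace ParamCSP

/-! ### Independent sets as a weighted definability problem -/

section Independent

open FirstOrder Language

/-- The arities of a vocabulary with one binary relation. -/
abbrev binaryArity : Fin 1 → ℕ := fun _ => 2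

/-- No two elements of the set variable are related. -/
def independentSentence : (relLang (withVar binaryArity 1)).Sentence :=
  ∀' ∀' ∼(Relations.boundedFormula₁ (L := relLang (withVar binaryArity 1)) (n := 2)
      (α := Empty) ⟨none, rfl⟩ (&0) ⊓
    (Relations.boundedFormula₁ (L := relLang (withVar binaryArity 1)) ⟨none, rfl⟩ (&1) ⊓
      Relations.boundedFormula₂ (L := relLang (withVar binaryArity 1)) ⟨some 0, rfl⟩ (&0) (&1)))

theorem isUniversal_independentSentence :
    BoundedFormula.IsUniversal independentSentence :=
  .all <| .all <| .of_isQF <| .not <| ((BoundedFormula.IsAtomic.rel _ _).isQF).inf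
    (((BoundedFormula.IsAtomic.rel _ _).isQF).inf (BoundedFormula.IsAtomic.rel _ _).isQF)

theorem sat_independentSentence (A : FinStructure binaryArity)
    (S : Finset (Fin 1 → Fin A.size)) : A.Sat independentSentence S ↔
      ∀ x y : Fin A.size, ¬ ((fun _ => x) ∈ S ∧ (fun _ => y) ∈ S ∧ ![x, y] ∈ A.rel 0) := by
  let _ := relStructure (withVar binaryArity 1) (A.interp S)
  have h1 : ∀ (v : Fin 2 → Fin A.size) (i : Fin 2), BoundedFormula.Realize
      (Relations.boundedFormula₁ (L := relLang (withVar binaryArity 1)) (α := Empty) (n := 2)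
        ⟨none, rfl⟩ (&i)) default v ↔ (fun _ => v i) ∈ S := fun v i =>
    Iff.of_eq (congrArg (· ∈ S) (funext fun j : Fin 1 => by fin_cases j; rfl))
  have h2 : ∀ v : Fin 2 → Fin A.size, BoundedFormula.Realize
      (Relations.boundedFormula₂ (L := relLang (withVar binaryArity 1)) (α := Empty) (n := 2)
        ⟨some 0, rfl⟩ (&0) (&1)) default v ↔ ![v 0, v 1] ∈ A.rel 0 := fun v =>
    Iff.of_eq (congrArg (· ∈ A.rel 0) (funext fun j : Fin 2 => by fin_cases j <;> rfl))
  exact forall_congr' fun x => forall_congr' fun y =>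
    not_congr (BoundedFormula.realize_inf.trans (and_congr (h1 _ 0)
      (BoundedFormula.realize_inf.trans (and_congr (h1 _ 1) (h2 _)))))

/-- The structure on `Fin N` with the relation `pairs`, with the weight `K`. -/
def pairInst (K N : ℕ) (pairs : List (ℕ × ℕ)) (hK : 0 < K) (hN : 0 < N)
    (hp : ∀ p ∈ pairs, p.1 < N ∧ p.2 < N) : WDInst binaryArity where
  str :=
    { size := N
      size_pos := hN
      rel := fun _ => pairs.attach.map fun p =>
        ![⟨p.1.1, (hp _ p.2).1⟩, ⟨p.1.2, (hp _ p.2).2⟩] }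
  weight := K
  weight_pos := hK

variable {K N : ℕ} {pairs : List (ℕ × ℕ)} (hK : 0 < K) (hN : 0 < N)
    (hp : ∀ p ∈ pairs, p.1 < N ∧ p.2 < N)

theorem encode_pairInst : (pairInst K N pairs hK hN hp).encode = outWord K N pairs := by
  have h : ∀ l : List {p // p ∈ pairs}, (l.map fun p =>
      (![⟨p.1.1, (hp _ p.2).1⟩, ⟨p.1.2, (hp _ p.2).2⟩] : Fin 2 → Fin N)).flatMap
        (fun t => encNats (List.ofFn fun j => (t j : ℕ))) =
      (l.map Subtype.val).flatMap fun p => encNats [p.1, p.2] := by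
    intro l
    rw [List.flatMap_map, List.flatMap_map]
    rfl
  have h' := h pairs.attach
  rw [List.attach_map_subtype_val] at h'
  rw [WDInst.encode, outWord, ← h']
  simp only [List.finRange_succ, List.finRange_zero, List.map_nil, List.flatMap_cons,
    List.flatMap_nil, List.append_nil]
  rfl

theorem yes_pairInst :
    (weightedDefinability binaryArity 1 independentSentence).yes (pairInst K N pairs hK hN hp) ↔
      ∃ S : Finset (Fin N), S.card = K ∧ ∀ i ∈ S, ∀ j ∈ S, ((i : ℕ), (j : ℕ)) ∉ pairs := by
  have hmem : ∀ x y : Fin N,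
      ![x, y] ∈ (pairInst K N pairs hK hN hp).str.rel 0 ↔ ((x : ℕ), (y : ℕ)) ∈ pairs := by
    intro x y
    change (![x, y] : Fin 2 → Fin N) ∈ pairs.attach.map _ ↔ _
    simp only [List.mem_map, List.mem_attach, true_and, Subtype.exists, Prod.exists]
    constructor
    · rintro ⟨a, b, h, hxy⟩
      have h0 : (a : ℕ) = x := congrArg Fin.val (congrFun hxy 0)
      have h1 : (b : ℕ) = y := congrArg Fin.val (congrFun hxy 1)
      rwa [← h0, ← h1]
    · exact fun h => ⟨x, y, h, rfl⟩
  have hsat : ∀ S : Finset (Fin 1 → Fin N),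
      (pairInst K N pairs hK hN hp).str.Sat independentSentence S ↔
        ∀ x y : Fin N, ¬ ((fun _ => x) ∈ S ∧ (fun _ => y) ∈ S ∧ ((x : ℕ), (y : ℕ)) ∈ pairs) := by
    intro S
    refine (sat_independentSentence (pairInst K N pairs hK hN hp).str S).trans ?_
    exact forall_congr' fun x => forall_congr' fun y =>
      not_congr (and_congr_right' (and_congr_right' (hmem x y)))
  let e := Equiv.funUnique (Fin 1) (Fin N)
  constructor
  · rintro ⟨S, hS, h⟩
    replace h := (hsat S).1 h
    change Finset (Fin 1 → Fin N) at S
    refine ⟨S.map e.toEmbedding, (Finset.card_map _).trans hS, fun i hi j hj hij => ?_⟩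
    rw [Finset.mem_map_equiv] at hi hj
    exact h i j ⟨hi, hj, hij⟩
  · rintro ⟨S, hS, h⟩
    refine ⟨S.map e.symm.toEmbedding, (Finset.card_map _).trans hS, (hsat _).2 fun x y => ?_⟩
    rintro ⟨hx, hy, hxy⟩
    exact h x (Finset.mem_map_equiv.1 hx) y (Finset.mem_map_equiv.1 hy) hxy

/-- A no-instance. -/
def noInst : WDInst binaryArity :=
  pairInst 1 1 [(0, 0)] one_pos one_pos (by simp)

theorem not_yes_noInst :
    ¬ (weightedDefinability binaryArity 1 independentSentence).yes noInst := by
  rw [noInst, yes_pairInst]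
  rintro ⟨S, hS, h⟩
  obtain ⟨x, rfl⟩ := Finset.card_eq_one.1 hS
  exact h x (by simp) x (by simp) (by simp)

end Independent

end ParamCSP

namespace ParamCSP

/-! ### The reduction -/

section Reduction

variable {Γ : BoolConstraintLanguage}

namespace RawConstraint

theorem positions_inter (c : RawConstraint Γ) (D : Finset ℕ) :
    c.positions (D ∩ c.scope.toFinset) = c.positions D := by
  ext j
  simp [positions]

theorem holds_inter (c : RawConstraint Γ) (D : Finset ℕ) :
    c.Holds D ↔ c.Holds (D ∩ c.scope.toFinset) := by
  rw [Holds, Holds, positions_inter]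

theorem card_inter_le (c : RawConstraint Γ) (D : Finset ℕ) :
    (D ∩ c.scope.toFinset).card ≤ (c.positions D).card := by
  refine (Finset.card_le_card fun v hv => ?_).trans (Finset.card_image_le (s := c.positions D)
    (f := fun j => c.scope[(j : ℕ)]'(by rw [c.length_scope]; exact j.2)))
  rw [Finset.mem_inter, List.mem_toFinset] at hv
  obtain ⟨i, hi, rfl⟩ := List.getElem_of_mem hv.2
  exact Finset.mem_image.2 ⟨⟨i, by rwa [← c.length_scope]⟩, by simpa [positions] using hv.1, rfl⟩

end RawConstraint

namespace CSPInst

/-- The constraints without the set of variables. -/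
def raws (I : CSPInst Γ) : List (RawConstraint Γ) := I.constraints.map Constraint.toRaw

theorem exists_satisfiedBy_iff (I : CSPInst Γ) : (∃ D, I.SatisfiedBy D) ↔
    ∃ D : Finset ℕ, D ⊆ Finset.range I.numVars ∧ D.card = I.weight ∧ ∀ c ∈ I.raws, c.Holds D := by
  have key : ∀ D : Finset (Fin I.numVars), I.SatisfiedBy D ↔
      (D.map Fin.valEmbedding).card = I.weight ∧
        ∀ c ∈ I.raws, c.Holds (D.map Fin.valEmbedding) := by
    intro D
    refine and_congr ?_ ?_
    · simp [Satisfies, weightRel]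
    · simp only [raws, List.forall_mem_map]
      refine forall₂_congr fun c _ => ?_
      have : c.toRaw.positions (D.map Fin.valEmbedding) =
          Finset.univ.filter fun j => c.scope j ∈ D := by
        ext j
        have h : c.toRaw.scope[(j : ℕ)]'(by rw [c.toRaw.length_scope]; exact j.2) =
            (c.scope j : ℕ) := by
          simp only [Constraint.toRaw, List.getElem_ofFn]
          rfl
        simp only [RawConstraint.positions, Finset.mem_filter, Finset.mem_univ, true_and, h]
        exact (Finset.mem_map' Fin.valEmbedding).trans
          ((Finset.mem_filter (p := fun j => c.scope j ∈ D)).trans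
            (and_iff_right (Finset.mem_univ j))).symm
      rw [RawConstraint.Holds, this]
      rfl
  constructor
  · rintro ⟨D, hD⟩
    refine ⟨D.map Fin.valEmbedding, fun v hv => ?_, (key D).1 hD⟩
    obtain ⟨j, -, rfl⟩ := Finset.mem_map.1 hv
    exact Finset.mem_range.2 j.2
  · rintro ⟨D, hD, h⟩
    have : (D.attachFin fun v hv => Finset.mem_range.1 (hD hv)).map Fin.valEmbedding = D := by
      simp
    refine ⟨D.attachFin fun v hv => Finset.mem_range.1 (hD hv), (key _).2 ?_⟩
    rwa [this]

end CSPInst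

theorem length_indexLists_pos (d k : ℕ) : 0 < (indexLists d k).length :=
  List.length_pos_of_mem (a := []) (by simp [indexLists, mem_incLists])

theorem length_incLists_le (j : ℕ) (l : List ℕ) :
    (incLists j l).length ≤ (l.length + 1) ^ j := by
  induction j generalizing l with
  | zero => simp [incLists]
  | succ j ih =>
    rw [incLists, List.length_cons, List.length_flatMap, pow_succ']
    have h : (l.map fun a => ((incLists j (l.filter fun b => decide (a < b))).map
        fun t => a :: t).length).sum ≤ l.length * (l.length + 1) ^ j := by
      refine (List.sum_le_card_nsmul _ ((l.length + 1) ^ j) ?_).trans (by simp)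
      simp only [List.forall_mem_map, List.length_map]
      exact fun a _ => (ih _).trans
        (Nat.pow_le_pow_left (Nat.succ_le_succ (List.length_filter_le _ _)) _)
    have := Nat.one_le_pow j (l.length + 1) (Nat.succ_pos _)
    rw [Nat.add_mul, Nat.one_mul]
    omega

variable (d : ℕ)

open Classical in
/-- The structure and the weight to which an instance is reduced. -/
noncomputable def CSPInst.reduct (I : CSPInst Γ) : WDInst binaryArity :=
  if I.weight ≤ I.numVars then
    pairInst (indexLists d I.weight).length (cells d I.weight I.numVars I.raws).length
      (conflicts d I.weight I.numVars I.raws RawConstraint.scope RawConstraint.good)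
      (length_indexLists_pos _ _) cells_length_pos fun p hp => by
        obtain ⟨a, b, h1, h2, -⟩ := (mem_conflicts _ _ _ _ _ _).1 hp
        exact ⟨(List.getElem?_eq_some_iff.1 h1).1, (List.getElem?_eq_some_iff.1 h2).1⟩
  else noInst

variable {d}

theorem CSPInst.yes_reduct_iff (hd : 1 ≤ d) (hsize : ∀ i, ∀ T ∈ Γ.rel i, T.card ≤ d)
    (I : CSPInst Γ) : (∃ D, I.SatisfiedBy D) ↔
      (weightedDefinability binaryArity 1 independentSentence).yes (I.reduct d) := by
  rw [I.exists_satisfiedBy_iff, reduct]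
  split_ifs with h
  · rw [yes_pairInst]
    exact (exists_independent_iff (P := RawConstraint.Holds) hd (by simp [RawConstraint.good])
      RawConstraint.holds_inter fun c D h => (c.card_inter_le D).trans (hsize _ _ h)).symm
  · refine iff_of_false ?_ not_yes_noInst
    rintro ⟨D, hD, hcard, -⟩
    have := Finset.card_le_card hD
    rw [Finset.card_range] at this
    omega

theorem CSPInst.weight_reduct_le (I : CSPInst Γ) :
    (I.reduct d).weight ≤ (I.weight + 1) ^ (d + 1) := by
  rw [reduct]
  split_ifs with h
  · change (indexLists d I.weight).length ≤ _
    simpa [indexLists] using length_incLists_le (d + 1) (List.range I.weight)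
  · exact Nat.one_le_pow _ _ (Nat.succ_pos _)

theorem CSPInst.encode_reduct (I : CSPInst Γ) : (I.reduct d).encode =
    if decide (I.weight ≤ I.numVars) then
      outWord (indexLists d I.weight).length (cells d I.weight I.numVars I.raws).length
        (conflicts d I.weight I.numVars I.raws RawConstraint.scope RawConstraint.good)
    else outWord 1 1 [(0, 0)] := by
  by_cases h : I.weight ≤ I.numVars
  · rw [reduct, if_pos h, encode_pairInst, if_pos (by simpa using h)]
  · rw [reduct, if_neg h, noInst, encode_pairInst, if_neg (by simpa using h)]

theorem computable_succ_pow (m : ℕ) : Computable fun k : ℕ => (k + 1) ^ m := by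
  refine Primrec.to_comp ?_
  induction m with
  | zero => simpa using Primrec.const 1
  | succ m ih => simpa only [pow_succ] using Primrec.nat_mul.comp ih Primrec.succ

end Reduction

/-! ### Programs on instances -/

section Programs

variable {Γ : BoolConstraintLanguage} {J : Type} [DecidableEq J] {O : MachineFamily J}

theorem valueUpTo_digits_of_le {N n : ℕ} (h : n ≤ N) : valueUpTo N (digits n) = n := by
  rw [valueUpTo_digits, min_eq_left h]

theorem ToTree.repr_list_congr {α β : Type} [ToTree α] [ToTree β] {l : List α} {f : α → β}
    (h : ∀ a, ToTree.repr a = ToTree.repr (f a)) :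
    ToTree.repr l = ToTree.repr (l.map f) := by
  change BTree.ofList (l.map ToTree.repr) = BTree.ofList ((l.map f).map ToTree.repr)
  rw [List.map_map]
  exact congrArg _ (List.map_congr_left fun a _ => h a)

namespace PT

theorem inst_encode : PT O fun I : CSPInst Γ => I.encode :=
  (id (O := O) (α := List Sym)).of_repr CSPInst.encode (fun _ => rfl) fun _ => rfl

theorem inst_numVars : PT O fun I : CSPInst Γ => I.numVars := by
  have h := inst_encode (O := O) (Γ := Γ)
  have h' : PT O fun I : CSPInst Γ =>
      ((ParamCSP.readLists I.encode).headD []).tail.length := by fun_prop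
  exact h'.congr fun I => by simp [I.readLists_encode, CSPInst.lists]

theorem inst_weightDigits : PT O fun I : CSPInst Γ => ParamCSP.digits I.weight := by
  have h := inst_encode (O := O) (Γ := Γ)
  have h' : PT O fun I : CSPInst Γ =>
      ((ParamCSP.readLists I.encode).headD []).headD [] := by fun_prop
  exact h'.congr fun I => by simp [I.readLists_encode, CSPInst.lists]

theorem inst_raws : PT O fun I : CSPInst Γ => I.raws := by
  have h := inst_encode (O := O) (Γ := Γ)
  have h2 := inst_numVars (O := O) (Γ := Γ)
  have h' : PT O fun I : CSPInst Γ => (ParamCSP.readLists I.encode).tail.map fun b =>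
      (b.headD [], b.tail.map fun w => ParamCSP.valueUpTo I.numVars w) := by fun_prop
  refine h'.of_repr (fun I => I) (fun _ => rfl) fun I => ?_
  rw [ToTree.repr_list_congr (l := I.raws) (f := fun c => (ParamCSP.digits c.idx, c.scope))
    fun _ => rfl]
  congr 1
  rw [I.readLists_encode, CSPInst.lists, CSPInst.raws, List.map_cons, List.tail_cons,
    List.map_map, List.map_map, List.map_map]
  refine List.map_congr_left fun c _ => ?_
  simp only [Function.comp_apply, Constraint.toRaw, List.map_cons, List.headD_cons,
    List.tail_cons, List.map_ofFn, Prod.mk.injEq, true_and]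
  exact congrArg _ (funext fun j => (valueUpTo_digits_of_le (c.scope j).2.le).symm)

theorem inst_encode_reduct (hgood : PT O fun x : RawConstraint Γ × List ℕ => x.1.good x.2)
    (d : ℕ) : PT O fun I : CSPInst Γ => (I.reduct d).encode := by
  have h1 := inst_numVars (O := O) (Γ := Γ)
  have h2 := inst_weightDigits (O := O) (Γ := Γ)
  have h3 := inst_raws (O := O) (Γ := Γ)
  have h4 : PT O fun I : CSPInst Γ =>
      ParamCSP.valueUpTo (I.numVars + 1) (ParamCSP.digits I.weight) := by fun_prop
  have h5 := conflicts hgood d h4 h1 h3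
  have h6 : PT O fun I : CSPInst Γ =>
      if decide (ParamCSP.valueUpTo (I.numVars + 1) (ParamCSP.digits I.weight) ≤ I.numVars) then
        ParamCSP.outWord
          (ParamCSP.indexLists d
            (ParamCSP.valueUpTo (I.numVars + 1) (ParamCSP.digits I.weight))).length
          (ParamCSP.cells d (ParamCSP.valueUpTo (I.numVars + 1) (ParamCSP.digits I.weight))
            I.numVars I.raws).length
          (ParamCSP.conflicts d
            (ParamCSP.valueUpTo (I.numVars + 1) (ParamCSP.digits I.weight)) I.numVars I.raws
            RawConstraint.scope RawConstraint.good)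
      else ParamCSP.outWord 1 1 [(0, 0)] := by fun_prop
  refine h6.congr fun I => ?_
  rw [I.encode_reduct, valueUpTo_digits]
  by_cases h : I.weight ≤ I.numVars
  · rw [min_eq_left (by omega)]
  · rw [if_neg (by simpa using h), if_neg (by simp; omega)]

theorem inst_encNat_weight : PT O fun I : CSPInst Γ => ParamCSP.encNat I.weight := by
  have h := inst_weightDigits (O := O) (Γ := Γ)
  have h' : PT O fun I : CSPInst Γ => ParamCSP.digits I.weight ++ [Sym.comma] := by fun_prop
  exact h'

end PT

end Programs

end ParamCSP

namespace ParamCSP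

open Turing

section Language

variable {Γ : BoolConstraintLanguage}

theorem digits_injective : Function.Injective digits := fun m n h => by
  have h1 := valueUpTo_digits (max m n) m
  rw [h, valueUpTo_digits, min_eq_left (le_max_left _ _), min_eq_left (le_max_right _ _)] at h1
  exact h1.symm

theorem CSPInst.encode_injective : Function.Injective (CSPInst.encode (Γ := Γ)) := by
  intro I I' h
  have h1 := congrArg readLists h
  rw [I.readLists_encode, I'.readLists_encode] at h1
  have h2 := (List.map_injective_iff.2 (List.map_injective_iff.2 digits_injective)) h1
  obtain ⟨n, k, cs⟩ := I
  obtain ⟨n', k', cs'⟩ := I'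
  simp only [CSPInst.lists, List.cons.injEq] at h2
  obtain ⟨⟨rfl, h3⟩, h4⟩ := h2
  obtain rfl : n = n' := by simpa using congrArg List.length h3
  congr 1
  refine (List.map_injective_iff.2 ?_) h4
  rintro ⟨i, s⟩ ⟨i', s'⟩ hc
  obtain ⟨rfl, hs⟩ := List.cons.inj hc
  congr 1
  exact funext fun j => Fin.ext (congrFun (List.ofFn_injective hs) j)

open Classical in
/-- A program on instances, extended to all strings. -/
theorem PT.of_encode {J : Type} [DecidableEq J] {O : MachineFamily J}
    (hrec : PT O fun w : List Sym => decide (∃ I : CSPInst Γ, I.encode = w))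
    {F : CSPInst Γ → List Sym} (hF : PT O F) (v : List Sym) :
    PT O fun w : List Sym => if h : ∃ I : CSPInst Γ, I.encode = w then F h.choose else v := by
  refine (PT.dite hrec (f := fun w => F (of_decide_eq_true w.2).choose) (g := fun _ => v)
    (hF.of_repr (fun w => (of_decide_eq_true w.2).choose) (fun w => ?_) fun _ => rfl)
    (const v)).congr fun w => ?_
  · exact congrArg ToTree.repr (of_decide_eq_true w.2).choose_spec.symm
  · by_cases h : ∃ I : CSPInst Γ, I.encode = w
    · rw [dif_pos h, dif_pos (decide_eq_true h)]
    · rw [dif_neg h, dif_neg (by simpa using h)]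

theorem weightCSP_inW1 (hΓ : Γ.FPTMembershipCheckable) {d : ℕ} (hd : 1 ≤ d)
    (hsize : ∀ i, ∀ T ∈ Γ.rel i, T.card ≤ d) : InW1 (weightCSP Γ) := by
  obtain ⟨g, p, -, M, hM⟩ := hΓ
  let O : MachineFamily Unit := ⟨fun _ => M⟩
  have hgood := PT.raw_good (O := O) hsize () hM
  obtain ⟨q, hq⟩ := PT.computableWithin (ea := CSPInst.encode) (eb := WDInst.encode)
    (G := CSPInst.reduct d) (PT.inst_encode_reduct hgood d) (fun _ => rfl) fun _ => rfl
  refine ⟨PT.computableWithin (O := O) PT.inst_encNat_weight (fun _ => rfl) fun _ => rfl,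
    1, binaryArity, 1, independentSentence, fun _ => two_pos, one_pos,
    isUniversal_independentSentence, CSPInst.reduct d, CSPInst.yes_reduct_iff hd hsize,
    ⟨fun _ => 1, q, Computable.const 1, by simp only [one_mul]; exact hq⟩,
    _, computable_succ_pow (d + 1), CSPInst.weight_reduct_le⟩

open Classical in
theorem asLanguage_weightCSP_inW1 (hΓ : Γ.FPTMembershipCheckable) {d : ℕ} (hd : 1 ≤ d)
    (hsize : ∀ i, ∀ T ∈ Γ.rel i, T.card ≤ d) (hrec : (weightCSP Γ).PolyTimeRecognizable) :
    InW1 (weightCSP Γ).asLanguage := by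
  obtain ⟨g, p, -, M, hM⟩ := hΓ
  obtain ⟨r, M', hM'⟩ := hrec
  let O : MachineFamily Bool := ⟨fun b => if b then M else M'⟩
  have hgood := PT.raw_good (O := O) hsize true hM
  have hrec' : PT O fun w : List Sym => decide (∃ I : CSPInst Γ, I.encode = w) := by
    have h1 : PT O fun w : List Sym => encBool (decide (∃ I : CSPInst Γ, I.encode = w)) := by
      refine PT.oracle false PT.id (q := fun n => r.eval n + 1)
        (((IsPoly.eval r).comp IsPoly.id).add_const 1) (fun w => by simp [encBool]) fun w => ?_
      obtain ⟨h⟩ := hM' w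
      exact ⟨⟨h.toEvalsTo, h.steps_le_m.trans
        ((polynomial_eval_monotone r (length_le_tsize w)).trans (Nat.le_add_right _ 1))⟩⟩
    have h2 : PT O fun w : List Sym =>
        (encBool (decide (∃ I : CSPInst Γ, I.encode = w))).headD Sym.zero == Sym.one := by
      fun_prop
    refine h2.congr fun w => ?_
    cases decide (∃ I : CSPInst Γ, I.encode = w) <;> rfl
  have hparam : ∀ I : CSPInst Γ, (weightCSP Γ).asLanguage.param I.encode = I.weight := by
    intro I
    have : {k | ∃ x : CSPInst Γ, x.encode = I.encode ∧ x.weight = k} = {I.weight} := by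
      ext k
      constructor
      · rintro ⟨x, hx, rfl⟩
        rw [CSPInst.encode_injective hx]
        rfl
      · rintro rfl
        exact ⟨I, rfl, rfl⟩
    change sInf {k | ∃ x : CSPInst Γ, x.encode = I.encode ∧ x.weight = k} = _
    rw [this, csInf_singleton]
  have hparam0 : ∀ w, (¬ ∃ I : CSPInst Γ, I.encode = w) →
      (weightCSP Γ).asLanguage.param w = 0 := by
    intro w hw
    have : {k | ∃ x : CSPInst Γ, x.encode = w ∧ x.weight = k} = ∅ :=
      Set.eq_empty_of_forall_notMem fun k ⟨x, hx, _⟩ => hw ⟨x, hx⟩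
    change sInf {k | ∃ x : CSPInst Γ, x.encode = w ∧ x.weight = k} = _
    rw [this, Nat.sInf_empty]
  let R : List Sym → WDInst binaryArity := fun w =>
    if h : ∃ I : CSPInst Γ, I.encode = w then h.choose.reduct d else noInst
  obtain ⟨q, hq⟩ := PT.computableWithin (ea := fun w : List Sym => w) (eb := WDInst.encode)
    (G := R) (PT.of_encode hrec' (PT.inst_encode_reduct hgood d) noInst.encode) (fun _ => rfl)
    fun w => (apply_dite WDInst.encode _ _ _).symm
  refine ⟨PT.computableWithin (ea := fun w : List Sym => w)
      (PT.of_encode hrec' PT.inst_encNat_weight (encNat 0)) (fun _ => rfl) fun w => ?_,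
    1, binaryArity, 1, independentSentence, fun _ => two_pos, one_pos,
    isUniversal_independentSentence, R, fun w => ?_,
    ⟨fun _ => 1, q, Computable.const 1, by simp only [one_mul]; exact hq⟩,
    _, computable_succ_pow (d + 1), fun w => ?_⟩
  · by_cases h : ∃ I : CSPInst Γ, I.encode = w
    · rw [dif_pos h, ← hparam h.choose, h.choose_spec]
    · rw [dif_neg h, hparam0 w h]
  · change (∃ I : CSPInst Γ, I.encode = w ∧ ∃ D, I.SatisfiedBy D) ↔ _
    by_cases h : ∃ I : CSPInst Γ, I.encode = w
    · simp only [R, dif_pos h]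
      rw [← CSPInst.yes_reduct_iff hd hsize]
      constructor
      · rintro ⟨I, hI, hD⟩
        rwa [← CSPInst.encode_injective (hI.trans h.choose_spec.symm)]
      · exact fun hD => ⟨_, h.choose_spec, hD⟩
    · simp only [R, dif_neg h]
      exact iff_of_false (fun ⟨I, hI, _⟩ => h ⟨I, hI⟩) not_yes_noInst
  · change (R w).weight ≤ _
    by_cases h : ∃ I : CSPInst Γ, I.encode = w
    · simp only [R, dif_pos h]
      have := hparam h.choose
      rw [h.choose_spec] at this
      rw [this]
      exact h.choose.weight_reduct_le
    · simp only [R, dif_neg h]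
      exact Nat.one_le_pow _ _ (Nat.succ_pos _)

end Language

end ParamCSP

theorem mainTheorem1 (Γ : ParamCSP.BoolConstraintLanguage) (hΓ : Γ.FPTMembershipCheckable)
    (d : ℕ) (hd : 1 ≤ d) (hsize : ∀ i, ∀ T ∈ Γ.rel i, T.card ≤ d) :
    ParamCSP.InW1 (ParamCSP.weightCSP Γ) ∧
      ((ParamCSP.weightCSP Γ).PolyTimeRecognizable →
        ParamCSP.InW1 (ParamCSP.weightCSP Γ).asLanguage) :=
  ⟨ParamCSP.weightCSP_inW1 hΓ hd hsize, ParamCSP.asLanguage_weightCSP_inW1 hΓ hd hsize⟩
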